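/- Let $\mu$ be a Radon measure on a $\sigma$-compact locally compact Hausdorff space $X$, let $(H_x)_{x\in X}$ be a $\mu$-measurable field of Hilbert spaces, and let $(M_x,\tau_x)_{x\in X}$ be a measurable field of tracial von Neumann algebras $M_x\subseteq B(H_x)$: for almost every $x$, $M_x$ is generated by the values at $x$ of one fixed sequence of measurable, essentially bounded fields of operators, and $\tau_x$ is a faithful normal finite trace on $M_x$ (not necessarily normalized). Let $M=\int_X^{\oplus}M_x\,d\mu(x)$ act on $\int_X^{\oplus}H_x\,d\mu(x)$, with trace $\tau=\int_X w(x)\,\tau_x\,d\mu(x)$ for some weight $w>0$ almost everywhere, i.e. for every $T=\int_X^\oplus T_x\,d\mu(x)\in M$ the function $x\mapsto w(x)\tau_x(T_x)$ is integrable and $\tau(T)=\int_X w(x)\tau_x(T_x)\,d\mu(x)$. Let $(P_x)_{x\in X}$ be a measurable field of von Neumann algebras, $P_x\subseteq B(H_x)$, such that $P=\int_X^{\oplus}P_x\,d\mu(x)\subseteq M$; thus $L^\infty(X,\mu)\subseteq P\subseteq M$, where $L^\infty(X,\mu)$ is the algebra of diagonal operators (contained in the center of $M$, for instance equal to it). For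 an algebra $A$ of operators with trace $\tau$ and a subalgebra $B\subseteq A$, let $\mathbb E_B:A\to B$ be the $\tau$-preserving conditional expectation. The inclusion $B\subseteq A$ has finite index (with respect to $\tau$) if it has a finite Pimsner-Popa basis: there are finitely many $m_1,\dots,m_k\in A$ and nonzero projections $p_1,\dots,p_k\in B$ such that $\mathbb E_B(m_im_j^*)=\delta_{ij}p_i$ for all $i,j$ and $y=\sum_{i=1}^k\mathbb E_B(ym_i^*)m_i$ for all $y\in A$. Assume that $P\subseteq M$ has finite index with respect to $\tau$. Then for almost every $x\in X$ one has $P_x\subseteq M_x$ and this inclusion has finite index with respect to $\tau_x$. In particular, suppose $P=L^\infty(X,\mu)\,\overline\otimes\,Q$ for a von Neumann algebra $Q$ on $\int_X^{\oplus}H_x\,d\mu(x)$ (necessarily contained in $P$), that is, there is a $*$-isomorphism of the von Neumann algebra tensor product $L^\infty(X,\mu)\,\overline\otimes\,Q$ onto $P$ that sends $f\otimes 1$ to the diagonal operator $\int_X^\oplus f(x)\,d\mu(x)$ and $1\otimes q$ to $q$. Then for almost every $x\in X$ there is a von Neumann subalgebra $N\subseteq M_x$ that is $*$-isomorphic to $Q$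 and has finite index in $M_x$ with respect to $\tau_x$. -/

import Mathlib

open MeasureTheory Filter Topology
open scoped ENNReal

universe u v

/-! ### Operator algebras on one Hilbert space -/

section Algebras

variable {K : Type*} [NormedAddCommGroup K] [InnerProductSpace ℂ K] [CompleteSpace K]

/-- `W*(s)`: the von Neumann algebra generated by a set `s` of bounded operators, that is, the
double commutant of `s ∪ s*`. -/
noncomputable def generatedVonNeumannAlgebra (s : Set (K →L[ℂ] K)) : VonNeumannAlgebra K where
  toStarSubalgebra := StarSubalgebra.centralizer ℂ (StarSubalgebra.centralizer ℂ s : Set (K →L[ℂ] K))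
  centralizer_centralizer' := by
    change Set.centralizer (Set.centralizer
      ((StarSubalgebra.centralizer ℂ
        (StarSubalgebra.centralizer ℂ s : Set (K →L[ℂ] K)) : StarSubalgebra ℂ (K →L[ℂ] K)) :
          Set (K →L[ℂ] K))) =
      ((StarSubalgebra.centralizer ℂ
        (StarSubalgebra.centralizer ℂ s : Set (K →L[ℂ] K)) : StarSubalgebra ℂ (K →L[ℂ] K)) :
          Set (K →L[ℂ] K))
    rw [StarSubalgebra.coe_centralizer_centralizer, Set.centralizer_centralizer_centralizer]

/-- `τ` is a faithful normal finite trace on the algebra `A` of operators on `K`. Normality of a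
positive functional is membership in the predual: `τ(a) = ∑ₙ ⟨ξₙ, a ξₙ⟩` for a square-summable
sequence of vectors `ξₙ`. The trace is not required to be normalized. -/
structure IsFaithfulNormalTrace {A : StarSubalgebra ℂ (K →L[ℂ] K)} (τ : A →ₗ[ℂ] ℂ) : Prop where
  normal : ∃ ξ : ℕ → K, (Summable fun n => ‖ξ n‖ ^ 2) ∧
    ∀ a : A, HasSum (fun n => inner ℂ (ξ n) ((a : K →L[ℂ] K) (ξ n))) (τ a)
  tracial : ∀ a b : A, τ (a * b) = τ (b * a)
  faithful : ∀ a : A, τ (star a * a) = 0 → a = 0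

/-- `E : A → A` is the `τ`-preserving conditional expectation of `A` onto its subalgebra `B`.
For a faithful trace `τ` there is at most one such map, and it is automatically positive. -/
structure IsTraceExpectation {A : StarSubalgebra ℂ (K →L[ℂ] K)} (τ : A →ₗ[ℂ] ℂ)
    (B : StarSubalgebra ℂ (K →L[ℂ] K)) (E : A →ₗ[ℂ] A) : Prop where
  mem : ∀ a : A, (E a : K →L[ℂ] K) ∈ B
  fixes : ∀ b : A, (b : K →L[ℂ] K) ∈ B → E b = b
  bimodular : ∀ a b c : A, (b : K →L[ℂ] K) ∈ B → (c : K →L[ℂ] K) ∈ B →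
    E (b * a * c) = b * E a * c
  preserves : ∀ a : A, τ (E a) = τ a

/-- The inclusion `B ⊆ A` has finite index with respect to the trace `τ` of `A`: with `E` the
`τ`-preserving conditional expectation onto `B`, there is a finite Pimsner-Popa basis
`m₁, …, mₖ` of `A` over `B`, i.e. `E(mᵢ mⱼ*) = δᵢⱼ pᵢ` for nonzero projections `pᵢ ∈ B`, and
`y = ∑ᵢ E(y mᵢ*) mᵢ` for every `y ∈ A`. -/
def IsFiniteIndex {A : StarSubalgebra ℂ (K →L[ℂ] K)} (τ : A →ₗ[ℂ] ℂ)
    (B : StarSubalgebra ℂ (K →L[ℂ] K)) : Prop :=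
  B ≤ A ∧ ∃ E : A →ₗ[ℂ] A, IsTraceExpectation τ B E ∧
    ∃ (k : ℕ) (m p : Fin k → A),
      (∀ i, (p i : K →L[ℂ] K) ∈ B ∧ IsStarProjection (p i) ∧ p i ≠ 0) ∧
      (∀ i j, E (m i * star (m j)) = if i = j then p i else 0) ∧
      ∀ y : A, y = ∑ i, E (y * star (m i)) * m i

/-- The von Neumann algebra `L^∞(X, μ) ⊗̄ Q` on `L²(X, μ; K) = L²(X, μ) ⊗ K`, generated by the
multiplication operators `f ⊗ 1` and by the operators `1 ⊗ q`, `q ∈ Q`, acting pointwise. -/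
noncomputable def linftyTensor {X : Type*} [MeasurableSpace X] (μ : Measure X)
    (Q : VonNeumannAlgebra K) : VonNeumannAlgebra (Lp K 2 μ) :=
  generatedVonNeumannAlgebra
    ({S | ∃ f : Lp ℂ ∞ μ, S = (ContinuousLinearMap.lsmul ℂ ℂ).holderL μ ∞ 2 2 f} ∪
      {S | ∃ q ∈ Q, S = q.compLpL 2 μ})

end Algebras

/-! ### Measurable fields of Hilbert spaces and their direct integral -/

/-- The structure of a measurable field on a family `H x` of Hilbert spaces. Measurability is
`μ`-measurability, i.e. measurability up to `μ`-null sets. -/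
structure MeasurableHilbertField {X : Type u} [MeasurableSpace X] (μ : Measure X)
    (H : X → Type v) [∀ x, NormedAddCommGroup (H x)] [∀ x, InnerProductSpace ℂ (H x)] where
  /-- the measurable sections -/
  sections : Submodule ℂ (∀ x, H x)
  mem_sections_iff : ∀ η : ∀ x, H x, η ∈ sections ↔
    ∀ ζ ∈ sections, AEStronglyMeasurable (fun x => inner ℂ (ζ x) (η x)) μ
  exists_fundamental : ∃ ζ : ℕ → ∀ x, H x, (∀ n, ζ n ∈ sections) ∧
    ∀ᵐ x ∂μ, (Submodule.span ℂ (Set.range fun n => ζ n x)).topologicalClosure = ⊤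

namespace MeasurableHilbertField

variable {X : Type u} [MeasurableSpace X] {μ : Measure X} {H : X → Type v}
  [∀ x, NormedAddCommGroup (H x)] [∀ x, InnerProductSpace ℂ (H x)]
  (F : MeasurableHilbertField μ H)

theorem aesm_inner {ζ η : ∀ x, H x} (hζ : ζ ∈ F.sections) (hη : η ∈ F.sections) :
    AEStronglyMeasurable (fun x => inner ℂ (ζ x) (η x)) μ :=
  (F.mem_sections_iff η).1 hη ζ hζ

theorem aesm_norm {ζ : ∀ x, H x} (hζ : ζ ∈ F.sections) :
    AEStronglyMeasurable (fun x => ‖ζ x‖) μ := by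
  have h := (F.aesm_inner hζ hζ).norm
  have h2 : (fun x => ‖ζ x‖) = fun x => Real.sqrt ‖(inner ℂ (ζ x) (ζ x) : ℂ)‖ := by
    funext x
    rw [inner_self_eq_norm_sq_to_K]
    simp
  rw [h2]
  exact Real.continuous_sqrt.comp_aestronglyMeasurable h

/-- Square-integrable measurable sections (before identification of sections that agree almost
everywhere). -/
def sqIntegrableSections : Submodule ℂ (∀ x, H x) where
  carrier := {ζ | ζ ∈ F.sections ∧ Integrable (fun x => ‖ζ x‖ ^ 2) μ}
  zero_mem' := ⟨F.sections.zero_mem, by simp⟩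
  add_mem' := by
    rintro ζ η ⟨h1, h2⟩ ⟨h3, h4⟩
    refine ⟨F.sections.add_mem h1 h3, ?_⟩
    refine ((h2.const_mul 2).add (h4.const_mul 2)).mono
      ((F.aesm_norm (F.sections.add_mem h1 h3)).pow 2) (Eventually.of_forall fun x => ?_)
    have : ‖(ζ + η) x‖ ≤ ‖ζ x‖ + ‖η x‖ := norm_add_le _ _
    simp only [Pi.add_apply, Real.norm_eq_abs]
    rw [abs_of_nonneg (by positivity), abs_of_nonneg (by positivity)]
    have h0 : 0 ≤ ‖(ζ + η) x‖ := norm_nonneg _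
    simp only [Pi.add_apply] at this h0
    nlinarith [sq_nonneg (‖ζ x‖ - ‖η x‖), norm_nonneg (ζ x), norm_nonneg (η x)]
  smul_mem' := by
    rintro c ζ ⟨h1, h2⟩
    refine ⟨F.sections.smul_mem c h1, ?_⟩
    simp only [Pi.smul_apply, norm_smul, mul_pow]
    exact h2.const_mul _

/-- The type of square-integrable sections, with the semi-inner product
`⟨ζ, η⟩ = ∫ ⟨ζ(x), η(x)⟩ dμ(x)`. -/
def PreDirectIntegral : Type (max u v) := F.sqIntegrableSections

namespace PreDirectIntegral

instance : AddCommGroup F.PreDirectIntegral := inferInstanceAs (AddCommGroup F.sqIntegrableSections)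
noncomputable instance : Module ℂ F.PreDirectIntegral :=
  inferInstanceAs (Module ℂ F.sqIntegrableSections)

variable {F}

/-- The underlying section. -/
def val (ζ : F.PreDirectIntegral) : ∀ x, H x := Subtype.val ζ

theorem val_add (ζ η : F.PreDirectIntegral) : (ζ + η).val = ζ.val + η.val := rfl
theorem val_sub (ζ η : F.PreDirectIntegral) : (ζ - η).val = ζ.val - η.val := rfl
theorem val_smul (c : ℂ) (ζ : F.PreDirectIntegral) : (c • ζ).val = c • ζ.val := rfl
theorem mem (ζ : F.PreDirectIntegral) : ζ.val ∈ F.sections := ζ.2.1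
theorem integrable_sq (ζ : F.PreDirectIntegral) : Integrable (fun x => ‖ζ.val x‖ ^ 2) μ := ζ.2.2

theorem integrable_inner (ζ η : F.PreDirectIntegral) :
    Integrable (fun x => (inner ℂ (ζ.val x) (η.val x) : ℂ)) μ := by
  refine (ζ.integrable_sq.add η.integrable_sq).mono (F.aesm_inner ζ.mem η.mem)
    (Eventually.of_forall fun x => ?_)
  have h := norm_inner_le_norm (𝕜 := ℂ) (ζ.val x) (η.val x)
  simp only [Pi.add_apply, Real.norm_eq_abs]
  rw [abs_of_nonneg (by positivity)]
  nlinarith [sq_nonneg (‖ζ.val x‖ - ‖η.val x‖), norm_nonneg (ζ.val x), norm_nonneg (η.val x)]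

noncomputable instance preCore : PreInnerProductSpace.Core ℂ F.PreDirectIntegral where
  inner ζ η := ∫ x, inner ℂ (ζ.val x) (η.val x) ∂μ
  conj_inner_symm ζ η := by
    rw [← integral_conj]
    simp [inner_conj_symm]
  re_inner_nonneg ζ := by
    have : ∫ x, (inner ℂ (ζ.val x) (ζ.val x) : ℂ) ∂μ = ((∫ x, ‖ζ.val x‖ ^ 2 ∂μ : ℝ) : ℂ) := by
      rw [← integral_complex_ofReal]
      refine integral_congr_ae (Eventually.of_forall fun x => ?_)
      simp [inner_self_eq_norm_sq_to_K]
    rw [this]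
    simpa using integral_nonneg fun x => by positivity
  add_left ζ η ξ := by
    rw [← integral_add (integrable_inner _ _) (integrable_inner _ _)]
    simp only [val_add, Pi.add_apply, inner_add_left]
  smul_left ζ η r := by
    rw [← integral_const_mul]
    simp only [val_smul, Pi.smul_apply, inner_smul_left]

noncomputable instance : SeminormedAddCommGroup F.PreDirectIntegral :=
  InnerProductSpace.Core.toSeminormedAddCommGroup (𝕜 := ℂ)

noncomputable instance : InnerProductSpace ℂ F.PreDirectIntegral :=
  InnerProductSpace.ofCore preCore

theorem inner_def (ζ η : F.PreDirectIntegral) :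
    inner ℂ ζ η = ∫ x, inner ℂ (ζ.val x) (η.val x) ∂μ := rfl

theorem norm_sq (ζ : F.PreDirectIntegral) : ‖ζ‖ ^ 2 = ∫ x, ‖ζ.val x‖ ^ 2 ∂μ := by
  have h : ((‖ζ‖ ^ 2 : ℝ) : ℂ) = ((∫ x, ‖ζ.val x‖ ^ 2 ∂μ : ℝ) : ℂ) := by
    have := inner_self_eq_norm_sq_to_K (𝕜 := ℂ) ζ
    rw [inner_def] at this
    rw [← integral_complex_ofReal]
    push_cast
    refine Eq.trans this.symm (integral_congr_ae (Eventually.of_forall fun x => ?_))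
    simp [inner_self_eq_norm_sq_to_K]
  exact_mod_cast h

theorem lintegral_sq (ζ : F.PreDirectIntegral) :
    ∫⁻ x, ENNReal.ofReal (‖ζ.val x‖ ^ 2) ∂μ = ENNReal.ofReal (‖ζ‖ ^ 2) := by
  rw [norm_sq, ofReal_integral_eq_lintegral_ofReal ζ.integrable_sq
    (Eventually.of_forall fun x => by positivity)]

/-- The space of square-integrable sections is complete (Riesz-Fischer). -/
instance [∀ x, CompleteSpace (H x)] : CompleteSpace F.PreDirectIntegral := by
  classical
  refine Metric.complete_of_convergent_controlled_sequences (fun n => (1 / 4 : ℝ) ^ n)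
    (fun n => by positivity) fun u hu => ?_
  have hmeas : ∀ n m : ℕ,
      AEMeasurable (fun x => ENNReal.ofReal (‖(u n).val x - (u m).val x‖ ^ 2)) μ := fun n m =>
    (((F.aesm_norm (u n - u m).mem).pow 2).aemeasurable).ennreal_ofReal
  have hdiff : ∀ N n m, N ≤ n → N ≤ m →
      ∫⁻ x, ENNReal.ofReal (‖(u n).val x - (u m).val x‖ ^ 2) ∂μ
        ≤ ENNReal.ofReal (((1 / 4 : ℝ) ^ N) ^ 2) := by
    intro N n m hn hm
    have h1 := lintegral_sq (u n - u m)
    simp only [val_sub, Pi.sub_apply] at h1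
    rw [h1]
    refine ENNReal.ofReal_le_ofReal ?_
    have := hu N n m hn hm
    rw [dist_eq_norm] at this
    gcongr
  -- almost everywhere the sequence is Cauchy
  have hsum : ∫⁻ x, ∑' n, ENNReal.ofReal (4 ^ n * ‖(u n).val x - (u (n + 1)).val x‖ ^ 2) ∂μ
      ≠ ∞ := by
    rw [lintegral_tsum]
    · have hb : ∀ n, ∫⁻ x, ENNReal.ofReal (4 ^ n * ‖(u n).val x - (u (n + 1)).val x‖ ^ 2) ∂μ
          ≤ ENNReal.ofReal ((1 / 4 : ℝ) ^ n) := by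
        intro n
        have h4 : (0 : ℝ) ≤ 4 ^ n := by positivity
        simp_rw [ENNReal.ofReal_mul h4]
        rw [lintegral_const_mul'' _ (hmeas n (n + 1))]
        refine (mul_le_mul_right (hdiff n n (n + 1) le_rfl (Nat.le_succ n)) _).trans ?_
        rw [← ENNReal.ofReal_mul h4]
        refine ENNReal.ofReal_le_ofReal (le_of_eq ?_)
        rw [sq, ← mul_assoc, ← mul_pow]
        norm_num
      refine ne_top_of_le_ne_top ?_ (ENNReal.tsum_le_tsum hb)
      have hs : Summable fun n : ℕ => (1 / 4 : ℝ) ^ n :=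
        summable_geometric_of_lt_one (by norm_num) (by norm_num)
      rw [← ENNReal.ofReal_tsum_of_nonneg (fun n => by positivity) hs]
      exact ENNReal.ofReal_ne_top
    · intro n
      have h4 : (0 : ℝ) ≤ 4 ^ n := by positivity
      simp_rw [ENNReal.ofReal_mul h4]
      exact (hmeas n (n + 1)).const_mul _
  have hcauchy : ∀ᵐ x ∂μ, CauchySeq fun n => (u n).val x := by
    have hm : AEMeasurable (fun x => ∑' n,
        ENNReal.ofReal (4 ^ n * ‖(u n).val x - (u (n + 1)).val x‖ ^ 2)) μ := by
      refine AEMeasurable.tsum fun n => ?_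
      have h4 : (0 : ℝ) ≤ 4 ^ n := by positivity
      simp_rw [ENNReal.ofReal_mul h4]
      exact (hmeas n (n + 1)).const_mul _
    filter_upwards [ae_lt_top' hm hsum] with x hx
    set C : ℝ := (∑' n, ENNReal.ofReal
      (4 ^ n * ‖(u n).val x - (u (n + 1)).val x‖ ^ 2)).toReal with hC
    have hC0 : 0 ≤ C := ENNReal.toReal_nonneg
    refine cauchySeq_of_le_geometric (1 / 2) (Real.sqrt C) (by norm_num) fun n => ?_
    have h1 : 4 ^ n * ‖(u n).val x - (u (n + 1)).val x‖ ^ 2 ≤ C := by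
      have h2 := ENNReal.le_tsum (f := fun n => ENNReal.ofReal
        (4 ^ n * ‖(u n).val x - (u (n + 1)).val x‖ ^ 2)) n
      exact (ENNReal.ofReal_le_iff_le_toReal hx.ne).1 h2
    have h3 : (2 ^ n * ‖(u n).val x - (u (n + 1)).val x‖) ^ 2 ≤ C := by
      rw [mul_pow, ← pow_mul, mul_comm n 2, pow_mul]
      norm_num
      exact h1
    have h5 := Real.le_sqrt_of_sq_le h3
    rw [dist_eq_norm, div_pow, one_pow, mul_one_div, le_div_iff₀ (by positivity)]
    linarith
  -- the limit section
  set ζ : ∀ x, H x := fun x =>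
    if h : CauchySeq fun n => (u n).val x then (cauchySeq_tendsto_of_complete h).choose else 0
    with hζ
  have hlim : ∀ᵐ x ∂μ, Tendsto (fun n => (u n).val x) atTop (𝓝 (ζ x)) := by
    filter_upwards [hcauchy] with x hx
    simp only [hζ, dif_pos hx]
    exact (cauchySeq_tendsto_of_complete hx).choose_spec
  have hζS : ζ ∈ F.sections := by
    refine (F.mem_sections_iff ζ).2 fun ξ hξ => ?_
    refine aestronglyMeasurable_of_tendsto_ae atTop (fun n => F.aesm_inner hξ (u n).mem) ?_
    filter_upwards [hlim] with x hx
    exact (tendsto_const_nhds (x := ξ x)).inner hx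
  have hfatou : ∀ N, ∫⁻ x, ENNReal.ofReal (‖(u N).val x - ζ x‖ ^ 2) ∂μ
      ≤ ENNReal.ofReal (((1 / 4 : ℝ) ^ N) ^ 2) := by
    intro N
    have h1 : ∫⁻ x, ENNReal.ofReal (‖(u N).val x - ζ x‖ ^ 2) ∂μ
        = ∫⁻ x, liminf (fun m => ENNReal.ofReal (‖(u N).val x - (u m).val x‖ ^ 2)) atTop ∂μ := by
      refine lintegral_congr_ae ?_
      filter_upwards [hlim] with x hx
      refine (Tendsto.liminf_eq ?_).symm
      exact ENNReal.tendsto_ofReal ((tendsto_const_nhds.sub hx).norm.pow 2)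
    rw [h1]
    refine (lintegral_liminf_le' fun m => hmeas N m).trans ?_
    refine liminf_le_of_frequently_le' (Eventually.frequently ?_)
    filter_upwards [eventually_ge_atTop N] with m hm
    exact hdiff N N m le_rfl hm
  have hsq : ∀ N, (u N).val - ζ ∈ F.sqIntegrableSections := by
    intro N
    have hS := F.sections.sub_mem (u N).mem hζS
    refine ⟨hS, (F.aesm_norm hS).pow 2, ?_⟩
    rw [hasFiniteIntegral_iff_ofReal (Eventually.of_forall fun x => by positivity)]
    exact (hfatou N).trans_lt ENNReal.ofReal_lt_top
  have hζ2 : ζ ∈ F.sqIntegrableSections := by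
    have := F.sqIntegrableSections.sub_mem (u 0).2 (hsq 0)
    have he : (u 0).val - ((u 0).val - ζ) = ζ := by abel
    exact he ▸ this
  let z : F.PreDirectIntegral := ⟨ζ, hζ2⟩
  refine ⟨z, ?_⟩
  rw [tendsto_iff_dist_tendsto_zero]
  refine squeeze_zero (fun _ => dist_nonneg) (g := fun n => (1 / 4 : ℝ) ^ n) (fun N => ?_)
    (tendsto_pow_atTop_nhds_zero_of_lt_one (by norm_num) (by norm_num))
  rw [dist_eq_norm]
  have h1 := lintegral_sq (u N - z)
  have h2 := (h1.symm.le.trans (hfatou N))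
  rw [ENNReal.ofReal_le_ofReal_iff (by positivity)] at h2
  exact (abs_le_of_sq_le_sq' h2 (by positivity)).2

end PreDirectIntegral

/-- The direct integral Hilbert space `∫^⊕ H x dμ(x)`: square-integrable measurable sections, two
sections being identified when they agree almost everywhere (i.e. are at distance `0`). -/
abbrev DirectIntegral : Type (max u v) := SeparationQuotient F.PreDirectIntegral

/-- The class of a square-integrable section in the direct integral. -/
noncomputable def toDirectIntegral (ζ : F.PreDirectIntegral) : F.DirectIntegral :=
  SeparationQuotient.mk ζ

theorem toDirectIntegral_eq_iff (ζ η : F.PreDirectIntegral) :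
    F.toDirectIntegral ζ = F.toDirectIntegral η ↔ ∀ᵐ x ∂μ, ζ.val x = η.val x := by
  rw [toDirectIntegral, toDirectIntegral, SeparationQuotient.mk_eq_mk, Metric.inseparable_iff,
    dist_eq_norm, ← sq_eq_zero_iff, PreDirectIntegral.norm_sq,
    integral_eq_zero_iff_of_nonneg (fun x => by positivity) (ζ - η).integrable_sq]
  refine ⟨fun h => ?_, fun h => ?_⟩ <;> filter_upwards [h] with x hx
  · simpa [PreDirectIntegral.val_sub, sub_eq_zero] using hx
  · simp [PreDirectIntegral.val_sub, hx]

/-! ### Decomposable operators and direct integrals of von Neumann algebras -/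

/-- `x ↦ t x` is a measurable, essentially bounded field of operators. -/
structure IsMeasurableOperatorField (t : ∀ x, H x →L[ℂ] H x) : Prop where
  measurable : ∀ ξ ∈ F.sections, ∀ η ∈ F.sections,
    AEStronglyMeasurable (fun x => inner ℂ (η x) (t x (ξ x))) μ
  bounded : ∃ C : ℝ, ∀ᵐ x ∂μ, ‖t x‖ ≤ C

variable {F}

theorem IsMeasurableOperatorField.apply_mem {t : ∀ x, H x →L[ℂ] H x}
    (ht : F.IsMeasurableOperatorField t) {ξ : ∀ x, H x} (hξ : ξ ∈ F.sections) :
    (fun x => t x (ξ x)) ∈ F.sections :=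
  (F.mem_sections_iff _).2 fun η hη => ht.measurable ξ hξ η hη

theorem IsMeasurableOperatorField.apply_sq {t : ∀ x, H x →L[ℂ] H x}
    (ht : F.IsMeasurableOperatorField t) (ζ : F.PreDirectIntegral) :
    (fun x => t x (ζ.val x)) ∈ F.sqIntegrableSections := by
  refine ⟨ht.apply_mem ζ.mem, ?_⟩
  obtain ⟨C, hC⟩ := ht.bounded
  refine (ζ.integrable_sq.const_mul (C ^ 2)).mono ((F.aesm_norm (ht.apply_mem ζ.mem)).pow 2) ?_
  filter_upwards [hC] with x hx
  rw [Real.norm_eq_abs, Real.norm_eq_abs, abs_of_nonneg (by positivity),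
    abs_of_nonneg (by positivity), ← mul_pow]
  have := (t x).le_of_opNorm_le hx (ζ.val x)
  gcongr

/-- The section `x ↦ t x (ζ x)`. -/
def IsMeasurableOperatorField.app {t : ∀ x, H x →L[ℂ] H x}
    (ht : F.IsMeasurableOperatorField t) (ζ : F.PreDirectIntegral) : F.PreDirectIntegral :=
  ⟨fun x => t x (ζ.val x), ht.apply_sq ζ⟩

variable (F)

/-- `T = ∫^⊕ t x dμ(x)`: the field `t` is measurable and essentially bounded, and `T` maps the
class of every square-integrable section `ζ` to the class of `x ↦ t x (ζ x)`. -/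
def IsIntegralOf (T : F.DirectIntegral →L[ℂ] F.DirectIntegral) (t : ∀ x, H x →L[ℂ] H x) : Prop :=
  ∃ ht : F.IsMeasurableOperatorField t,
    ∀ ζ : F.PreDirectIntegral, T (F.toDirectIntegral ζ) = F.toDirectIntegral (ht.app ζ)

variable {F}

theorem IsMeasurableOperatorField.scalar (c : ℂ) :
    F.IsMeasurableOperatorField fun x => algebraMap ℂ (H x →L[ℂ] H x) c where
  measurable ξ hξ η hη := by
    simp only [Algebra.algebraMap_eq_smul_one, smul_apply,
      one_apply_eq_self, inner_smul_right]
    exact (F.aesm_inner hη hξ).const_mul c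
  bounded := ⟨‖c‖, Eventually.of_forall fun x => by
    rw [Algebra.algebraMap_eq_smul_one, norm_smul]
    exact mul_le_of_le_one_right (norm_nonneg _) ContinuousLinearMap.norm_id_le⟩

theorem IsMeasurableOperatorField.add {s t : ∀ x, H x →L[ℂ] H x}
    (hs : F.IsMeasurableOperatorField s) (ht : F.IsMeasurableOperatorField t) :
    F.IsMeasurableOperatorField fun x => s x + t x where
  measurable ξ hξ η hη := by
    simp only [add_apply, inner_add_right]
    exact (hs.measurable ξ hξ η hη).add (ht.measurable ξ hξ η hη)
  bounded := by
    obtain ⟨C, hC⟩ := hs.bounded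
    obtain ⟨D, hD⟩ := ht.bounded
    refine ⟨C + D, ?_⟩
    filter_upwards [hC, hD] with x h1 h2
    exact (norm_add_le _ _).trans (add_le_add h1 h2)

theorem IsMeasurableOperatorField.mul {s t : ∀ x, H x →L[ℂ] H x}
    (hs : F.IsMeasurableOperatorField s) (ht : F.IsMeasurableOperatorField t) :
    F.IsMeasurableOperatorField fun x => s x * t x where
  measurable ξ hξ η hη := hs.measurable _ (ht.apply_mem hξ) η hη
  bounded := by
    obtain ⟨C, hC⟩ := hs.bounded
    obtain ⟨D, hD⟩ := ht.bounded
    refine ⟨C * D, ?_⟩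
    filter_upwards [hC, hD] with x h1 h2
    exact (norm_mul_le _ _).trans
      (mul_le_mul h1 h2 (norm_nonneg _) ((norm_nonneg _).trans h1))

variable [∀ x, CompleteSpace (H x)]

theorem IsMeasurableOperatorField.star {t : ∀ x, H x →L[ℂ] H x}
    (ht : F.IsMeasurableOperatorField t) :
    F.IsMeasurableOperatorField fun x => star (t x) where
  measurable ξ hξ η hη := by
    have h := (Complex.continuous_conj.comp_aestronglyMeasurable (ht.measurable η hη ξ hξ))
    refine h.congr (Eventually.of_forall fun x => ?_)
    simp [ContinuousLinearMap.star_eq_adjoint, ContinuousLinearMap.adjoint_inner_right]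
  bounded := by
    obtain ⟨C, hC⟩ := ht.bounded
    exact ⟨C, by simpa only [norm_star] using hC⟩

variable (F)

/-- `x ↦ A x` is a measurable field of von Neumann algebras: almost everywhere `A x` is generated
by the values of one sequence of measurable fields of operators. -/
def IsMeasurableAlgebraField (A : ∀ x, VonNeumannAlgebra (H x)) : Prop :=
  ∃ a : ℕ → ∀ x, H x →L[ℂ] H x, (∀ n, F.IsMeasurableOperatorField (a n)) ∧
    ∀ᵐ x ∂μ, A x = generatedVonNeumannAlgebra (Set.range fun n => a n x)

/-- The direct integral `∫^⊕ A x dμ(x)`: all operators `∫^⊕ t x dμ(x)` with `t x ∈ A x` for almost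
every `x`. -/
noncomputable def integralAlgebra (A : ∀ x, VonNeumannAlgebra (H x)) :
    StarSubalgebra ℂ (F.DirectIntegral →L[ℂ] F.DirectIntegral) where
  carrier := {T | ∃ t : ∀ x, H x →L[ℂ] H x, F.IsIntegralOf T t ∧ ∀ᵐ x ∂μ, t x ∈ A x}
  mul_mem' := by
    rintro S T ⟨s, ⟨hs, hS⟩, hsA⟩ ⟨t, ⟨ht, hT⟩, htA⟩
    refine ⟨fun x => s x * t x, ⟨hs.mul ht, fun ζ => ?_⟩, ?_⟩
    · rw [mul_apply_eq_comp, hT, hS]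
      rfl
    · filter_upwards [hsA, htA] with x h1 h2
      exact mul_mem h1 h2
  add_mem' := by
    rintro S T ⟨s, ⟨hs, hS⟩, hsA⟩ ⟨t, ⟨ht, hT⟩, htA⟩
    refine ⟨fun x => s x + t x, ⟨hs.add ht, fun ζ => ?_⟩, ?_⟩
    · rw [add_apply, hT, hS]
      rfl
    · filter_upwards [hsA, htA] with x h1 h2
      exact add_mem h1 h2
  algebraMap_mem' c := by
    refine ⟨fun x => algebraMap ℂ (H x →L[ℂ] H x) c, ⟨.scalar c, fun ζ => ?_⟩,
      Eventually.of_forall fun x => (A x).algebraMap_mem' c⟩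
    rfl
  star_mem' := by
    rintro T ⟨t, ⟨ht, hT⟩, htA⟩
    refine ⟨fun x => star (t x), ⟨ht.star, fun ζ => ?_⟩, ?_⟩
    · refine ext_inner_right ℂ fun ξ => ?_
      obtain ⟨η, rfl⟩ := SeparationQuotient.surjective_mk ξ
      rw [ContinuousLinearMap.star_eq_adjoint, ContinuousLinearMap.adjoint_inner_left]
      change inner ℂ _ (T (F.toDirectIntegral η)) = _
      rw [hT]
      change inner ℂ ζ (ht.app η) = inner ℂ (ht.star.app ζ) η
      rw [PreDirectIntegral.inner_def, PreDirectIntegral.inner_def]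
      refine integral_congr_ae (Eventually.of_forall fun x => ?_)
      change inner ℂ (ζ.val x) (t x (η.val x)) = inner ℂ (star (t x) (ζ.val x)) (η.val x)
      rw [ContinuousLinearMap.star_eq_adjoint, ContinuousLinearMap.adjoint_inner_left]
    · filter_upwards [htA] with x h
      exact star_mem h

/-- `τ = ∫ w(x) τ_x dμ(x)` on `M = ∫^⊕ A x dμ(x)`: for every `T = ∫^⊕ t x dμ(x)` in `M` with
`t x ∈ A x`, the function `x ↦ w(x) τ_x(t x)` is integrable and its integral is `τ(T)`. -/
def IsIntegralTrace {A : ∀ x, VonNeumannAlgebra (H x)} (w : X → ℝ)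
    (τ : F.integralAlgebra A →ₗ[ℂ] ℂ) (τf : ∀ x, (A x).toStarSubalgebra →ₗ[ℂ] ℂ) : Prop :=
  ∀ (T : F.integralAlgebra A) (t : ∀ x, (A x).toStarSubalgebra),
    F.IsIntegralOf (T : F.DirectIntegral →L[ℂ] F.DirectIntegral)
      (fun x => (t x : H x →L[ℂ] H x)) →
    Integrable (fun x => (w x : ℂ) * τf x (t x)) μ ∧ τ T = ∫ x, (w x : ℂ) * τf x (t x) ∂μ

/-- `P = L^∞(X, μ) ⊗̄ Q`, where `P` and `Q` are algebras of operators on the direct integral: there is a `*`-isomorphism of the von Neumann algebra tensor product onto `P`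
which maps `f ⊗ 1` to the diagonal operator `∫^⊕ f(x) dμ(x)` and `1 ⊗ q` to `q`; in particular
`Q ⊆ P`. -/
def IsLinftyTensor (P : StarSubalgebra ℂ (F.DirectIntegral →L[ℂ] F.DirectIntegral))
    (Q : VonNeumannAlgebra F.DirectIntegral) : Prop :=
  ∃ θ : (linftyTensor μ Q).toStarSubalgebra ≃⋆ₐ[ℂ] P,
    (∀ (f : Lp ℂ ∞ μ) (S : (linftyTensor μ Q).toStarSubalgebra),
      (S : Lp F.DirectIntegral 2 μ →L[ℂ] Lp F.DirectIntegral 2 μ) =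
          (ContinuousLinearMap.lsmul ℂ ℂ).holderL μ ∞ 2 2 f →
        F.IsIntegralOf (θ S : F.DirectIntegral →L[ℂ] F.DirectIntegral)
          (fun x => f x • ContinuousLinearMap.id ℂ (H x))) ∧
    ∀ q ∈ Q, ∀ S : (linftyTensor μ Q).toStarSubalgebra,
      (S : Lp F.DirectIntegral 2 μ →L[ℂ] Lp F.DirectIntegral 2 μ) = q.compLpL 2 μ →
        (θ S : F.DirectIntegral →L[ℂ] F.DirectIntegral) = q

end MeasurableHilbertField

/-! ### Shortcuts for type class inference in `*`-algebras of operators -/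

section OperatorAlgebras

-- Write `traceSq τ a = τ(a*a)` for the squared 2-norm of a trace.
--
-- Finite index. The index data of P ⊆ M decompose into fields, and the point is that the fibers of
-- the expectation are again expectations. Since E is P-bimodular and P contains every diagonal
-- projection 1_Z, trace preservation gives ∫_Z w τ_x(S_x E(T)_x) = ∫_Z w τ_x(S_x T_x) for all
-- measurable Z and all S in P, so the integrands agree almost everywhere
-- (`IsIntegralTrace.ae_apply_mul_eq`). Countably many S with dense fibers then show that E(T)_x
-- represents b ↦ τ_x(b T_x) on P_x (`IsIntegralTrace.ae_isExpectationValue`). Hence the relations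
-- of the basis hold at almost every x on a countable *-subring with dense fibers, and they pass to
-- all of M_x because expectation values are contractive for the operator norm and for the 2-norm
-- (`IsNormalTracial.isFiniteIndex_of_dense`).
--
-- Fibers are defined only up to null sets, so no relation can be imposed at one x on uncountably
-- many operators. The substitute is a countable *-subring with a dense set of scalars, followed by
-- Kaplansky density (`kaplansky_density`). Normal traces are controlled by a sequence of vectors,
-- so sequences suffice although the direct integral need not be separable. `IsNormalTracial`
-- collects what is needed of a trace, and holds for τ_x and for τ alike.
--
-- The tensor case. Here N = P_x, and q ↦ q_x must identify Q with P_x. On L^∞ ⊗̄ Q there are two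
-- functionals: the trace of M transported by the given isomorphism, and the slice T ↦ τ(J*TJ) with
-- Jk = g ⊗ k for a strictly positive g in L². Both are normal, positive and faithful, so each is
-- absolutely continuous with respect to the other on the positive unit ball
-- (`IsNormalPositive.exists_forall_lt`). On 1_Z ⊗ q*q they are the integrals over Z of w
-- τ_x(q_x*q_x) and of τ(q*q) g². Gluing along the central projections 1_Z turns this integrated
-- comparison into a pointwise one, uniform over countable families (`ae_exists_forall_lt`): on
-- bounded subsets of a countable *-subring R of Q, the 2-norms of q and of q_x define the same
-- topology for almost every x. So q ↦ q_x extends from R to an injective homomorphism of W*(R) into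
-- M_x whose range is closed under bounded 2-norm limits (`IsBicontinuousHom.exists_extension`).
--
-- It remains to choose R. Approximating generators of P by polynomials in diagonal operators and
-- elements of Q yields a countable R whose fibers generate almost every P_x
-- (`IsTensorIso.exists_countable_forall_le`), so W*(R) ≅ P_x. Adjoining one more q to R does not
-- change the fiber, and comparing the two compatible isomorphisms at a single x forces q ∈ W*(R);
-- thus W*(R) = Q (`IsTensorIso.mem_generatedVonNeumannAlgebra`).

noncomputable local instance operatorAlgebra {K : Type*} [NormedAddCommGroup K]
    [InnerProductSpace ℂ K] : Algebra ℂ (K →L[ℂ] K) := inferInstance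

noncomputable local instance subalgebraAlgebra {K : Type*} [NormedAddCommGroup K]
    [InnerProductSpace ℂ K] [CompleteSpace K] (A : StarSubalgebra ℂ (K →L[ℂ] K)) :
    Algebra ℂ A := inferInstance

noncomputable local instance subalgebraModule {K : Type*} [NormedAddCommGroup K]
    [InnerProductSpace ℂ K] [CompleteSpace K] (A : StarSubalgebra ℂ (K →L[ℂ] K)) :
    Module ℂ A := inferInstance

noncomputable local instance subalgebraRing {K : Type*} [NormedAddCommGroup K]
    [InnerProductSpace ℂ K] [CompleteSpace K] (A : StarSubalgebra ℂ (K →L[ℂ] K)) :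
    Ring A := inferInstance

/-! ### Von Neumann's density theorem, also for self-adjoint elements. -/

section Density

open scoped ComplexStarModule

variable {K : Type*} [NormedAddCommGroup K] [InnerProductSpace ℂ K]

/-- The finite power of a Hilbert space, with the `ℓ²` norm. -/
abbrev FinitePower (ι : Type*) [Fintype ι] (K : Type*) := PiLp 2 (fun _ : ι => K)

/-- The diagonal action of an operator on a finite power of the Hilbert space. -/
noncomputable def amplification (ι : Type*) [Fintype ι] (a : K →L[ℂ] K) :
    PiLp 2 (fun _ : ι => K) →L[ℂ] PiLp 2 (fun _ : ι => K) :=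
  ((PiLp.continuousLinearEquiv 2 ℂ (fun _ : ι => K)).symm :
      (ι → K) →L[ℂ] PiLp 2 (fun _ : ι => K)) ∘L
    (ContinuousLinearMap.pi fun i => a ∘L PiLp.proj 2 (fun _ : ι => K) i)

@[simp]
theorem amplification_apply {ι : Type*} [Fintype ι] (a : K →L[ℂ] K)
    (v : PiLp 2 (fun _ : ι => K)) (i : ι) : amplification ι a v i = a (v i) := rfl

variable [CompleteSpace K]

/-- The density theorem of von Neumann: an operator in the double commutant of a `*`-algebra is
approximated by the algebra on finitely many vectors. -/
theorem exists_mem_near_of_commute_commutant {ι : Type*} [Fintype ι]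
    (C : StarSubalgebra ℂ (K →L[ℂ] K)) {T : K →L[ℂ] K}
    (hT : ∀ S : K →L[ℂ] K, (∀ a ∈ C, a * S = S * a) → T * S = S * T)
    (η : ι → K) {ε : ℝ} (hε : 0 < ε) : ∃ a ∈ C, ∀ i, ‖a (η i) - T (η i)‖ < ε := by
  classical
  let L : C →ₗ[ℂ] FinitePower ι K :=
    { toFun := fun a => WithLp.toLp 2 fun i => (a : K →L[ℂ] K) (η i)
      map_add' := fun a b => by ext i; simp
      map_smul' := fun c a => by ext i; simp }
  -- The closed orbit of the tuple η under C acting diagonally. It reduces the amplified algebra, so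
  -- its projection e commutes with every amplification of an element of C.
  let V : Submodule ℂ (FinitePower ι K) := (LinearMap.range L).topologicalClosure
  have : CompleteSpace V := (Submodule.isClosed_topologicalClosure _).completeSpace_coe
  let e : FinitePower ι K →L[ℂ] FinitePower ι K := V.starProjection
  have hVmem : ∀ a ∈ C, ∀ v ∈ V, amplification ι a v ∈ V := by
    intro a ha v hv
    have hmaps : Set.MapsTo (amplification ι a) (LinearMap.range L : Set (FinitePower ι K))
        (LinearMap.range L : Set (FinitePower ι K)) := by
      rintro _ ⟨b, rfl⟩
      refine ⟨⟨a, ha⟩ * b, ?_⟩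
      ext i; simp [L]
    exact hmaps.closure (amplification ι a).continuous hv
  have hinner : ∀ (a : K →L[ℂ] K) (u v : FinitePower ι K),
      inner ℂ u (amplification ι a v) = inner ℂ (amplification ι (star a) u) v := by
    intro a u v
    simp [PiLp.inner_apply, ContinuousLinearMap.star_eq_adjoint,
      ContinuousLinearMap.adjoint_inner_left]
  have hcomm : ∀ a ∈ C, ∀ v, amplification ι a (e v) = e (amplification ι a v) := by
    intro a ha v
    have h1 : amplification ι a v = amplification ι a (e v) + amplification ι a (v - e v) := by
      rw [← map_add]; congr 1; abel
    have h2 : amplification ι a (v - e v) ∈ Vᗮ := by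
      intro u hu
      rw [hinner]
      exact V.sub_starProjection_mem_orthogonal v _ (hVmem _ (star_mem ha) u hu)
    rw [h1, map_add, Submodule.starProjection_eq_self_iff.2
      (hVmem a ha _ (V.starProjection_apply_mem v)),
      (Submodule.starProjection_apply_eq_zero_iff V).2 h2, add_zero]
  let inj : ι → K →L[ℂ] FinitePower ι K := fun j =>
    ((PiLp.continuousLinearEquiv 2 ℂ (fun _ : ι => K)).symm : (ι → K) →L[ℂ] FinitePower ι K) ∘L
      ContinuousLinearMap.single ℂ (fun _ : ι => K) j
  let pr : ι → FinitePower ι K →L[ℂ] K := fun i => PiLp.proj 2 (fun _ : ι => K) i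
  have hinj : ∀ (a : K →L[ℂ] K) j v, amplification ι a (inj j v) = inj j (a v) := by
    intro a j v
    ext i
    by_cases h : i = j
    · subst h; simp [inj]
    · simp [inj, h]
  have hsum : ∀ v : FinitePower ι K, v = ∑ j, inj j (v j) := by
    intro v
    ext i
    simp [inj, Pi.single_apply]
  -- The matrix entries of e lie in the commutant of C, hence commute with T; therefore T acting
  -- diagonally commutes with e.
  have hS : ∀ i j, T * (pr i ∘L e ∘L inj j) = (pr i ∘L e ∘L inj j) * T := by
    intro i j
    refine hT _ fun a ha => ?_
    ext v
    change a ((e (inj j v)) i) = (e (inj j (a v))) i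
    rw [← hinj, ← hcomm a ha, amplification_apply]
  have hTe : ∀ v, amplification ι T (e v) = e (amplification ι T v) := by
    intro v
    ext i
    rw [amplification_apply]
    conv_lhs => rw [hsum v]
    conv_rhs => rw [hsum (amplification ι T v)]
    simp only [map_sum, WithLp.ofLp_sum, Finset.sum_apply, amplification_apply]
    refine Finset.sum_congr rfl fun j _ => ?_
    exact DFunLike.congr_fun (hS i j) (v j)
  -- C is unital, so the tuple η itself lies in V, and T applied to it stays in V.
  let ζ : FinitePower ι K := L 1
  have hζ : ζ ∈ V := Submodule.le_topologicalClosure _ ⟨1, rfl⟩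
  have hTζ : amplification ι T ζ ∈ V := by
    have := hTe ζ
    rw [show e ζ = ζ from Submodule.starProjection_eq_self_iff.2 hζ] at this
    rw [this]
    exact V.starProjection_apply_mem _
  obtain ⟨_, ⟨a, rfl⟩, ha⟩ := Metric.mem_closure_iff.1 hTζ ε hε
  refine ⟨a, a.2, fun i => ?_⟩
  rw [dist_comm, dist_eq_norm] at ha
  have := PiLp.norm_apply_le (L a - amplification ι T ζ) i
  refine lt_of_le_of_lt (le_trans (le_of_eq ?_) this) ha
  simp [L, ζ]

/-- A self-adjoint operator in the double commutant of a `*`-algebra is approximated by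
self-adjoint elements of the algebra on finitely many vectors. -/
theorem exists_selfAdjoint_mem_near_of_commute_commutant {ι : Type*} [Fintype ι]
    (C : StarSubalgebra ℂ (K →L[ℂ] K)) {T : K →L[ℂ] K} (hsa : IsSelfAdjoint T)
    (hT : ∀ S : K →L[ℂ] K, (∀ a ∈ C, a * S = S * a) → T * S = S * T)
    (η : ι → K) {ε : ℝ} (hε : 0 < ε) :
    ∃ a ∈ C, IsSelfAdjoint a ∧ ∀ i, ‖a (η i) - T (η i)‖ < ε := by
  classical
  let _ : InnerProductSpace ℝ (FinitePower ι K) := InnerProductSpace.complexToReal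
  let W : Submodule ℝ (FinitePower ι K) :=
    { carrier := {v | ∃ a ∈ C, IsSelfAdjoint a ∧ v = WithLp.toLp 2 fun i => a (η i)}
      add_mem' := by
        rintro _ _ ⟨a, ha, ha', rfl⟩ ⟨b, hb, hb', rfl⟩
        exact ⟨a + b, add_mem ha hb, ha'.add hb', by ext i; simp⟩
      zero_mem' := ⟨0, zero_mem _, .zero _, by ext i; simp⟩
      smul_mem' := by
        rintro c _ ⟨a, ha, ha', rfl⟩
        refine ⟨(c : ℂ) • a, C.smul_mem ha _, ?_, ?_⟩
        · rw [isSelfAdjoint_iff, star_smul, ha'.star_eq]; simp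
        · ext i; simp }
  let t : FinitePower ι K := WithLp.toLp 2 fun i => T (η i)
  have key : t ∈ W.topologicalClosure := by
    rw [← Submodule.orthogonal_orthogonal_eq_closure]
    intro y hy
    have hre : ∀ v : FinitePower ι K, inner ℝ y v = (inner ℂ y v).re := fun v => rfl
    -- A complex linear extension of a ↦ 2 Re⟨y, aη⟩ from self-adjoint operators. Linearity makes it
    -- vanish on all of C once it vanishes on self-adjoint elements, so the density theorem without
    -- self-adjointness applies to it.
    let g : (K →L[ℂ] K) → ℂ := fun a => ∑ i, (inner ℂ (y i) (a (η i)) + inner ℂ (η i) (a (y i)))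
    have gadd : ∀ a b, g (a + b) = g a + g b := fun a b => by
      simp only [g, add_apply, inner_add_right, ← Finset.sum_add_distrib]
      exact Finset.sum_congr rfl fun i _ => by ring
    have gsmul : ∀ (c : ℂ) a, g (c • a) = c * g a := fun c a => by
      simp only [g, smul_apply, inner_smul_right, Finset.mul_sum]
      exact Finset.sum_congr rfl fun i _ => by ring
    have gsa : ∀ a, IsSelfAdjoint a →
        g a = ((2 * (inner ℂ y (WithLp.toLp 2 fun i => a (η i) : FinitePower ι K)).re : ℝ) : ℂ) := by
      intro a ha
      have h1 : ∀ i, inner ℂ (η i) (a (y i)) = (starRingEnd ℂ) (inner ℂ (y i) (a (η i))) := by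
        intro i
        rw [inner_conj_symm, ← ContinuousLinearMap.adjoint_inner_left,
          ← ContinuousLinearMap.star_eq_adjoint, ha.star_eq]
      simp only [g, h1, Complex.add_conj, PiLp.inner_apply, Complex.re_sum, Finset.mul_sum]
      push_cast
      rfl
    have gC : ∀ a ∈ C, g a = 0 := by
      intro a ha
      have hsa0 : ∀ b ∈ C, IsSelfAdjoint b → g b = 0 := by
        intro b hb hb'
        have := W.inner_left_of_mem_orthogonal (v := y) ⟨b, hb, hb', rfl⟩ hy
        rw [hre] at this
        rw [gsa b hb', this]
        simp
      rw [← realPart_add_I_smul_imaginaryPart a, gadd, gsmul,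
        hsa0 _ ?_ (ℜ a).2, hsa0 _ ?_ (ℑ a).2]
      · simp
      · rw [imaginaryPart_apply_coe]
        exact C.smul_mem (C.smul_mem (sub_mem ha (star_mem ha)) _) _
      · rw [realPart_apply_coe]
        have := C.smul_mem (add_mem ha (star_mem ha)) ((2⁻¹ : ℝ) : ℂ)
        rw [show (2⁻¹ : ℝ) • (a + star a) = (((2⁻¹ : ℝ) : ℂ)) • (a + star a) from rfl]
        exact this
    have gT : g T = 0 := by
      by_contra hne
      have hpos : 0 < ‖g T‖ := norm_pos_iff.2 hne
      let B : ℝ := ∑ i, (‖y i‖ + ‖η i‖)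
      have hB : 0 ≤ B := Finset.sum_nonneg fun i _ => by positivity
      -- The family of vectors is doubled because g evaluates operators both at the η i and at the y
      -- i.
      obtain ⟨a, ha, hae⟩ := exists_mem_near_of_commute_commutant C hT (Sum.elim η fun i => y i)
        (ε := ‖g T‖ / (B + 1)) (by positivity)
      have h1 : g (a - T) = - g T := by
        have := gadd (a - T) T
        rw [sub_add_cancel, gC a ha] at this
        exact eq_neg_of_add_eq_zero_left this.symm
      have h2 : ‖g (a - T)‖ ≤ B * (‖g T‖ / (B + 1)) := by
        rw [Finset.sum_mul]
        refine norm_sum_le_of_le _ fun i _ => ?_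
        refine (norm_add_le _ _).trans ?_
        rw [add_mul]
        refine add_le_add ((norm_inner_le_norm _ _).trans ?_) ((norm_inner_le_norm _ _).trans ?_)
        · exact mul_le_mul_of_nonneg_left (hae (Sum.inl i)).le (norm_nonneg _)
        · exact mul_le_mul_of_nonneg_left (hae (Sum.inr i)).le (norm_nonneg _)
      rw [h1, norm_neg, mul_div_assoc', le_div_iff₀ (by positivity)] at h2
      nlinarith
    have h3 := gsa T hsa
    rw [gT] at h3
    rw [hre]
    have h4 : (2 * (inner ℂ y t).re : ℝ) = 0 := by exact_mod_cast h3.symm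
    linarith
  obtain ⟨_, ⟨a, haC, hasa, rfl⟩, ha⟩ := Metric.mem_closure_iff.1 key ε hε
  refine ⟨a, haC, hasa, fun i => ?_⟩
  rw [dist_comm, dist_eq_norm] at ha
  have := PiLp.norm_apply_le ((WithLp.toLp 2 fun i => a (η i) : FinitePower ι K) - t) i
  exact lt_of_le_of_lt (le_trans (le_of_eq (by simp [t])) this) ha

end Density

/-! ### Kaplansky density through the bounded function 2t/(1+t²). -/

section Kaplansky

open scoped ComplexStarModule

theorem continuous_inv_one_add_sq : Continuous fun t : ℝ => (1 + t ^ 2)⁻¹ :=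
  (by fun_prop : Continuous fun t : ℝ => 1 + t ^ 2).inv₀ fun t => by positivity

theorem continuous_two_mul_div_one_add_sq : Continuous fun t : ℝ => 2 * t * (1 + t ^ 2)⁻¹ :=
  (by fun_prop : Continuous fun t : ℝ => 2 * t).mul continuous_inv_one_add_sq

section CStar

variable {R : Type*} [CStarAlgebra R]

theorem cfc_inv_one_add_sq_mul {y : R} (hy : IsSelfAdjoint y) :
    cfc (fun t : ℝ => (1 + t ^ 2)⁻¹) y * (1 + y * y) = 1 := by
  have h1 : (1 + y * y : R) = cfc (fun t : ℝ => 1 + t ^ 2) y := by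
    rw [cfc_const_add (1 : ℝ) (fun t : ℝ => t ^ 2) y (by fun_prop) hy, cfc_pow_id (R := ℝ) y 2,
      map_one, pow_two]
  rw [h1, ← cfc_mul _ _ y continuous_inv_one_add_sq.continuousOn (by fun_prop)]
  rw [← cfc_one ℝ y]
  refine cfc_congr fun t _ => ?_
  have : (1 + t ^ 2 : ℝ) ≠ 0 := by positivity
  simp [this]

theorem mul_cfc_inv_one_add_sq {y : R} (hy : IsSelfAdjoint y) :
    (1 + y * y) * cfc (fun t : ℝ => (1 + t ^ 2)⁻¹) y = 1 := by
  have h := cfc_inv_one_add_sq_mul hy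
  have hc : Commute (cfc (fun t : ℝ => (1 + t ^ 2)⁻¹) y) (1 + y * y) :=
    Commute.cfc_real ((Commute.one_right y).add_right ((Commute.refl y).mul_right (Commute.refl y))) _
  rw [← hc.eq, h]

theorem cfc_two_mul_div_one_add_sq {y : R} (hy : IsSelfAdjoint y) :
    cfc (fun t : ℝ => 2 * t * (1 + t ^ 2)⁻¹) y =
      (2 : ℝ) • (y * cfc (fun t : ℝ => (1 + t ^ 2)⁻¹) y) := by
  conv_rhs => enter [2, 1]; rw [← cfc_id' ℝ y]
  rw [← cfc_mul _ _ y (by fun_prop) continuous_inv_one_add_sq.continuousOn,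
    ← cfc_smul (2 : ℝ) (fun t : ℝ => t * (1 + t ^ 2)⁻¹) y
      ((continuous_id.mul continuous_inv_one_add_sq).continuousOn)]
  refine cfc_congr fun t _ => ?_
  simp [mul_assoc]

theorem norm_cfc_inv_one_add_sq_le (y : R) :
    ‖cfc (fun t : ℝ => (1 + t ^ 2)⁻¹) y‖ ≤ 1 := by
  refine norm_cfc_le zero_le_one fun t _ => ?_
  rw [Real.norm_eq_abs, abs_of_nonneg (by positivity)]
  exact inv_le_one_of_one_le₀ (by nlinarith)

theorem abs_two_mul_div_one_add_sq_le (t : ℝ) : ‖2 * t * (1 + t ^ 2)⁻¹‖ ≤ 1 := by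
  rw [Real.norm_eq_abs, abs_mul, abs_of_nonneg (inv_nonneg.2 (by positivity : 0 ≤ 1 + t ^ 2)),
    ← div_eq_mul_inv, div_le_one (by positivity)]
  rw [abs_le]
  constructor <;> nlinarith [sq_nonneg (t - 1), sq_nonneg (t + 1)]

theorem norm_cfc_two_mul_div_one_add_sq_le (y : R) :
    ‖cfc (fun t : ℝ => 2 * t * (1 + t ^ 2)⁻¹) y‖ ≤ 1 :=
  norm_cfc_le zero_le_one fun t _ => abs_two_mul_div_one_add_sq_le t

/-- Up to the factor 2 this is the contraction 2t/(1+t²) at y. The bound does not depend on ‖y‖, as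
is needed because the approximants produced by the density theorem are not bounded. -/
theorem norm_cfc_inv_one_add_sq_mul_le {y : R} (hy : IsSelfAdjoint y) :
    ‖cfc (fun t : ℝ => (1 + t ^ 2)⁻¹) y * y‖ ≤ 1 := by
  have h := norm_cfc_two_mul_div_one_add_sq_le y
  rw [cfc_two_mul_div_one_add_sq hy, norm_smul] at h
  have hc : Commute (cfc (fun t : ℝ => (1 + t ^ 2)⁻¹) y) y := Commute.cfc_real (Commute.refl y) _
  rw [hc.eq]
  norm_num at h
  linarith [norm_nonneg (y * cfc (fun t : ℝ => (1 + t ^ 2)⁻¹) y)]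

/-- The bounded function `2t/(1+t²)` of two self-adjoint elements: a difference formula. -/
theorem cfc_two_mul_div_sub {y x : R} (hy : IsSelfAdjoint y) (hx : IsSelfAdjoint x) :
    cfc (fun t : ℝ => 2 * t * (1 + t ^ 2)⁻¹) y - cfc (fun t : ℝ => 2 * t * (1 + t ^ 2)⁻¹) x =
      (2 : ℝ) • (cfc (fun t : ℝ => (1 + t ^ 2)⁻¹) y *
        ((y - x) * cfc (fun t : ℝ => (1 + t ^ 2)⁻¹) x) -
        (cfc (fun t : ℝ => (1 + t ^ 2)⁻¹) y * y) *
          ((y - x) * (x * cfc (fun t : ℝ => (1 + t ^ 2)⁻¹) x))) := by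
  rw [cfc_two_mul_div_one_add_sq hy, cfc_two_mul_div_one_add_sq hx, ← smul_sub]
  congr 1
  have hc : Commute (cfc (fun t : ℝ => (1 + t ^ 2)⁻¹) y) y := Commute.cfc_real (Commute.refl y) _
  have h1 := cfc_inv_one_add_sq_mul hy
  have h2 := mul_cfc_inv_one_add_sq hx
  rw [← hc.eq]
  generalize cfc (fun t : ℝ => (1 + t ^ 2)⁻¹) y = r at *
  generalize cfc (fun t : ℝ => (1 + t ^ 2)⁻¹) x = s at *
  calc r * y - x * s = r * y * ((1 + x * x) * s) - r * (1 + y * y) * (x * s) := by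
        rw [h1, h2]; simp
    _ = _ := by noncomm_ring

/-- Every self-adjoint contraction is `2x/(1+x²)` for a self-adjoint `x` commuting with
everything it commutes with. -/
theorem exists_eq_cfc_two_mul_div {a : R} (ha : IsSelfAdjoint a) (hn : ‖a‖ ≤ 1) :
    ∃ x : R, IsSelfAdjoint x ∧ (∀ b, Commute a b → Commute x b) ∧
      a = cfc (fun t : ℝ => 2 * t * (1 + t ^ 2)⁻¹) x := by
  -- The inverse of t ↦ 2t/(1+t²) with values in [-1, 1]: solving s t² - 2t + s = 0 and taking the
  -- smaller root.
  let g : ℝ → ℝ := fun s => s * (1 + √(1 - s ^ 2))⁻¹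
  have hg : Continuous g := by
    refine continuous_id.mul (Continuous.inv₀ (by fun_prop) fun s => ?_)
    positivity
  refine ⟨cfc g a, cfc_predicate g a, fun b hb => hb.cfc_real g, ?_⟩
  rw [← cfc_comp' (fun t : ℝ => 2 * t * (1 + t ^ 2)⁻¹) g a
    continuous_two_mul_div_one_add_sq.continuousOn hg.continuousOn ha]
  conv_lhs => rw [← cfc_id' ℝ a]
  refine cfc_congr fun s hs => ?_
  have hs1 : |s| ≤ 1 := by
    have := norm_apply_le_norm_cfc (fun t : ℝ => t) a hs (by fun_prop) ha
    rw [cfc_id' ℝ a] at this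
    exact this.trans hn
  have hs2 : 0 ≤ 1 - s ^ 2 := by
    rw [abs_le] at hs1
    nlinarith
  have hu := Real.sq_sqrt hs2
  have hu0 := Real.sqrt_nonneg (1 - s ^ 2)
  simp only [g]
  generalize √(1 - s ^ 2) = c at *
  have h1 : (1 + c) ≠ 0 := by positivity
  have h2 : 1 + (s * (1 + c)⁻¹) ^ 2 ≠ 0 := by positivity
  rw [← div_eq_mul_inv, eq_div_iff h2]
  field_simp
  linear_combination s * hu
end CStar

variable {K : Type*} [NormedAddCommGroup K] [InnerProductSpace ℂ K] [CompleteSpace K]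

/-- Write T = f(x) with f(t) = 2t/(1+t²) and approximate x by some self-adjoint y in C, without norm
control; f(y) is a contraction in any case. By `cfc_two_mul_div_sub` the error f(y) - f(x) is a
uniformly bounded operator applied to (y - x) on vectors depending only on x. -/
theorem exists_norm_le_one_near_of_commute_commutant {ι : Type*} [Fintype ι]
    (C : StarSubalgebra ℂ (K →L[ℂ] K)) [hC : IsClosed (C : Set (K →L[ℂ] K))]
    {T : K →L[ℂ] K} (hsa : IsSelfAdjoint T) (hn : ‖T‖ ≤ 1)
    (hT : ∀ S : K →L[ℂ] K, (∀ a ∈ C, a * S = S * a) → T * S = S * T)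
    (η : ι → K) {ε : ℝ} (hε : 0 < ε) : ∃ a ∈ C, ‖a‖ ≤ 1 ∧ ∀ i, ‖a (η i) - T (η i)‖ < ε := by
  obtain ⟨x, hx, hxc, rfl⟩ := exists_eq_cfc_two_mul_div hsa hn
  let r := cfc (fun t : ℝ => (1 + t ^ 2)⁻¹) x
  -- The vectors on the right of y - x in the difference formula are r(η i) and x(r(η i)), with r =
  -- (1+x²)⁻¹. Each contributes less than ε/4, and the formula has the factor 2.
  obtain ⟨y, hyC, hy, hyη⟩ := exists_selfAdjoint_mem_near_of_commute_commutant C hx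
    (fun S hS => hxc S (hT S hS))
    (Sum.elim (fun i => r (η i)) fun i => x (r (η i))) (ε := ε / 4) (by positivity)
  refine ⟨cfc (fun t : ℝ => 2 * t * (1 + t ^ 2)⁻¹) y, cfc_mem (s := C) _ hyC,
    norm_cfc_two_mul_div_one_add_sq_le y, fun i => ?_⟩
  rw [← sub_apply, cfc_two_mul_div_sub hy hx]
  have h1 := hyη (Sum.inl i)
  have h2 := hyη (Sum.inr i)
  simp only [Sum.elim_inl, Sum.elim_inr] at h1 h2
  have e1 := norm_cfc_inv_one_add_sq_le y
  have e2 := norm_cfc_inv_one_add_sq_mul_le hy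
  rw [smul_apply, norm_smul, Real.norm_eq_abs, abs_two]
  have h3 : ∀ (b : K →L[ℂ] K) (v : K), ‖b‖ ≤ 1 → ‖b v‖ ≤ ‖v‖ := fun b v hb => by
    simpa using b.le_of_opNorm_le hb v
  have h4 := norm_sub_le (cfc (fun t : ℝ => (1 + t ^ 2)⁻¹) y (y (r (η i)) - x (r (η i))))
    ((cfc (fun t : ℝ => (1 + t ^ 2)⁻¹) y * y) (y (x (r (η i))) - x (x (r (η i)))))
  have h5 := h3 _ (y (r (η i)) - x (r (η i))) e1
  have h6 := h3 _ (y (x (r (η i))) - x (x (r (η i)))) e2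
  refine lt_of_le_of_lt (mul_le_mul_of_nonneg_left h4 zero_le_two) ?_
  linarith

/-- A form of the Kaplansky density theorem: an operator in the double commutant of a `*`-algebra
is the limit of a bounded sequence of the algebra on any sequence of vectors. -/
theorem kaplansky_density (C : StarSubalgebra ℂ (K →L[ℂ] K)) {T : K →L[ℂ] K}
    (hT : ∀ S : K →L[ℂ] K, (∀ a ∈ C, a * S = S * a ∧ a * star S = star S * a) → T * S = S * T)
    (η : ℕ → K) : ∃ a : ℕ → K →L[ℂ] K, (∀ k, a k ∈ C ∧ ‖a k‖ ≤ 2 * ‖T‖ + 1) ∧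
      ∀ n, Tendsto (fun k => a k (η n)) atTop (𝓝 (T (η n))) := by
  -- Continuous functional calculus stays inside the algebra only after taking the norm closure.
  let D := C.topologicalClosure
  have hDc : IsClosed (D : Set (K →L[ℂ] K)) := C.isClosed_topologicalClosure
  have hCD : C ≤ D := C.le_topologicalClosure
  have hstar : ∀ S : K →L[ℂ] K, (∀ a ∈ C, a * S = S * a) → ∀ a ∈ C, a * star S = star S * a := by
    intro S hS a ha
    have := congrArg star (hS _ (star_mem ha))
    simpa using this.symm
  have hTS : ∀ S : K →L[ℂ] K, (∀ a ∈ D, a * S = S * a) → T * S = S * T := fun S hS =>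
    hT S fun a ha => ⟨hS a (hCD ha), hstar S (fun a ha => hS a (hCD ha)) a ha⟩
  have hTS' : ∀ S : K →L[ℂ] K, (∀ a ∈ D, a * S = S * a) → star T * S = S * star T := by
    intro S hS
    have h := hT (star S) fun a ha => by
      rw [star_star]
      exact ⟨hstar S (fun a ha => hS a (hCD ha)) a ha, hS a (hCD ha)⟩
    have := congrArg star h
    simpa using this.symm
  -- self-adjoint operators of any norm
  have key : ∀ T : K →L[ℂ] K, IsSelfAdjoint T →
      (∀ S : K →L[ℂ] K, (∀ a ∈ D, a * S = S * a) → T * S = S * T) → ∀ k : ℕ,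
      ∃ a ∈ D, ‖a‖ ≤ ‖T‖ ∧ ∀ i : Fin k, ‖a (η i) - T (η i)‖ < 1 / ((k : ℝ) + 1) := by
    intro T hsa hT k
    rcases eq_or_ne T 0 with rfl | h0
    · exact ⟨0, zero_mem _, le_rfl, fun i => by simp; positivity⟩
    have hpos : 0 < ‖T‖ := norm_pos_iff.2 h0
    obtain ⟨a, haD, han, ha⟩ := exists_norm_le_one_near_of_commute_commutant D (hC := hDc)
      (T := ((‖T‖⁻¹ : ℝ) : ℂ) • T)
      (by rw [isSelfAdjoint_iff, star_smul, hsa.star_eq]; simp)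
      (by rw [norm_smul]; simp [hpos.ne'])
      (fun S hS => by rw [smul_mul_assoc, hT S hS, mul_smul_comm])
      (fun i : Fin k => η i) (ε := ‖T‖⁻¹ * (1 / ((k : ℝ) + 1))) (by positivity)
    refine ⟨((‖T‖ : ℝ) : ℂ) • a, D.smul_mem haD _, ?_, fun i => ?_⟩
    · rw [norm_smul]
      simpa using mul_le_of_le_one_right hpos.le han
    · have h1 := ha i
      have h2 : (((‖T‖ : ℝ) : ℂ) • a) (η i) - T (η i) =
          ((‖T‖ : ℝ) : ℂ) • (a (η i) - (((‖T‖⁻¹ : ℝ) : ℂ) • T) (η i)) := by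
        rw [smul_sub, smul_apply, smul_apply, smul_smul, ← Complex.ofReal_mul,
          mul_inv_cancel₀ hpos.ne']
        simp
      rw [h2, norm_smul, Complex.norm_real, norm_norm]
      calc _ < ‖T‖ * (‖T‖⁻¹ * (1 / ((k : ℝ) + 1))) := by gcongr
        _ = _ := by rw [← mul_assoc, mul_inv_cancel₀ hpos.ne', one_mul]
  have hre : ∀ S : K →L[ℂ] K, (∀ a ∈ D, a * S = S * a) →
      ((ℜ T : selfAdjoint _) : K →L[ℂ] K) * S = S * ((ℜ T : selfAdjoint _) : K →L[ℂ] K) := by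
    intro S hS
    rw [realPart_apply_coe, smul_mul_assoc, mul_smul_comm, add_mul, mul_add, hTS S hS, hTS' S hS]
  have him : ∀ S : K →L[ℂ] K, (∀ a ∈ D, a * S = S * a) →
      ((ℑ T : selfAdjoint _) : K →L[ℂ] K) * S = S * ((ℑ T : selfAdjoint _) : K →L[ℂ] K) := by
    intro S hS
    rw [imaginaryPart_apply_coe]
    simp only [smul_mul_assoc, mul_smul_comm, sub_mul, mul_sub, hTS S hS, hTS' S hS]
  -- Real and imaginary parts each cost at most ‖T‖ in norm, and the return from D to C costs at
  -- most 1. The k-th approximant serves the first k vectors.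
  have hstep : ∀ k : ℕ, ∃ a ∈ C, ‖a‖ ≤ 2 * ‖T‖ + 1 ∧
      ∀ i : Fin k, ‖a (η i) - T (η i)‖ < (2 + ‖η i‖) / ((k : ℝ) + 1) := by
    intro k
    obtain ⟨a, haD, han, ha⟩ := key _ (ℜ T).2 hre k
    obtain ⟨b, hbD, hbn, hb⟩ := key _ (ℑ T).2 him k
    have hab : a + Complex.I • b ∈ D := add_mem haD (D.smul_mem hbD _)
    have hk : 0 < 1 / ((k : ℝ) + 1) := by positivity
    obtain ⟨c, hcC, hc⟩ := Metric.mem_closure_iff.1 hab _ hk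
    rw [dist_comm, dist_eq_norm] at hc
    have hk1 : 1 / ((k : ℝ) + 1) ≤ 1 := by
      rw [div_le_one (by positivity)]; linarith [k.cast_nonneg (α := ℝ)]
    refine ⟨c, hcC, ?_, fun i => ?_⟩
    · have h1 : ‖c‖ ≤ ‖c - (a + Complex.I • b)‖ + ‖a + Complex.I • b‖ := by
        simpa using norm_add_le (c - (a + Complex.I • b)) (a + Complex.I • b)
      have h2 : ‖a + Complex.I • b‖ ≤ ‖a‖ + ‖b‖ := by
        refine (norm_add_le _ _).trans ?_
        rw [norm_smul, Complex.norm_I, one_mul]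
      have h3 := realPart.norm_le T
      have h4 := imaginaryPart.norm_le T
      have h5 : ‖(ℜ T : selfAdjoint (K →L[ℂ] K))‖ = ‖((ℜ T : selfAdjoint _) : K →L[ℂ] K)‖ := rfl
      have h6 : ‖(ℑ T : selfAdjoint (K →L[ℂ] K))‖ = ‖((ℑ T : selfAdjoint _) : K →L[ℂ] K)‖ := rfl
      linarith
    · have e : c (η i) - T (η i) = (c - (a + Complex.I • b)) (η i) +
          ((a (η i) - ((ℜ T : selfAdjoint _) : K →L[ℂ] K) (η i)) +
            Complex.I • (b (η i) - ((ℑ T : selfAdjoint _) : K →L[ℂ] K) (η i))) := by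
        conv_lhs => rw [← realPart_add_I_smul_imaginaryPart T]
        simp only [sub_apply, add_apply, smul_apply, smul_sub]
        abel
      rw [e]
      have h1 := (c - (a + Complex.I • b)).le_of_opNorm_le hc.le (η i)
      have h2 := norm_add_le ((c - (a + Complex.I • b)) (η i))
        ((a (η i) - ((ℜ T : selfAdjoint _) : K →L[ℂ] K) (η i)) +
            Complex.I • (b (η i) - ((ℑ T : selfAdjoint _) : K →L[ℂ] K) (η i)))
      have h3 := norm_add_le (a (η i) - ((ℜ T : selfAdjoint _) : K →L[ℂ] K) (η i))
            (Complex.I • (b (η i) - ((ℑ T : selfAdjoint _) : K →L[ℂ] K) (η i)))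
      rw [norm_smul, Complex.norm_I, one_mul] at h3
      have h4 := ha i
      have h5 := hb i
      have h6 : (2 + ‖η i‖) / ((k : ℝ) + 1) =
        2 * (1 / ((k : ℝ) + 1)) + 1 / ((k : ℝ) + 1) * ‖η i‖ := by ring
      linarith
  choose a haC han ha using hstep
  refine ⟨a, fun k => ⟨haC k, han k⟩, fun n => ?_⟩
  rw [tendsto_iff_norm_sub_tendsto_zero]
  refine squeeze_zero' (Eventually.of_forall fun _ => norm_nonneg _) (g := fun k : ℕ =>
    (2 + ‖η n‖) * (1 / ((k : ℝ) + 1))) ?_ ?_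
  · filter_upwards [eventually_gt_atTop n] with k hk
    have := (ha k ⟨n, hk⟩).le
    rwa [div_eq_mul_one_div] at this
  · simpa using (tendsto_one_div_add_atTop_nhds_zero_nat (𝕜 := ℝ)).const_mul (2 + ‖η n‖)

end Kaplansky

/-! ### Strong limits of bounded sequences of operators. -/

section StrongLimits

variable {K : Type*} [NormedAddCommGroup K] [InnerProductSpace ℂ K] [CompleteSpace K]

theorem norm_apply_le_of_norm_le {a : K →L[ℂ] K} {C : ℝ} (h : ‖a‖ ≤ C) (v : K) :
    ‖a v‖ ≤ C * ‖v‖ := a.le_of_opNorm_le h v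

/-- A bounded sequence of operators that converges on a total set converges strongly. -/
theorem exists_strong_limit {a : ℕ → K →L[ℂ] K} {C : ℝ} (hC : ∀ k, ‖a k‖ ≤ C) {S : Set K}
    (hS : (Submodule.span ℂ S).topologicalClosure = ⊤)
    (hcauchy : ∀ s ∈ S, CauchySeq fun k => a k s) :
    ∃ b : K →L[ℂ] K, ∀ v, Tendsto (fun k => a k v) atTop (𝓝 (b v)) := by
  have hC0 : 0 ≤ C := (norm_nonneg _).trans (hC 0)
  let W : Submodule ℂ K :=
    { carrier := {v | CauchySeq fun k => a k v}
      add_mem' := fun {u v} hu hv => by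
        have : CauchySeq fun k => a k u + a k v := CauchySeq.add hu hv
        simpa only [Set.mem_ofPred_eq, map_add] using this
      zero_mem' := by
        simp only [Set.mem_ofPred_eq, map_zero]
        exact cauchySeq_const 0
      smul_mem' := fun c v hv => by
        obtain ⟨w, hw⟩ := cauchySeq_tendsto_of_complete hv
        simp only [Set.mem_ofPred_eq, map_smul]
        exact (hw.const_smul c).cauchySeq }
  have hspan : Submodule.span ℂ S ≤ W := Submodule.span_le.2 hcauchy
  have hall : ∀ v, CauchySeq fun k => a k v := by
    intro v
    have hv : v ∈ (Submodule.span ℂ S).topologicalClosure := hS ▸ Submodule.mem_top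
    rw [Metric.cauchySeq_iff]
    intro ε hε
    obtain ⟨u, hu, huv⟩ := Metric.mem_closure_iff.1 hv (ε / (4 * (C + 1))) (by positivity)
    obtain ⟨N, hN⟩ := Metric.cauchySeq_iff.1 (hspan hu) (ε / 2) (by positivity)
    refine ⟨N, fun k hk l hl => ?_⟩
    have h1 := hN k hk l hl
    rw [dist_eq_norm] at huv h1 ⊢
    have e : a k v - a l v = a k (v - u) + (a k u - a l u) - a l (v - u) := by
      simp only [map_sub]; abel
    have h2 : ∀ k, ‖a k (v - u)‖ ≤ ε / 4 := fun k => by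
      refine (norm_apply_le_of_norm_le (hC k) _).trans ?_
      calc C * ‖v - u‖ ≤ (C + 1) * (ε / (4 * (C + 1))) := by gcongr; linarith
        _ = ε / 4 := by field_simp
    rw [e]
    have h3 := norm_sub_le (a k (v - u) + (a k u - a l u)) (a l (v - u))
    have h4 := norm_add_le (a k (v - u)) (a k u - a l u)
    linarith [h2 k, h2 l]
  choose f hf using fun v => cauchySeq_tendsto_of_complete (hall v)
  refine ⟨continuousLinearMapOfTendsto (fun k => a k) (f := f) (tendsto_pi_nhds.2 hf), hf⟩

theorem norm_le_of_strong_limit {a : ℕ → K →L[ℂ] K} {b : K →L[ℂ] K} {C : ℝ}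
    (hC : ∀ k, ‖a k‖ ≤ C) (h : ∀ v, Tendsto (fun k => a k v) atTop (𝓝 (b v))) : ‖b‖ ≤ C :=
  b.opNorm_le_bound ((norm_nonneg _).trans (hC 0)) fun v =>
    le_of_tendsto (h v).norm (Eventually.of_forall fun k => norm_apply_le_of_norm_le (hC k) v)

theorem VonNeumannAlgebra.mem_iff_commute (A : VonNeumannAlgebra K) {a : K →L[ℂ] K} :
    a ∈ A ↔ ∀ s ∈ A.commutant, s * a = a * s := by
  conv_lhs => rw [← A.commutant_commutant, VonNeumannAlgebra.mem_commutant_iff]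

/-- A von Neumann algebra is closed under strong limits of sequences. -/
theorem VonNeumannAlgebra.mem_of_strong_limit (A : VonNeumannAlgebra K) {a : ℕ → K →L[ℂ] K}
    {b : K →L[ℂ] K} (ha : ∀ k, a k ∈ A)
    (h : ∀ v, Tendsto (fun k => a k v) atTop (𝓝 (b v))) : b ∈ A := by
  refine A.mem_iff_commute.2 fun s hs => ?_
  ext v
  have h1 : Tendsto (fun k => s (a k v)) atTop (𝓝 (s (b v))) := (s.continuous.tendsto _).comp (h v)
  have h2 : (fun k => s (a k v)) = fun k => a k (s v) := by
    funext k
    exact DFunLike.congr_fun (A.mem_iff_commute.1 (ha k) s hs) v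
  rw [h2] at h1
  exact tendsto_nhds_unique h1 (h (s v))

theorem VonNeumannAlgebra.isClosed_coe (A : VonNeumannAlgebra K) :
    IsClosed (A.toStarSubalgebra : Set (K →L[ℂ] K)) := by
  refine IsSeqClosed.isClosed fun a b ha hab => ?_
  refine A.mem_of_strong_limit ha fun v => ?_
  exact ((ContinuousLinearMap.apply ℂ K v).continuous.tendsto b).comp hab

end StrongLimits

/-! ### The 2-norm of a faithful normal trace. -/

section Traces

variable {K : Type*} [NormedAddCommGroup K] [InnerProductSpace ℂ K] [CompleteSpace K]
  {A : StarSubalgebra ℂ (K →L[ℂ] K)}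

/-- The square `τ(a*a)` of the `2`-norm. -/
noncomputable def traceSq (τ : A →ₗ[ℂ] ℂ) (a : A) : ℝ := (τ (star a * a)).re

theorem traceSq_add_le_of_nonneg {τ : A →ₗ[ℂ] ℂ} (hτ : ∀ a, 0 ≤ traceSq τ a) (a b : A) :
    traceSq τ (a + b) ≤ 2 * traceSq τ a + 2 * traceSq τ b := by
  have h : traceSq τ (a + b) + traceSq τ (a - b) = 2 * traceSq τ a + 2 * traceSq τ b := by
    simp only [traceSq, star_add, star_sub, add_mul, mul_add, sub_mul, mul_sub, map_add, map_sub,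
      Complex.add_re, Complex.sub_re]
    ring
  linarith [hτ (a - b)]

theorem traceSq_sub_le_of_nonneg {τ : A →ₗ[ℂ] ℂ} (hτ : ∀ a, 0 ≤ traceSq τ a) (a b c : A) :
    traceSq τ (a - c) ≤ 2 * traceSq τ (a - b) + 2 * traceSq τ (b - c) := by
  have := traceSq_add_le_of_nonneg hτ (a - b) (b - c)
  rwa [sub_add_sub_cancel] at this

/-- A faithful finite trace whose `2`-norm is compatible with the strong topology on bounded
sequences and complete on the unit ball. -/
structure IsNormalTracial (τ : A →ₗ[ℂ] ℂ) : Prop where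
  tracial : ∀ a b : A, τ (a * b) = τ (b * a)
  map_star : ∀ a : A, τ (star a) = starRingEnd ℂ (τ a)
  nonneg : ∀ a : A, 0 ≤ traceSq τ a
  faithful : ∀ a : A, traceSq τ a = 0 → a = 0
  mul_le : ∀ a b : A, traceSq τ (a * b) ≤ ‖a‖ ^ 2 * traceSq τ b
  cont : ∃ η : ℕ → K, ∀ a : ℕ → A, (∃ C, ∀ k, ‖a k‖ ≤ C) →
    (∀ n, Tendsto (fun k => (a k : K →L[ℂ] K) (η n)) atTop (𝓝 0)) →
    Tendsto (fun k => traceSq τ (a k)) atTop (𝓝 0)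
  compl : ∀ a : ℕ → A, (∃ C, ∀ k, ‖a k‖ ≤ C) →
    (∀ ε > 0, ∃ N, ∀ k ≥ N, ∀ l ≥ N, traceSq τ (a k - a l) < ε) →
    ∃ b : A, Tendsto (fun k => traceSq τ (a k - b)) atTop (𝓝 0) ∧
      ∃ φ : ℕ → ℕ, StrictMono φ ∧
        ∀ v, Tendsto (fun k => (a (φ k) : K →L[ℂ] K) v) atTop (𝓝 ((b : K →L[ℂ] K) v))

namespace IsNormalTracial

variable {τ : A →ₗ[ℂ] ℂ} (hτ : IsNormalTracial τ)
include hτ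

theorem im_star_mul_self (a : A) : (τ (star a * a)).im = 0 := by
  have h := hτ.map_star (star a * a)
  rw [star_mul, star_star] at h
  exact Complex.conj_eq_iff_im.1 h.symm

theorem apply_star_mul_self (a : A) : τ (star a * a) = (traceSq τ a : ℂ) :=
  Complex.ext rfl (hτ.im_star_mul_self a)

theorem traceSq_star (a : A) : traceSq τ (star a) = traceSq τ a := by
  rw [traceSq, traceSq, star_star, hτ.tracial]

theorem mul_le_right (a b : A) : traceSq τ (a * b) ≤ ‖b‖ ^ 2 * traceSq τ a := by
  rw [← hτ.traceSq_star (a * b), star_mul, ← hτ.traceSq_star a, ← norm_star b]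
  exact hτ.mul_le _ _

omit hτ in
theorem traceSq_neg (a : A) : traceSq τ (-a) = traceSq τ a := by simp [traceSq]

omit hτ in
theorem traceSq_sub_comm (a b : A) : traceSq τ (a - b) = traceSq τ (b - a) := by
  rw [← traceSq_neg, neg_sub]

omit hτ in
theorem traceSq_zero : traceSq τ 0 = 0 := by simp [traceSq]

omit hτ in
theorem traceSq_smul (c : ℂ) (a : A) : traceSq τ (c • a) = ‖c‖ ^ 2 * traceSq τ a := by
  have : star (c • a) * (c • a) = ((‖c‖ ^ 2 : ℝ) : ℂ) • (star a * a) := by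
    rw [star_smul, smul_mul_smul_comm]
    congr 1
    rw [← Complex.normSq_eq_norm_sq]
    exact (Complex.normSq_eq_conj_mul_self).symm
  rw [traceSq, this, map_smul, smul_eq_mul, Complex.re_ofReal_mul, traceSq]

theorem traceSq_add_le (a b : A) : traceSq τ (a + b) ≤ 2 * traceSq τ a + 2 * traceSq τ b :=
  traceSq_add_le_of_nonneg hτ.nonneg a b

theorem traceSq_sub_le (a b c : A) :
    traceSq τ (a - c) ≤ 2 * traceSq τ (a - b) + 2 * traceSq τ (b - c) :=
  traceSq_sub_le_of_nonneg hτ.nonneg a b c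

/-- The Cauchy-Schwarz inequality. -/
theorem norm_sq_le (a b : A) : ‖τ (star a * b)‖ ^ 2 ≤ traceSq τ a * traceSq τ b := by
  let core : PreInnerProductSpace.Core ℂ A :=
    { inner := fun a b => τ (star a * b)
      conj_inner_symm := fun a b => by rw [← hτ.map_star, star_mul, star_star]
      re_inner_nonneg := fun a => hτ.nonneg a
      add_left := fun a b c => by simp [add_mul]
      smul_left := fun a b r => by simp }
  have h := InnerProductSpace.Core.inner_mul_inner_self_le (c := core) a b
  have h2 : ‖τ (star b * a)‖ = ‖τ (star a * b)‖ := by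
    rw [← norm_star, ← starRingEnd_apply, ← hτ.map_star, star_mul, star_star]
  rw [sq]
  calc _ = ‖τ (star a * b)‖ * ‖τ (star b * a)‖ := by rw [h2]
    _ ≤ _ := h

theorem norm_apply_sq_le (a : A) : ‖τ a‖ ^ 2 ≤ traceSq τ 1 * traceSq τ a := by
  simpa using hτ.norm_sq_le 1 a

theorem tendsto_apply {a : ℕ → A} (h : Tendsto (fun k => traceSq τ (a k)) atTop (𝓝 0)) :
    Tendsto (fun k => τ (a k)) atTop (𝓝 0) := by
  rw [tendsto_zero_iff_norm_tendsto_zero]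
  have h1 : Tendsto (fun k => √(traceSq τ 1 * traceSq τ (a k))) atTop (𝓝 0) := by
    have := (h.const_mul (traceSq τ 1)).sqrt
    simpa using this
  exact squeeze_zero (fun _ => norm_nonneg _) (fun k => Real.le_sqrt_of_sq_le
    (hτ.norm_apply_sq_le _)) h1

theorem tendsto_mul_left {a : ℕ → A} (c : A) (h : Tendsto (fun k => traceSq τ (a k)) atTop (𝓝 0)) :
    Tendsto (fun k => traceSq τ (c * a k)) atTop (𝓝 0) :=
  squeeze_zero (fun _ => hτ.nonneg _) (fun _ => hτ.mul_le _ _) (by simpa using h.const_mul (‖c‖ ^ 2))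

theorem tendsto_mul_right {a : ℕ → A} (c : A)
    (h : Tendsto (fun k => traceSq τ (a k)) atTop (𝓝 0)) :
    Tendsto (fun k => traceSq τ (a k * c)) atTop (𝓝 0) :=
  squeeze_zero (fun _ => hτ.nonneg _) (fun _ => hτ.mul_le_right _ _)
    (by simpa using h.const_mul (‖c‖ ^ 2))

theorem tendsto_add {a b : ℕ → A} (ha : Tendsto (fun k => traceSq τ (a k)) atTop (𝓝 0))
    (hb : Tendsto (fun k => traceSq τ (b k)) atTop (𝓝 0)) :
    Tendsto (fun k => traceSq τ (a k + b k)) atTop (𝓝 0) :=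
  squeeze_zero (fun _ => hτ.nonneg _) (fun _ => hτ.traceSq_add_le _ _)
    (by simpa using (ha.const_mul 2).add (hb.const_mul 2))

theorem tendsto_bounded_mul {a b : ℕ → A} {C : ℝ} (hb : ∀ k, ‖b k‖ ≤ C)
    (ha : Tendsto (fun k => traceSq τ (a k)) atTop (𝓝 0)) :
    Tendsto (fun k => traceSq τ (b k * a k)) atTop (𝓝 0) :=
  squeeze_zero (fun _ => hτ.nonneg _) (fun k => (hτ.mul_le _ _).trans
    (mul_le_mul_of_nonneg_right (pow_le_pow_left₀ (norm_nonneg _) (hb k) 2) (hτ.nonneg _)))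
    (by simpa using ha.const_mul (C ^ 2))

/-- Limits in the `2`-norm are unique. -/
theorem eq_of_tendsto {a : ℕ → A} {b c : A}
    (hb : Tendsto (fun k => traceSq τ (a k - b)) atTop (𝓝 0))
    (hc : Tendsto (fun k => traceSq τ (a k - c)) atTop (𝓝 0)) : b = c := by
  rw [← sub_eq_zero]
  refine hτ.faithful _ (le_antisymm ?_ (hτ.nonneg _))
  have h : Tendsto (fun k => 2 * traceSq τ (a k - b) + 2 * traceSq τ (a k - c)) atTop (𝓝 0) := by
    simpa using (hb.const_mul 2).add (hc.const_mul 2)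
  refine ge_of_tendsto h (Eventually.of_forall fun k => ?_)
  rw [traceSq_sub_comm (a k) b]
  exact hτ.traceSq_sub_le _ _ _

theorem cauchy_of_tendsto {a : ℕ → A} {b : A}
    (hb : Tendsto (fun k => traceSq τ (a k - b)) atTop (𝓝 0)) :
    ∀ ε > 0, ∃ N, ∀ k ≥ N, ∀ l ≥ N, traceSq τ (a k - a l) < ε := by
  intro ε hε
  obtain ⟨N, hN⟩ := eventually_atTop.1 (hb.eventually_lt_const (by positivity : 0 < ε / 4))
  refine ⟨N, fun k hk l hl => ?_⟩
  have := hτ.traceSq_sub_le (a k) b (a l)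
  rw [traceSq_sub_comm b] at this
  linarith [hN k hk, hN l hl]

/-- Bounded Cauchy sequences for the `2`-norm converge, in the `2`-norm and strongly. -/
theorem exists_limit {a : ℕ → A} (hC : ∃ C, ∀ k, ‖a k‖ ≤ C)
    (hcauchy : ∀ ε > 0, ∃ N, ∀ k ≥ N, ∀ l ≥ N, traceSq τ (a k - a l) < ε) :
    ∃ b : A, Tendsto (fun k => traceSq τ (a k - b)) atTop (𝓝 0) ∧
      ∀ v, Tendsto (fun k => (a k : K →L[ℂ] K) v) atTop (𝓝 ((b : K →L[ℂ] K) v)) := by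
  obtain ⟨b, hb, -⟩ := hτ.compl a hC hcauchy
  -- Completeness supplies strong convergence only along a subsequence. Every subsequence has a
  -- strongly convergent one, and all the limits equal b because 2-norm limits are unique.
  refine ⟨b, hb, fun v => tendsto_of_subseq_tendsto fun ns hns => ?_⟩
  obtain ⟨C, hC⟩ := hC
  obtain ⟨c, hc, φ, hφ, hcv⟩ := hτ.compl (fun k => a (ns k)) ⟨C, fun k => hC _⟩ fun ε hε => by
    obtain ⟨N, hN⟩ := hcauchy ε hε
    obtain ⟨N', hN'⟩ := eventually_atTop.1 (hns.eventually_ge_atTop N)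
    exact ⟨N', fun k hk l hl => hN _ (hN' k hk) _ (hN' l hl)⟩
  rw [hτ.eq_of_tendsto (hb.comp hns) hc]
  exact ⟨φ, hcv v⟩

theorem cauchy_of_geometric {a : ℕ → A} {C : ℝ}
    (h : ∀ j, traceSq τ (a j - a (j + 1)) ≤ C * (1 / 4 : ℝ) ^ j) :
    ∀ ε > 0, ∃ N, ∀ k ≥ N, ∀ l ≥ N, traceSq τ (a k - a l) < ε := by
  -- The quasi-triangle inequality has the factor 2, and the constant closes the induction: 2|C| + 2
  -- · 4|C|/4 = 4|C|.
  have h1 : ∀ i j, traceSq τ (a j - a (j + i)) ≤ 4 * |C| * (1 / 4 : ℝ) ^ j := by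
    intro i
    induction i with
    | zero => intro j; rw [add_zero, sub_self, traceSq_zero]; positivity
    | succ i ih =>
      intro j
      have h2 := hτ.traceSq_sub_le (a j) (a (j + 1)) (a (j + (i + 1)))
      have h3 := ih (j + 1)
      rw [show j + 1 + i = j + (i + 1) by omega, pow_succ] at h3
      have h4 : C * (1 / 4 : ℝ) ^ j ≤ |C| * (1 / 4 : ℝ) ^ j :=
        mul_le_mul_of_nonneg_right (le_abs_self C) (by positivity)
      linarith [h j]
  intro ε hε
  have h5 : Tendsto (fun j : ℕ => 4 * |C| * (1 / 4 : ℝ) ^ j) atTop (𝓝 0) := by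
    simpa using (tendsto_pow_atTop_nhds_zero_of_lt_one (by norm_num : (0 : ℝ) ≤ 1 / 4)
      (by norm_num)).const_mul (4 * |C|)
  obtain ⟨N, hN⟩ := eventually_atTop.1 (h5.eventually_lt_const hε)
  refine ⟨N, fun k hk l hl => ?_⟩
  rcases le_total k l with hkl | hkl
  · obtain ⟨i, rfl⟩ := Nat.exists_eq_add_of_le hkl
    exact (h1 i k).trans_lt (hN k hk)
  · obtain ⟨i, rfl⟩ := Nat.exists_eq_add_of_le hkl
    rw [traceSq_sub_comm]
    exact (h1 i l).trans_lt (hN l hl)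

end IsNormalTracial

section Fiber

variable {A : VonNeumannAlgebra K} {τ : A.toStarSubalgebra →ₗ[ℂ] ℂ}

/-- Normality gives `traceSq τ a` = ∑ ‖a ξₙ‖², so convergence at the ξₙ controls the 2-norm by
dominated convergence. Conversely a 2-norm Cauchy sequence converges at every s ξₙ with s in the
commutant; faithfulness makes these vectors total, so bounded Cauchy sequences converge strongly. -/
theorem IsFaithfulNormalTrace.isNormalTracial (h : IsFaithfulNormalTrace τ) :
    IsNormalTracial τ := by
  obtain ⟨ξ, hξ, hsum⟩ := h.normal
  have hinner : ∀ (a : A.toStarSubalgebra) v, inner ℂ v ((star a * a : A.toStarSubalgebra).1 v) =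
      ((‖(a : K →L[ℂ] K) v‖ ^ 2 : ℝ) : ℂ) := by
    intro a v
    change inner ℂ v ((star (a : K →L[ℂ] K)) ((a : K →L[ℂ] K) v)) = _
    rw [ContinuousLinearMap.star_eq_adjoint, ContinuousLinearMap.adjoint_inner_right,
      inner_self_eq_norm_sq_to_K]
    simp
  have hsq : ∀ a : A.toStarSubalgebra,
      HasSum (fun n => ‖(a : K →L[ℂ] K) (ξ n)‖ ^ 2) (traceSq τ a) := by
    intro a
    have h1 := hsum (star a * a)
    simp only [hinner] at h1
    have h2 := Complex.hasSum_re h1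
    simp only [Complex.ofReal_re] at h2
    exact h2
  have hcont : ∀ a : ℕ → A.toStarSubalgebra, (∃ C, ∀ k, ‖a k‖ ≤ C) →
      (∀ n, Tendsto (fun k => (a k : K →L[ℂ] K) (ξ n)) atTop (𝓝 0)) →
      Tendsto (fun k => traceSq τ (a k)) atTop (𝓝 0) := by
    rintro a ⟨C, hC⟩ ha
    have h1 : ∀ k, traceSq τ (a k) = ∑' n, ‖(a k : K →L[ℂ] K) (ξ n)‖ ^ 2 := fun k =>
      (hsq _).tsum_eq.symm
    simp only [h1]
    rw [show (0 : ℝ) = ∑' _ : ℕ, 0 by simp]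
    refine tendsto_tsum_of_dominated_convergence (bound := fun n => C ^ 2 * ‖ξ n‖ ^ 2)
      (hξ.mul_left _) (fun n => by simpa using (ha n).norm.pow 2)
      (Eventually.of_forall fun k n => ?_)
    rw [norm_pow, norm_norm, ← mul_pow]
    exact pow_le_pow_left₀ (norm_nonneg _) (norm_apply_le_of_norm_le (hC k) _) 2
  have hfaith : ∀ a : A.toStarSubalgebra, traceSq τ a = 0 → a = 0 := by
    intro a ha
    refine h.faithful a (HasSum.unique (hsum _) ?_)
    have h1 := hsq a
    rw [ha, hasSum_zero_iff_of_nonneg fun n => by positivity] at h1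
    simp only [hinner]
    have h2 : ∀ n, ‖(a : K →L[ℂ] K) (ξ n)‖ ^ 2 = 0 := fun n => congrFun h1 n
    simpa only [h2, Complex.ofReal_zero] using (hasSum_zero (α := ℂ) (β := ℕ))
  have hdense : (Submodule.span ℂ {v | ∃ s ∈ A.commutant, ∃ n, v = s (ξ n)}).topologicalClosure
      = ⊤ := by
    set V := (Submodule.span ℂ {v | ∃ s ∈ A.commutant, ∃ n, v = s (ξ n)}).topologicalClosure with hV
    have : CompleteSpace V := (Submodule.isClosed_topologicalClosure _).completeSpace_coe
    have hinv : ∀ s ∈ A.commutant, ∀ v ∈ V, s v ∈ V := by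
      intro s hs v hv
      have hmaps : Set.MapsTo s
          (Submodule.span ℂ {v | ∃ s ∈ A.commutant, ∃ n, v = s (ξ n)} : Set K)
          (Submodule.span ℂ {v | ∃ s ∈ A.commutant, ∃ n, v = s (ξ n)} : Set K) := by
        intro v hv
        have : Submodule.span ℂ {v | ∃ s ∈ A.commutant, ∃ n, v = s (ξ n)} ≤
            (Submodule.span ℂ {v | ∃ s ∈ A.commutant, ∃ n, v = s (ξ n)}).comap
              (s : K →ₗ[ℂ] K) := by
          rw [Submodule.span_le]
          rintro _ ⟨t, ht, n, rfl⟩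
          exact Submodule.subset_span ⟨s * t, mul_mem hs ht, n, rfl⟩
        exact this hv
      exact hmaps.closure s.continuous hv
    have hmem : V.starProjection ∈ A := by
      refine A.mem_iff_commute.2 fun s hs => ?_
      ext v
      have h1 : s v = s (V.starProjection v) + s (v - V.starProjection v) := by
        rw [← map_add]; congr 1; abel
      have h2 : s (v - V.starProjection v) ∈ Vᗮ := by
        intro u hu
        rw [← ContinuousLinearMap.adjoint_inner_left, ← ContinuousLinearMap.star_eq_adjoint]
        exact V.sub_starProjection_mem_orthogonal v _ (hinv _ (star_mem hs) u hu)
      change s (V.starProjection v) = V.starProjection (s v)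
      rw [h1, map_add, Submodule.starProjection_eq_self_iff.2
        (hinv s hs _ (V.starProjection_apply_mem v)),
        (Submodule.starProjection_apply_eq_zero_iff V).2 h2, add_zero]
    -- The projection onto V lies in A, as V is invariant under the commutant. Its complement kills
    -- every ξₙ, hence has 2-norm zero.
    have h0 : (1 - ⟨V.starProjection, hmem⟩ : A.toStarSubalgebra) = 0 := by
      refine hfaith _ (HasSum.unique (hsq _) ?_)
      have hz : ∀ n, ((1 - ⟨V.starProjection, hmem⟩ : A.toStarSubalgebra) : K →L[ℂ] K) (ξ n) = 0 := by
        intro n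
        have : ξ n ∈ V := Submodule.le_topologicalClosure _
          (Submodule.subset_span ⟨1, one_mem _, n, rfl⟩)
        change ξ n - V.starProjection (ξ n) = 0
        rw [Submodule.starProjection_eq_self_iff.2 this, sub_self]
      have hz' : ∀ n, ‖((1 - ⟨V.starProjection, hmem⟩ : A.toStarSubalgebra) : K →L[ℂ] K) (ξ n)‖ ^ 2
          = 0 := fun n => by rw [hz n]; simp
      simp only [hz']
      exact hasSum_zero
    rw [eq_top_iff]
    intro v _
    have h1 : v - V.starProjection v = 0 := DFunLike.congr_fun (congrArg Subtype.val h0) v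
    rw [sub_eq_zero.1 h1]
    exact V.starProjection_apply_mem v
  refine ⟨h.tracial, fun a => ?_, fun a => (hsq a).nonneg fun n => by positivity, hfaith,
    fun a b => ?_, ⟨ξ, hcont⟩, ?_⟩
  · refine HasSum.unique (hsum (star a)) ?_
    have h1 := (hsum a).map (starRingEnd ℂ) Complex.continuous_conj
    refine HasSum.congr_fun h1 fun n => ?_
    change inner ℂ (ξ n) ((star (a : K →L[ℂ] K)) (ξ n)) = starRingEnd ℂ _
    rw [ContinuousLinearMap.star_eq_adjoint, ContinuousLinearMap.adjoint_inner_right]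
    simp [inner_conj_symm]
  · refine hasSum_le (fun n => ?_) (hsq (a * b)) ((hsq b).mul_left _)
    rw [← mul_pow]
    exact pow_le_pow_left₀ (norm_nonneg _) ((a : K →L[ℂ] K).le_opNorm _) 2
  · rintro a ⟨C, hC⟩ hcauchy
    obtain ⟨b, hb⟩ := exists_strong_limit (a := fun k => (a k : K →L[ℂ] K)) hC hdense (by
      rintro _ ⟨s, hs, n, rfl⟩
      have h1 : CauchySeq fun k => (a k : K →L[ℂ] K) (ξ n) := by
        rw [Metric.cauchySeq_iff]
        intro ε hε
        obtain ⟨N, hN⟩ := hcauchy (ε ^ 2) (by positivity)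
        refine ⟨N, fun k hk l hl => ?_⟩
        rw [dist_eq_norm]
        refine lt_of_pow_lt_pow_left₀ 2 hε.le (lt_of_le_of_lt ?_ (hN k hk l hl))
        exact le_hasSum (hsq (a k - a l)) n fun _ _ => by positivity
      have h2 : (fun k => (a k : K →L[ℂ] K) (s (ξ n))) =
          fun k => s ((a k : K →L[ℂ] K) (ξ n)) := by
        funext k
        exact (DFunLike.congr_fun (A.mem_iff_commute.1 (a k).2 s hs) (ξ n)).symm
      rw [h2]
      exact h1.map s.uniformContinuous)
    have hbA : b ∈ A := A.mem_of_strong_limit (fun k => (a k).2) hb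
    refine ⟨⟨b, hbA⟩, hcont _ ⟨C + ‖b‖, fun k => ?_⟩ fun n => ?_, id, strictMono_id, hb⟩
    · exact (norm_sub_le _ _).trans (add_le_add_left (hC k) _)
    · have := (hb (ξ n)).sub_const (b (ξ n))
      simpa using this

end Fiber

end Traces

/-! ### Generated von Neumann algebras and density of *-subrings. -/

section Generated

variable {K : Type*} [NormedAddCommGroup K] [InnerProductSpace ℂ K] [CompleteSpace K]

theorem mem_generatedVonNeumannAlgebra_iff {s : Set (K →L[ℂ] K)} {T : K →L[ℂ] K} :
    T ∈ generatedVonNeumannAlgebra s ↔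
      ∀ S : K →L[ℂ] K, (∀ a ∈ s, a * S = S * a ∧ a * star S = star S * a) → T * S = S * T := by
  have hC : ∀ S : K →L[ℂ] K, S ∈ StarSubalgebra.centralizer ℂ s ↔
      ∀ a ∈ s, a * S = S * a ∧ a * star S = star S * a := by
    intro S
    rw [StarSubalgebra.mem_centralizer_iff]
    refine forall₂_congr fun a _ => and_congr_right fun _ => ?_
    constructor <;> intro h <;> simpa using (congrArg star h).symm
  change T ∈ StarSubalgebra.centralizer ℂ
    (StarSubalgebra.centralizer ℂ s : Set (K →L[ℂ] K)) ↔ _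
  rw [StarSubalgebra.mem_centralizer_iff]
  constructor
  · exact fun h S hS => (h S ((hC S).2 hS)).1.symm
  · intro h S hS
    exact ⟨(h S ((hC S).1 hS)).symm, (h _ ((hC _).1 (star_mem hS))).symm⟩

theorem subset_generatedVonNeumannAlgebra {s : Set (K →L[ℂ] K)} {a : K →L[ℂ] K} (ha : a ∈ s) :
    a ∈ generatedVonNeumannAlgebra s :=
  mem_generatedVonNeumannAlgebra_iff.2 fun _ hS => (hS a ha).1

theorem generatedVonNeumannAlgebra_le {s : Set (K →L[ℂ] K)} {A : VonNeumannAlgebra K}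
    (h : ∀ a ∈ s, a ∈ A) {T : K →L[ℂ] K} (hT : T ∈ generatedVonNeumannAlgebra s) : T ∈ A :=
  A.mem_iff_commute.2 fun S hS => Eq.symm (mem_generatedVonNeumannAlgebra_iff.1 hT S fun a ha =>
    ⟨(A.mem_iff_commute.1 (h a ha) S hS).symm,
      (A.mem_iff_commute.1 (h a ha) _ (star_mem hS)).symm⟩)

/-- The norm closure of a `*`-subring containing a dense set of scalars. -/
noncomputable def Subring.starClosure (R : Subring (K →L[ℂ] K)) (hstar : ∀ a ∈ R, star a ∈ R)
    (hscal : ∀ c : ℂ, algebraMap ℂ (K →L[ℂ] K) c ∈ R.topologicalClosure) :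
    StarSubalgebra ℂ (K →L[ℂ] K) :=
  { R.topologicalClosure with
    algebraMap_mem' := hscal
    star_mem' := fun {a} ha => by
      have : Set.MapsTo star (R : Set (K →L[ℂ] K)) (R : Set (K →L[ℂ] K)) := hstar
      exact this.closure continuous_star ha }

/-- The Kaplansky density theorem for a `*`-subring containing a dense set of scalars. -/
theorem Subring.kaplansky_density (R : Subring (K →L[ℂ] K)) (hstar : ∀ a ∈ R, star a ∈ R)
    (hscal : ∀ c : ℂ, algebraMap ℂ (K →L[ℂ] K) c ∈ R.topologicalClosure) {T : K →L[ℂ] K}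
    (hT : T ∈ generatedVonNeumannAlgebra (R : Set (K →L[ℂ] K))) (η : ℕ → K) :
    ∃ a : ℕ → K →L[ℂ] K, (∀ k, a k ∈ R ∧ ‖a k‖ ≤ 2 * ‖T‖ + 2) ∧
      ∀ n, Tendsto (fun k => a k (η n)) atTop (𝓝 (T (η n))) := by
  -- The closure of R is a complex algebra, so the theorem applies there; moving back into R changes
  -- the k-th term by at most 1/(k+1), whence 2‖T‖ + 2 in place of 2‖T‖ + 1.
  obtain ⟨c, hc, hcη⟩ := _root_.kaplansky_density (R.starClosure hstar hscal) (T := T)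
    (fun S hS => mem_generatedVonNeumannAlgebra_iff.1 hT S fun a ha =>
      hS a (R.le_topologicalClosure ha)) η
  have happ : ∀ k : ℕ, ∃ a ∈ R, ‖a - c k‖ < 1 / ((k : ℝ) + 1) := fun k => by
    obtain ⟨a, ha, hac⟩ := Metric.mem_closure_iff.1 (hc k).1 (1 / ((k : ℝ) + 1)) (by positivity)
    rw [dist_comm, dist_eq_norm] at hac
    exact ⟨a, ha, hac⟩
  choose a haR ha using happ
  refine ⟨a, fun k => ⟨haR k, ?_⟩, fun n => ?_⟩
  · have h1 : ‖a k‖ ≤ ‖a k - c k‖ + ‖c k‖ := by simpa using norm_add_le (a k - c k) (c k)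
    have h2 : 1 / ((k : ℝ) + 1) ≤ 1 := by
      rw [div_le_one (by positivity)]; linarith [k.cast_nonneg (α := ℝ)]
    linarith [ha k, (hc k).2]
  · have h1 : Tendsto (fun k => (a k - c k) (η n)) atTop (𝓝 0) := by
      rw [tendsto_zero_iff_norm_tendsto_zero]
      refine squeeze_zero (fun _ => norm_nonneg _)
        (fun k => norm_apply_le_of_norm_le (ha k).le (η n)) ?_
      simpa using (tendsto_one_div_add_atTop_nhds_zero_nat (𝕜 := ℝ)).mul_const ‖η n‖
    have := h1.add (hcη n)
    simpa using this

/-- Kaplansky density is applied to the countably many vectors that control the 2-norm on bounded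
sets. This is how relations known on a countable subring reach the algebra it generates. -/
theorem IsNormalTracial.exists_seq_tendsto {A : StarSubalgebra ℂ (K →L[ℂ] K)} {τ : A →ₗ[ℂ] ℂ}
    (hτ : IsNormalTracial τ) (R : Subring (K →L[ℂ] K)) (hstar : ∀ a ∈ R, star a ∈ R)
    (hscal : ∀ c : ℂ, algebraMap ℂ (K →L[ℂ] K) c ∈ R.topologicalClosure)
    (hRA : ∀ a ∈ R, a ∈ A) (T : A)
    (hT : (T : K →L[ℂ] K) ∈ generatedVonNeumannAlgebra (R : Set (K →L[ℂ] K))) :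
    ∃ a : ℕ → A, (∀ k, (a k : K →L[ℂ] K) ∈ R) ∧ (∀ k, ‖a k‖ ≤ 2 * ‖T‖ + 2) ∧
      Tendsto (fun k => traceSq τ (a k - T)) atTop (𝓝 0) := by
  obtain ⟨η, hη⟩ := hτ.cont
  obtain ⟨a, ha, haη⟩ := R.kaplansky_density hstar hscal hT η
  refine ⟨fun k => ⟨a k, hRA _ (ha k).1⟩, fun k => (ha k).1, fun k => (ha k).2, ?_⟩
  refine hη _ ⟨2 * ‖T‖ + 2 + ‖T‖, fun k => ?_⟩ fun n => ?_
  · exact (norm_sub_le _ _).trans (add_le_add_left (ha k).2 _)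
  · have := (haη n).sub_const ((T : K →L[ℂ] K) (η n))
    simpa using this

end Generated

/-! ### Conditional expectations described by the functionals b ↦ τ(by). -/

section Expectation

variable {K : Type*} [NormedAddCommGroup K] [InnerProductSpace ℂ K] [CompleteSpace K]
  {A : StarSubalgebra ℂ (K →L[ℂ] K)}

/-- `h ∈ B` represents the functional `b ↦ τ(b y)` on `B`. -/
def IsExpectationValue (τ : A →ₗ[ℂ] ℂ) (B : VonNeumannAlgebra K) (y h : A) : Prop :=
  (h : K →L[ℂ] K) ∈ B ∧ ∀ b : A, (b : K →L[ℂ] K) ∈ B → τ (b * h) = τ (b * y)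

variable {τ : A →ₗ[ℂ] ℂ} {B : VonNeumannAlgebra K}

/-- An element of `B` whose left multiplication is bounded by `C` in the `2`-norm has norm at
most `C`. -/
theorem IsNormalTracial.norm_le_of_traceSq_mul_le (hτ : IsNormalTracial τ)
    (hBA : B.toStarSubalgebra ≤ A) {h : A} (hB : (h : K →L[ℂ] K) ∈ B) {C : ℝ} (hC0 : 0 ≤ C)
    (hC : ∀ c : A, (c : K →L[ℂ] K) ∈ B → traceSq τ (h * c) ≤ C ^ 2 * traceSq τ c) : ‖h‖ ≤ C := by
  set k : K →L[ℂ] K := star (h : K →L[ℂ] K) * h with hk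
  have hkB : k ∈ B := mul_mem (star_mem hB) hB
  have hksa : IsSelfAdjoint k := .star_mul_self _
  have hk0 : 0 ≤ k := star_mul_self_nonneg _
  have := B.isClosed_coe
  have hcfc : ∀ f : ℝ → ℝ, cfc f k ∈ B.toStarSubalgebra := fun f =>
    cfc_mem (s := B.toStarSubalgebra) f hkB
  -- Test the hypothesis on c = f(h*h), which is supported where h*h exceeds C². Since f(t)(t - C²)
  -- = f(t)², the difference of the two sides is the squared 2-norm of d = f^{3/2}(h*h), so d = 0
  -- and the spectrum of h*h stays below C².
  let f : ℝ → ℝ := fun t => max (t - C ^ 2) 0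
  have hf : Continuous f := by fun_prop
  have hf0 : ∀ t, 0 ≤ f t := fun t => le_max_right _ _
  let d : A := ⟨cfc (fun t => f t * √(f t)) k, hBA (hcfc _)⟩
  let c : A := ⟨cfc f k, hBA (hcfc _)⟩
  have hcs : star c = c := Subtype.ext (cfc_predicate f k : IsSelfAdjoint _).star_eq
  have hds : star d = d := Subtype.ext (cfc_predicate (fun t => f t * √(f t)) k :
    IsSelfAdjoint _).star_eq
  have hid : star (h * c) * (h * c) - ((C ^ 2 : ℝ) : ℂ) • (star c * c) = star d * d := by
    refine Subtype.ext ?_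
    rw [star_mul, hcs, hds]
    change cfc f k * star (h : K →L[ℂ] K) * (h * cfc f k) - (C ^ 2 : ℝ) • (cfc f k * cfc f k) =
      cfc (fun t => f t * √(f t)) k * cfc (fun t => f t * √(f t)) k
    have h1 : cfc f k * star (h : K →L[ℂ] K) * (h * cfc f k) = cfc f k * k * cfc f k := by
      rw [hk]; noncomm_ring
    have h2 : cfc f k * k * cfc f k = cfc (fun t => f t * t * f t) k := by
      conv_lhs => enter [1, 2]; rw [← cfc_id' ℝ k]
      rw [← cfc_mul f _ k, ← cfc_mul _ f k]
    rw [h1, h2, ← cfc_mul f f k, ← cfc_smul (C ^ 2 : ℝ) (fun t => f t * f t) k,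
      ← cfc_sub (fun t => f t * t * f t) (fun t => (C ^ 2 : ℝ) • (f t * f t)) k
        (by fun_prop) (by fun_prop),
      ← cfc_mul _ _ k (by fun_prop) (by fun_prop)]
    refine cfc_congr fun t _ => ?_
    have h3 : √(f t) * √(f t) = f t := Real.mul_self_sqrt (hf0 t)
    have h4 : f t * (t - C ^ 2) = f t * f t := by
      simp only [f]
      rcases le_total (t - C ^ 2) 0 with h | h
      · rw [max_eq_right h]; simp
      · rw [max_eq_left h]
    simp only [smul_eq_mul]
    linear_combination f t * h4 - f t * f t * h3
  have hd0 : d = 0 := by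
    refine hτ.faithful d (le_antisymm ?_ (hτ.nonneg d))
    rw [traceSq, ← hid, map_sub, map_smul, Complex.sub_re, smul_eq_mul, Complex.re_ofReal_mul]
    have := hC c (hcfc f)
    rw [traceSq, traceSq] at this
    linarith
  have hspec : ∀ t ∈ spectrum ℝ k, t ≤ C ^ 2 := by
    intro t ht
    have h1 := norm_apply_le_norm_cfc (fun t => f t * √(f t)) k ht (by fun_prop) hksa
    rw [show cfc (fun t => f t * √(f t)) k = 0 from congrArg Subtype.val hd0, norm_zero,
      norm_le_zero_iff] at h1
    have h2 : f t = 0 := by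
      rcases mul_eq_zero.1 h1 with h | h
      · exact h
      · exact (Real.sqrt_eq_zero (hf0 t)).1 h
    have h3 : t - C ^ 2 ≤ f t := le_max_left _ _
    linarith
  have hkn : ‖k‖ ≤ C ^ 2 := by
    rw [← cfc_id' ℝ k]
    refine norm_cfc_le (by positivity) fun t ht => ?_
    rw [Real.norm_eq_abs, abs_of_nonneg (spectrum_nonneg_of_nonneg hk0 ht)]
    exact hspec t ht
  rw [hk, CStarRing.norm_star_mul_self, ← sq] at hkn
  exact (le_abs_self _).trans (abs_le_of_sq_le_sq hkn hC0)

namespace IsExpectationValue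

theorem of_mem {b : A} (hb : (b : K →L[ℂ] K) ∈ B) : IsExpectationValue τ B b b :=
  ⟨hb, fun _ _ => rfl⟩

theorem add {y y' h h' : A} (H : IsExpectationValue τ B y h) (H' : IsExpectationValue τ B y' h') :
    IsExpectationValue τ B (y + y') (h + h') :=
  ⟨add_mem H.1 H'.1, fun b hb => by rw [mul_add, mul_add, map_add, map_add, H.2 b hb, H'.2 b hb]⟩

theorem smul {y h : A} (H : IsExpectationValue τ B y h) (c : ℂ) :
    IsExpectationValue τ B (c • y) (c • h) :=
  ⟨B.toStarSubalgebra.smul_mem H.1 c, fun b hb => by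
    rw [mul_smul_comm, mul_smul_comm, map_smul, map_smul, H.2 b hb]⟩

theorem sub {y y' h h' : A} (H : IsExpectationValue τ B y h) (H' : IsExpectationValue τ B y' h') :
    IsExpectationValue τ B (y - y') (h - h') :=
  ⟨sub_mem H.1 H'.1, fun b hb => by rw [mul_sub, mul_sub, map_sub, map_sub, H.2 b hb, H'.2 b hb]⟩

theorem bimodule (hτ : IsNormalTracial τ) {y h b c : A} (H : IsExpectationValue τ B y h)
    (hb : (b : K →L[ℂ] K) ∈ B) (hc : (c : K →L[ℂ] K) ∈ B) :
    IsExpectationValue τ B (b * y * c) (b * h * c) := by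
  refine ⟨mul_mem (mul_mem hb H.1) hc, fun d hd => ?_⟩
  have e : ∀ z : A, τ (d * (b * z * c)) = τ (c * d * b * z) := fun z => by
    rw [← mul_assoc, hτ.tracial]; simp only [mul_assoc]
  rw [e, e]
  exact H.2 _ (mul_mem (mul_mem hc hd) hb)

/-- The Cauchy-Schwarz inequality for τ(h*h) = τ(h*y). -/
theorem traceSq_le (hτ : IsNormalTracial τ) {y h : A} (H : IsExpectationValue τ B y h) :
    traceSq τ h ≤ traceSq τ y := by
  have h1 := hτ.norm_sq_le h y
  rw [← H.2 _ (star_mem H.1 : ((star h : A) : K →L[ℂ] K) ∈ B), hτ.apply_star_mul_self,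
    Complex.norm_real, Real.norm_eq_abs, sq_abs] at h1
  rcases (hτ.nonneg h).eq_or_lt with h0 | h0
  · rw [← h0]; exact hτ.nonneg y
  · rw [sq] at h1
    exact le_of_mul_le_mul_left h1 h0

/-- For c in B, hc represents yc, so ‖hc‖₂ ≤ ‖yc‖₂ ≤ ‖y‖ ‖c‖₂. A 2-norm bound for left
multiplication on B is an operator norm bound. No positivity of the expectation is used. -/
theorem norm_le (hτ : IsNormalTracial τ) (hBA : B.toStarSubalgebra ≤ A) {y h : A}
    (H : IsExpectationValue τ B y h) : ‖h‖ ≤ ‖y‖ := by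
  refine hτ.norm_le_of_traceSq_mul_le hBA H.1 (norm_nonneg _) fun c hc => ?_
  have h1 := (H.bimodule hτ (b := 1) (one_mem B : (1 : K →L[ℂ] K) ∈ B) hc).traceSq_le hτ
  rw [one_mul, one_mul] at h1
  exact h1.trans (hτ.mul_le _ _)

theorem unique (hτ : IsNormalTracial τ) {y h h' : A} (H : IsExpectationValue τ B y h)
    (H' : IsExpectationValue τ B y h') : h = h' := by
  have h1 := (H.sub H').traceSq_le hτ
  rw [sub_self, IsNormalTracial.traceSq_zero] at h1
  exact sub_eq_zero.1 (hτ.faithful _ (le_antisymm h1 (hτ.nonneg _)))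

/-- Both contractivity estimates enter: the values form a bounded sequence which is Cauchy in the
2-norm, so they converge, and strong closedness keeps the limit in B. -/
theorem exists_of_tendsto (hτ : IsNormalTracial τ) (hBA : B.toStarSubalgebra ≤ A) {y : A}
    {a h : ℕ → A} {C : ℝ} (hC : ∀ k, ‖a k‖ ≤ C)
    (ha : Tendsto (fun k => traceSq τ (a k - y)) atTop (𝓝 0))
    (H : ∀ k, IsExpectationValue τ B (a k) (h k)) : ∃ z, IsExpectationValue τ B y z := by
  obtain ⟨z, hz, φ, -, hzs⟩ := hτ.compl h ⟨C, fun k => ((H k).norm_le hτ hBA).trans (hC k)⟩ (by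
    intro ε hε
    obtain ⟨N, hN⟩ := hτ.cauchy_of_tendsto ha ε hε
    exact ⟨N, fun k hk l hl => (((H k).sub (H l)).traceSq_le hτ).trans_lt (hN k hk l hl)⟩)
  refine ⟨z, B.mem_of_strong_limit (fun k => (H _).1) hzs, fun b hb => ?_⟩
  have h1 := hτ.tendsto_apply (hτ.tendsto_mul_left b hz)
  have h2 := hτ.tendsto_apply (hτ.tendsto_mul_left b ha)
  have h3 : (fun k => τ (b * (a k - y))) = fun k => τ (b * (h k - z)) + (τ (b * z) - τ (b * y)) := by
    funext k
    rw [mul_sub, mul_sub, map_sub, map_sub, (H k).2 b hb]; ring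
  rw [h3] at h2
  have h4 := tendsto_nhds_unique h2 (h1.add_const _)
  rw [zero_add] at h4
  exact sub_eq_zero.1 h4.symm

end IsExpectationValue

/-- The inclusion has finite index as soon as the expectation and a Pimsner-Popa basis exist on a
subset dense in the `2`-norm on bounded sets. -/
theorem IsNormalTracial.isFiniteIndex_of_dense (hτ : IsNormalTracial τ)
    (hBA : B.toStarSubalgebra ≤ A) (D : Set A)
    (hD : ∀ y : A, ∃ a : ℕ → A, (∀ k, a k ∈ D) ∧ (∃ C, ∀ k, ‖a k‖ ≤ C) ∧
      Tendsto (fun k => traceSq τ (a k - y)) atTop (𝓝 0))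
    (hE : ∀ y ∈ D, ∃ h, IsExpectationValue τ B y h) {k : ℕ} (m p : Fin k → A)
    (hp : ∀ i, (p i : K →L[ℂ] K) ∈ B ∧ IsStarProjection (p i))
    (hm : ∀ i j, IsExpectationValue τ B (m i * star (m j)) (if i = j then p i else 0))
    (hbasis : ∀ y ∈ D, ∃ h : Fin k → A,
      (∀ i, IsExpectationValue τ B (y * star (m i)) (h i)) ∧ y = ∑ i, h i * m i) :
    IsFiniteIndex τ B.toStarSubalgebra := by
  classical
  have hall : ∀ y : A, ∃ h, IsExpectationValue τ B y h := by
    intro y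
    obtain ⟨a, haD, ⟨C, hC⟩, ha⟩ := hD y
    choose h hh using fun k => hE (a k) (haD k)
    exact IsExpectationValue.exists_of_tendsto hτ hBA hC ha hh
  choose e he using hall
  let E : A →ₗ[ℂ] A :=
    { toFun := e
      map_add' := fun x y => (he (x + y)).unique hτ ((he x).add (he y))
      map_smul' := fun c x => (he (c • x)).unique hτ ((he x).smul c) }
  have hEe : ∀ y, E y = e y := fun _ => rfl
  have hsum : ∀ y : A, y = ∑ i, E (y * star (m i)) * m i := by
    intro y
    obtain ⟨a, haD, -, ha⟩ := hD y
    -- Both sides of the reconstruction formula are 2-norm continuous in y and agree on the dense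
    -- set.
    refine hτ.eq_of_tendsto ha ?_
    have h1 : ∀ j, a j = ∑ i, E (a j * star (m i)) * m i := by
      intro j
      obtain ⟨h, hh, hj⟩ := hbasis _ (haD j)
      conv_lhs => rw [hj]
      exact Finset.sum_congr rfl fun i _ => by rw [hEe, (he _).unique hτ (hh i)]
    have h2 : ∀ j, a j - ∑ i, E (y * star (m i)) * m i =
        ∑ i, E ((a j - y) * star (m i)) * m i := by
      intro j
      conv_lhs => rw [h1 j]
      rw [← Finset.sum_sub_distrib]
      exact Finset.sum_congr rfl fun i _ => by rw [sub_mul, map_sub, sub_mul]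
    simp only [h2]
    have h3 : ∀ s : Finset (Fin k), Tendsto
        (fun j => traceSq τ (∑ i ∈ s, E ((a j - y) * star (m i)) * m i)) atTop (𝓝 0) := by
      intro s
      induction s using Finset.induction_on with
      | empty => simp [IsNormalTracial.traceSq_zero]
      | insert i s hi ih =>
        simp only [Finset.sum_insert hi]
        refine hτ.tendsto_add (hτ.tendsto_mul_right _ ?_) ih
        exact squeeze_zero (fun _ => hτ.nonneg _) (fun _ => (he _).traceSq_le hτ)
          (hτ.tendsto_mul_right _ ha)
    exact h3 _
  -- The projection of a fiber may vanish, whereas a Pimsner-Popa basis has nonzero projections.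
  -- Such indices can be dropped because τ(mᵢmᵢ*) = τ(pᵢ) = 0.
  have hm0 : ∀ i, p i = 0 → m i = 0 := by
    intro i hi
    have h1 := (hm i i).2 1 (one_mem B : (1 : K →L[ℂ] K) ∈ B)
    rw [if_pos rfl, hi, mul_zero, map_zero, one_mul] at h1
    have h2 : star (m i) = 0 := hτ.faithful _ (by rw [traceSq, star_star, ← h1]; simp)
    simpa using h2
  refine ⟨hBA, E, ⟨fun a => (he a).1, fun b hb => (he b).unique hτ (.of_mem hb),
    fun a b c hb hc => (he _).unique hτ ((he a).bimodule hτ hb hc), fun a => ?_⟩, ?_⟩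
  · simpa [hEe] using (he a).2 1 (one_mem B : (1 : K →L[ℂ] K) ∈ B)
  · let σ := Fintype.equivFin {i // p i ≠ 0}
    refine ⟨_, fun j => m (σ.symm j), fun j => p (σ.symm j), fun j => ⟨(hp _).1, (hp _).2,
      (σ.symm j).2⟩, fun i j => ?_, fun y => ?_⟩
    · rw [hEe, (he _).unique hτ (hm _ _)]
      simp [Subtype.ext_iff.symm]
    · conv_lhs => rw [hsum y]
      rw [Equiv.sum_comp σ.symm fun i : {i // p i ≠ 0} => E (y * star (m i)) * m i,
        ← Finset.sum_subtype (Finset.univ.filter fun i => p i ≠ 0) (by simp)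
          (fun i => E (y * star (m i)) * m i)]
      refine (Finset.sum_filter_of_ne (p := fun i => p i ≠ 0) fun i _ hne hpi => hne ?_).symm
      rw [hm0 i hpi, mul_zero]

end Expectation

/-! ### From geometric decay of integrals to geometric decay almost everywhere. -/

section AlmostEverywhere

variable {X : Type*} [MeasurableSpace X] {μ : Measure X}

/-- Functions whose integrals decay geometrically decay geometrically almost everywhere. -/
theorem ae_exists_forall_le_of_integral_le {f : ℕ → X → ℝ} {n : ℕ}
    (hf : ∀ j, Integrable (f j) μ) (h0 : ∀ j, 0 ≤ᵐ[μ] f j)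
    (hle : ∀ j ≥ n, ∫ x, f j x ∂μ ≤ (1 / 16 : ℝ) ^ j) :
    ∀ᵐ x ∂μ, ∃ C : ℝ, 0 ≤ C ∧ ∀ j ≥ n, f j x ≤ C * (1 / 4 : ℝ) ^ j := by
  -- The weight 4^j turns the rate 16^{-j} of the integrals into the summable 4^{-j}; finiteness of
  -- the sum almost everywhere bounds every 4^j f_j(x) by one constant.
  have hmeas : ∀ j : ℕ, AEMeasurable (fun x => ENNReal.ofReal (4 ^ j * f j x)) μ := fun j =>
    (((hf j).aemeasurable).const_mul _).ennreal_ofReal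
  have hsum : ∫⁻ x, ∑' j, ENNReal.ofReal (4 ^ (j + n) * f (j + n) x) ∂μ ≠ ∞ := by
    rw [lintegral_tsum fun j => hmeas (j + n)]
    have hb : ∀ j : ℕ, ∫⁻ x, ENNReal.ofReal (4 ^ (j + n) * f (j + n) x) ∂μ
        ≤ ENNReal.ofReal ((1 / 4 : ℝ) ^ j) := by
      intro j
      rw [← ofReal_integral_eq_lintegral_ofReal ((hf (j + n)).const_mul _) ?_]
      · refine ENNReal.ofReal_le_ofReal ?_
        rw [integral_const_mul]
        calc (4 : ℝ) ^ (j + n) * ∫ x, f (j + n) x ∂μ ≤ 4 ^ (j + n) * (1 / 16 : ℝ) ^ (j + n) := by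
              gcongr
              exact hle _ (Nat.le_add_left n j)
          _ = (1 / 4 : ℝ) ^ (j + n) := by rw [← mul_pow]; norm_num
          _ ≤ (1 / 4 : ℝ) ^ j := pow_le_pow_of_le_one (by norm_num) (by norm_num)
              (Nat.le_add_right j n)
      · filter_upwards [h0 (j + n)] with x hx
        have : 0 ≤ f (j + n) x := hx
        simp only [Pi.zero_apply]
        positivity
    refine ne_top_of_le_ne_top ?_ (ENNReal.tsum_le_tsum hb)
    have hs : Summable fun n : ℕ => (1 / 4 : ℝ) ^ n :=
      summable_geometric_of_lt_one (by norm_num) (by norm_num)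
    rw [← ENNReal.ofReal_tsum_of_nonneg (fun n => by positivity) hs]
    exact ENNReal.ofReal_ne_top
  filter_upwards [ae_lt_top' (AEMeasurable.tsum fun j => hmeas (j + n)) hsum] with x hx
  refine ⟨(∑' j, ENNReal.ofReal (4 ^ (j + n) * f (j + n) x)).toReal, ENNReal.toReal_nonneg,
    fun j hj => ?_⟩
  obtain ⟨i, rfl⟩ := Nat.exists_eq_add_of_le' hj
  have h1 := ENNReal.le_tsum (f := fun j => ENNReal.ofReal (4 ^ (j + n) * f (j + n) x)) i
  have h2 := (ENNReal.ofReal_le_iff_le_toReal hx.ne).1 h1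
  rw [div_pow, one_pow, mul_one_div, le_div_iff₀ (by positivity)]
  linarith

theorem cauchySeq_of_sq_dist_le {E : Type*} [NormedAddCommGroup E] {u : ℕ → E} {C : ℝ} {n : ℕ}
    (hC : 0 ≤ C) (h : ∀ j ≥ n, ‖u j - u (j + 1)‖ ^ 2 ≤ C * (1 / 4 : ℝ) ^ j) : CauchySeq u := by
  rw [← cauchySeq_shift n]
  refine cauchySeq_of_le_geometric (1 / 2) (Real.sqrt C * (1 / 2) ^ n) (by norm_num) fun j => ?_
  rw [dist_eq_norm]
  refine le_of_sq_le_sq ?_ (by positivity)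
  have h1 := h (j + n) (Nat.le_add_left n j)
  have e : (Real.sqrt C * (1 / 2) ^ n * (1 / 2) ^ j) ^ 2 = C * (1 / 4 : ℝ) ^ (j + n) := by
    rw [mul_pow, mul_pow, Real.sq_sqrt hC, ← pow_mul, ← pow_mul, mul_comm n, mul_comm j, pow_mul,
      pow_mul, pow_add]
    norm_num
    ring
  rw [e, Nat.add_right_comm j 1 n]
  exact h1

end AlmostEverywhere

/-! ### Total sequences of sections and decomposable operators. -/

namespace MeasurableHilbertField

variable {X : Type u} [MeasurableSpace X] {μ : Measure X} {H : X → Type v}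
  [∀ x, NormedAddCommGroup (H x)] [∀ x, InnerProductSpace ℂ (H x)]
  {F : MeasurableHilbertField μ H}

theorem smul_mem_sections {f : X → ℂ} (hf : AEStronglyMeasurable f μ) {ζ : ∀ x, H x}
    (hζ : ζ ∈ F.sections) : (fun x => f x • ζ x) ∈ F.sections :=
  (F.mem_sections_iff _).2 fun ξ hξ => by
    simp only [inner_smul_right]
    exact hf.mul (F.aesm_inner hξ hζ)

variable (F) in
/-- There is a total sequence of square-integrable sections. -/
theorem exists_total_seq [SigmaFinite μ] : ∃ ζ : ℕ → F.PreDirectIntegral,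
    ∀ᵐ x ∂μ, (Submodule.span ℂ (Set.range fun n => (ζ n).val x)).topologicalClosure = ⊤ := by
  obtain ⟨ζ, hζ, htot⟩ := F.exists_fundamental
  obtain ⟨g, hg0, hgm, hg⟩ := exists_pos_lintegral_lt_of_sigmaFinite μ one_ne_zero
  have hgi : Integrable (fun x => (g x : ℝ)) μ := by
    refine ⟨hgm.coe_nnreal_real.aestronglyMeasurable, ?_⟩
    rw [hasFiniteIntegral_iff_ofReal (Eventually.of_forall fun x => NNReal.coe_nonneg _)]
    simpa using hg.trans ENNReal.one_lt_top
  -- A strictly positive factor making ζ n square-integrable, with ‖c ζ‖² ≤ g for an integrable g >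
  -- 0. Rescaling by nonzero numbers does not change the span in a fiber.
  let c : ℕ → X → ℝ := fun n x => √(g x) * (1 + ‖ζ n x‖)⁻¹
  have hc0 : ∀ n x, 0 < c n x := fun n x => by
    have := hg0 x
    have : (0 : ℝ) < g x := by exact_mod_cast this
    positivity
  have hcm : ∀ n, AEStronglyMeasurable (fun x => (c n x : ℂ)) μ := fun n => by
    refine Complex.continuous_ofReal.comp_aestronglyMeasurable ?_
    refine AEStronglyMeasurable.mul ?_ ?_
    · exact (Real.continuous_sqrt.measurable.comp hgm.coe_nnreal_real).aestronglyMeasurable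
    · exact ((aemeasurable_const.add (F.aesm_norm (hζ n)).aemeasurable).inv).aestronglyMeasurable
  have hmem : ∀ n, (fun x => (c n x : ℂ) • ζ n x) ∈ F.sqIntegrableSections := fun n => by
    have hs := smul_mem_sections (hcm n) (hζ n)
    refine ⟨hs, hgi.mono ((F.aesm_norm hs).pow 2) (Eventually.of_forall fun x => ?_)⟩
    have h1 : c n x * ‖ζ n x‖ ≤ √(g x) := by
      simp only [c]
      rw [mul_assoc]
      refine mul_le_of_le_one_right (Real.sqrt_nonneg _) ?_
      rw [inv_mul_le_iff₀ (by positivity)]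
      linarith
    rw [norm_smul, Complex.norm_real, Real.norm_eq_abs (c n x), abs_of_pos (hc0 n x), norm_pow,
      norm_mul, norm_norm, Real.norm_eq_abs (c n x), abs_of_pos (hc0 n x)]
    calc (c n x * ‖ζ n x‖) ^ 2 ≤ √(g x) ^ 2 :=
          pow_le_pow_left₀ (mul_nonneg (hc0 n x).le (norm_nonneg _)) h1 2
      _ = g x := Real.sq_sqrt (NNReal.coe_nonneg _)
      _ ≤ _ := le_abs_self _
  refine ⟨fun n => ⟨_, hmem n⟩, ?_⟩
  filter_upwards [htot] with x hx
  rw [eq_top_iff, ← hx]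
  refine Submodule.topologicalClosure_mono (Submodule.span_le.2 ?_)
  rintro _ ⟨n, rfl⟩
  have h1 : ((c n x : ℂ) • ζ n x) ∈ Submodule.span ℂ (Set.range fun n => (c n x : ℂ) • ζ n x) :=
    Submodule.subset_span ⟨n, rfl⟩
  have h2 := Submodule.smul_mem _ (c n x : ℂ)⁻¹ h1
  have h3 : (c n x : ℂ) ≠ 0 := by exact_mod_cast (hc0 n x).ne'
  rwa [smul_smul, inv_mul_cancel₀ h3, one_smul] at h2

variable (F) in
/-- There is a sequence of square-integrable sections with dense values. -/
theorem exists_dense_seq [SigmaFinite μ] : ∃ ζ : ℕ → F.PreDirectIntegral,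
    ∀ᵐ x ∂μ, DenseRange fun n => (ζ n).val x := by
  obtain ⟨ζ, hζ⟩ := F.exists_total_seq
  let d : ℕ → ℂ := TopologicalSpace.denseSeq ℂ
  -- Integer combinations of the sections d ζ, with d in a countable dense set of scalars, form a
  -- countable group; the closure of its values at x contains all complex combinations.
  let L : FreeAbelianGroup (ℕ × ℕ) →+ F.PreDirectIntegral :=
    FreeAbelianGroup.lift fun i => d i.1 • ζ i.2
  obtain ⟨e, he⟩ := exists_surjective_nat (FreeAbelianGroup (ℕ × ℕ))
  refine ⟨fun n => L (e n), ?_⟩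
  filter_upwards [hζ] with x hx
  let ev : F.PreDirectIntegral →+ H x :=
    { toFun := fun ζ => ζ.val x, map_zero' := rfl, map_add' := fun _ _ => rfl }
  let G : AddSubgroup (H x) := (ev.comp L).range
  have hG : ∀ i n, d i • (ζ n).val x ∈ G := fun i n =>
    ⟨FreeAbelianGroup.of (i, n), by simp only [AddMonoidHom.comp_apply, L, FreeAbelianGroup.lift_apply_of]; rfl⟩
  have hG' : ∀ (c : ℂ) n, c • (ζ n).val x ∈ G.topologicalClosure := by
    intro c n
    have h1 : Continuous fun c : ℂ => c • (ζ n).val x := by fun_prop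
    exact map_mem_closure (f := fun c : ℂ => c • (ζ n).val x) h1 (TopologicalSpace.denseRange_denseSeq ℂ c)
      (by rintro _ ⟨i, rfl⟩; exact hG i n)
  have hspan : (Submodule.span ℂ (Set.range fun n => (ζ n).val x) : Set (H x)) ⊆
      G.topologicalClosure := by
    intro v hv
    induction hv using Submodule.closure_induction with
    | zero => exact zero_mem _
    | add u v _ _ hu hv => exact add_mem hu hv
    | smul_mem c v hv =>
      obtain ⟨n, rfl⟩ := hv
      exact hG' c n
  have hr : (Set.range fun n => (L (e n)).val x) = (G : Set (H x)) := by
    ext v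
    constructor
    · rintro ⟨n, rfl⟩; exact ⟨e n, rfl⟩
    · rintro ⟨y, rfl⟩
      obtain ⟨n, rfl⟩ := he y
      exact ⟨n, rfl⟩
  rw [DenseRange, hr]
  intro v
  have hv : v ∈ (Submodule.span ℂ (Set.range fun n => (ζ n).val x)).topologicalClosure :=
    hx ▸ Submodule.mem_top
  have := closure_minimal hspan G.isClosed_topologicalClosure hv
  exact this

/-- The operator on the direct integral given by a measurable field of operators. -/
theorem IsMeasurableOperatorField.exists_isIntegralOf {t : ∀ x, H x →L[ℂ] H x}
    (ht : F.IsMeasurableOperatorField t) :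
    ∃ T : F.DirectIntegral →L[ℂ] F.DirectIntegral, F.IsIntegralOf T t := by
  obtain ⟨C, hC⟩ := ht.bounded
  let L : F.PreDirectIntegral →ₗ[ℂ] F.PreDirectIntegral :=
    { toFun := ht.app
      map_add' := fun ζ η => Subtype.ext (funext fun x => map_add (t x) _ _)
      map_smul' := fun c ζ => Subtype.ext (funext fun x => map_smul (t x) _ _) }
  have hL : ∀ ζ, ‖L ζ‖ ≤ |C| * ‖ζ‖ := by
    intro ζ
    refine le_of_sq_le_sq ?_ (by positivity)
    rw [mul_pow, PreDirectIntegral.norm_sq, PreDirectIntegral.norm_sq, ← integral_const_mul]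
    refine integral_mono_ae (L ζ).integrable_sq (ζ.integrable_sq.const_mul _) ?_
    filter_upwards [hC] with x hx
    rw [← mul_pow]
    exact pow_le_pow_left₀ (norm_nonneg _)
      ((t x).le_of_opNorm_le (hx.trans (le_abs_self C)) _) 2
  let L' : F.PreDirectIntegral →L[ℂ] F.PreDirectIntegral := L.mkContinuous |C| hL
  refine ⟨SeparationQuotient.liftCLM (SeparationQuotient.mkCLM ℂ _ ∘L L') fun ζ η h => ?_, ht,
    fun ζ => rfl⟩
  exact SeparationQuotient.mk_eq_mk.2 (h.map L'.continuous)

namespace IsIntegralOf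

variable {S T : F.DirectIntegral →L[ℂ] F.DirectIntegral} {s t : ∀ x, H x →L[ℂ] H x}

theorem congr (hT : F.IsIntegralOf T t) (h : ∀ᵐ x ∂μ, s x = t x) : F.IsIntegralOf T s := by
  obtain ⟨ht, hT⟩ := hT
  refine ⟨⟨fun ξ hξ η hη => (ht.measurable ξ hξ η hη).congr ?_, ?_⟩, fun ζ => ?_⟩
  · filter_upwards [h] with x hx
    rw [hx]
  · obtain ⟨C, hC⟩ := ht.bounded
    refine ⟨C, ?_⟩
    filter_upwards [h, hC] with x hx hx'
    rwa [hx]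
  · rw [hT, toDirectIntegral_eq_iff]
    filter_upwards [h] with x hx
    change t x _ = s x _
    rw [hx]

theorem add (hS : F.IsIntegralOf S s) (hT : F.IsIntegralOf T t) :
    F.IsIntegralOf (S + T) fun x => s x + t x := by
  obtain ⟨hs, hS⟩ := hS
  obtain ⟨ht, hT⟩ := hT
  refine ⟨hs.add ht, fun ζ => ?_⟩
  rw [add_apply, hT, hS]
  rfl

theorem mul (hS : F.IsIntegralOf S s) (hT : F.IsIntegralOf T t) :
    F.IsIntegralOf (S * T) fun x => s x * t x := by
  obtain ⟨hs, hS⟩ := hS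
  obtain ⟨ht, hT⟩ := hT
  refine ⟨hs.mul ht, fun ζ => ?_⟩
  rw [mul_apply_eq_comp, hT, hS]
  rfl

variable (F) in
theorem scalar (c : ℂ) : F.IsIntegralOf (algebraMap ℂ _ c) fun x => algebraMap ℂ (H x →L[ℂ] H x) c :=
  ⟨.scalar c, fun _ => rfl⟩

theorem smul (hT : F.IsIntegralOf T t) (c : ℂ) : F.IsIntegralOf (c • T) fun x => c • t x := by
  have := (scalar F c).mul hT
  simpa only [← Algebra.smul_def] using this

theorem sub (hS : F.IsIntegralOf S s) (hT : F.IsIntegralOf T t) :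
    F.IsIntegralOf (S - T) fun x => s x - t x := by
  have := hS.add (hT.smul (-1))
  have e : S - T = S + (-1 : ℂ) • T := by ext; simp [sub_eq_add_neg]
  rw [e]
  simpa only [neg_one_smul, ← sub_eq_add_neg] using this

theorem star [∀ x, CompleteSpace (H x)] (hT : F.IsIntegralOf T t) :
    F.IsIntegralOf (star T) fun x => star (t x) := by
  obtain ⟨ht, hT⟩ := hT
  refine ⟨ht.star, fun ζ => ?_⟩
  refine ext_inner_right ℂ fun ξ => ?_
  obtain ⟨η, rfl⟩ := SeparationQuotient.surjective_mk ξ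
  rw [ContinuousLinearMap.star_eq_adjoint, ContinuousLinearMap.adjoint_inner_left]
  change inner ℂ _ (T (F.toDirectIntegral η)) = _
  rw [hT]
  change inner ℂ ζ (ht.app η) = inner ℂ (ht.star.app ζ) η
  rw [PreDirectIntegral.inner_def, PreDirectIntegral.inner_def]
  refine integral_congr_ae (Eventually.of_forall fun x => ?_)
  change inner ℂ (ζ.val x) (t x (η.val x)) = inner ℂ (Star.star (t x) (ζ.val x)) (η.val x)
  rw [ContinuousLinearMap.star_eq_adjoint, ContinuousLinearMap.adjoint_inner_left]

/-- Multiplication by an essentially bounded function. -/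
theorem exists_diagonal {f : X → ℂ} (hf : AEStronglyMeasurable f μ) {C : ℝ}
    (hC : ∀ᵐ x ∂μ, ‖f x‖ ≤ C) : ∃ T : F.DirectIntegral →L[ℂ] F.DirectIntegral,
      F.IsIntegralOf T fun x => f x • ContinuousLinearMap.id ℂ (H x) := by
  refine IsMeasurableOperatorField.exists_isIntegralOf ⟨fun ξ hξ η hη => ?_, C, ?_⟩
  · simp only [smul_apply, ContinuousLinearMap.id_apply, inner_smul_right]
    exact hf.mul (F.aesm_inner hη hξ)
  · filter_upwards [hC] with x hx
    rw [norm_smul]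
    exact (mul_le_of_le_one_right (norm_nonneg _) ContinuousLinearMap.norm_id_le).trans hx

/-- The field of operators is determined almost everywhere. -/
theorem ae_eq [SigmaFinite μ] (hS : F.IsIntegralOf T s) (hT : F.IsIntegralOf T t) :
    ∀ᵐ x ∂μ, s x = t x := by
  obtain ⟨ζ, hζ⟩ := F.exists_dense_seq
  obtain ⟨hs, hS⟩ := hS
  obtain ⟨ht, hT⟩ := hT
  have h1 : ∀ n, ∀ᵐ x ∂μ, s x ((ζ n).val x) = t x ((ζ n).val x) := fun n =>
    (F.toDirectIntegral_eq_iff (hs.app (ζ n)) (ht.app (ζ n))).1 ((hS _).symm.trans (hT _))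
  filter_upwards [hζ, ae_all_iff.2 h1] with x hx h
  refine ContinuousLinearMap.coeFn_injective (hx.equalizer (s x).continuous (t x).continuous ?_)
  exact funext h

theorem norm_apply_sq (hT : F.IsIntegralOf T t) (ζ : F.PreDirectIntegral) :
    Integrable (fun x => ‖t x (ζ.val x)‖ ^ 2) μ ∧
    ‖T (F.toDirectIntegral ζ)‖ ^ 2 = ∫ x, ‖t x (ζ.val x)‖ ^ 2 ∂μ := by
  obtain ⟨ht, hT⟩ := hT
  refine ⟨(ht.app ζ).integrable_sq, ?_⟩
  rw [hT]
  exact PreDirectIntegral.norm_sq (ht.app ζ)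

theorem ext_of_eq (hS : F.IsIntegralOf S t) (hT : F.IsIntegralOf T t) : S = T := by
  ext η
  obtain ⟨ζ, rfl⟩ := SeparationQuotient.surjective_mk η
  exact (hS.2 ζ).trans (hT.2 ζ).symm

/-- The fibers of an operator are almost everywhere bounded by its norm. -/
theorem ae_norm_le [SigmaFinite μ] (hT : F.IsIntegralOf T t) : ∀ᵐ x ∂μ, ‖t x‖ ≤ ‖T‖ := by
  obtain ⟨ζ, hζ⟩ := F.exists_dense_seq
  have h1 : ∀ n, ∀ᵐ x ∂μ, ‖t x ((ζ n).val x)‖ ^ 2 ≤ ‖T‖ ^ 2 * ‖(ζ n).val x‖ ^ 2 := by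
    intro n
    refine ae_le_of_forall_setIntegral_le (hT.norm_apply_sq (ζ n)).1
      ((ζ n).integrable_sq.const_mul _) fun Z hZ _ => ?_
    -- Cutting the section down to Z localizes the global norm inequality, which then holds
    -- pointwise.
    let f : X → ℂ := Z.indicator 1
    have hf : AEStronglyMeasurable f μ :=
      (stronglyMeasurable_one.indicator hZ).aestronglyMeasurable
    have hmem : (fun x => f x • (ζ n).val x) ∈ F.sqIntegrableSections := by
      refine ⟨smul_mem_sections hf (ζ n).mem, (ζ n).integrable_sq.mono
        ((F.aesm_norm (smul_mem_sections hf (ζ n).mem)).pow 2) (Eventually.of_forall fun x => ?_)⟩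
      by_cases hx : x ∈ Z <;> simp [f, hx]
    let z : F.PreDirectIntegral := ⟨_, hmem⟩
    have h2 := (hT.norm_apply_sq z).2
    have h3 := T.le_opNorm (F.toDirectIntegral z)
    have h4 : ‖F.toDirectIntegral z‖ ^ 2 = ∫ x in Z, ‖(ζ n).val x‖ ^ 2 ∂μ := by
      rw [← integral_indicator hZ]
      refine (PreDirectIntegral.norm_sq z).trans (integral_congr_ae (Eventually.of_forall fun x => ?_))
      by_cases hx : x ∈ Z <;> simp [z, f, hx, PreDirectIntegral.val]
    have h5 : ‖T (F.toDirectIntegral z)‖ ^ 2 = ∫ x in Z, ‖t x ((ζ n).val x)‖ ^ 2 ∂μ := by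
      rw [h2, ← integral_indicator hZ]
      refine integral_congr_ae (Eventually.of_forall fun x => ?_)
      by_cases hx : x ∈ Z <;> simp [z, f, hx, PreDirectIntegral.val]
    rw [integral_const_mul, ← h4, ← h5, ← mul_pow]
    exact pow_le_pow_left₀ (norm_nonneg _) h3 2
  filter_upwards [hζ, ae_all_iff.2 h1] with x hx h
  refine (t x).opNorm_le_bound (norm_nonneg T) fun v => ?_
  refine hx.induction_on v (isClosed_le (by fun_prop) (by fun_prop)) fun n => ?_
  refine le_of_sq_le_sq ?_ (by positivity)
  rw [mul_pow]
  exact h n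

end IsIntegralOf

end MeasurableHilbertField

/-! ### Strong limits of decomposable operators. -/

namespace MeasurableHilbertField

variable {X : Type u} [MeasurableSpace X] {μ : Measure X} {H : X → Type v}
  [∀ x, NormedAddCommGroup (H x)] [∀ x, InnerProductSpace ℂ (H x)] [∀ x, CompleteSpace (H x)]
  {F : MeasurableHilbertField μ H}

/-- A bounded sequence of decomposable operators whose fibers converge strongly converges strongly
to a decomposable operator. -/
theorem exists_limit_of_ae_tendsto [SigmaFinite μ] {T : ℕ → F.DirectIntegral →L[ℂ] F.DirectIntegral}
    {t : ℕ → ∀ x, H x →L[ℂ] H x} (hT : ∀ k, F.IsIntegralOf (T k) (t k)) {C : ℝ}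
    (hC : ∀ k, ‖T k‖ ≤ C) {s : ∀ x, H x →L[ℂ] H x}
    (hs : ∀ᵐ x ∂μ, ∀ v, Tendsto (fun k => t k x v) atTop (𝓝 (s x v))) :
    ∃ S : F.DirectIntegral →L[ℂ] F.DirectIntegral, F.IsIntegralOf S s ∧
      ∀ η, Tendsto (fun k => T k η) atTop (𝓝 (S η)) := by
  have hbd : ∀ᵐ x ∂μ, ∀ k, ‖t k x‖ ≤ C := ae_all_iff.2 fun k => by
    filter_upwards [(hT k).ae_norm_le] with x hx
    exact hx.trans (hC k)
  have hfield : F.IsMeasurableOperatorField s := by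
    refine ⟨fun ξ hξ η hη => ?_, C, ?_⟩
    · refine aestronglyMeasurable_of_tendsto_ae atTop
        (fun k => (hT k).1.measurable ξ hξ η hη) ?_
      filter_upwards [hs] with x hx
      exact (tendsto_const_nhds (x := η x)).inner (hx (ξ x))
    · filter_upwards [hbd, hs] with x h1 h2
      exact norm_le_of_strong_limit h1 h2
  obtain ⟨S, hS⟩ := hfield.exists_isIntegralOf
  refine ⟨S, hS, fun η => ?_⟩
  obtain ⟨ζ, rfl⟩ := SeparationQuotient.surjective_mk η
  rw [tendsto_iff_norm_sub_tendsto_zero]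
  have h1 : ∀ k, ‖T k (F.toDirectIntegral ζ) - S (F.toDirectIntegral ζ)‖ ^ 2 =
      ∫ x, ‖(t k x - s x) (ζ.val x)‖ ^ 2 ∂μ := fun k => (((hT k).sub hS).norm_apply_sq ζ).2
  have h2 : Tendsto (fun k => ∫ x, ‖(t k x - s x) (ζ.val x)‖ ^ 2 ∂μ) atTop (𝓝 (∫ _, 0 ∂μ)) := by
    refine tendsto_integral_of_dominated_convergence (fun x => (2 * C) ^ 2 * ‖ζ.val x‖ ^ 2)
      (fun k => (((hT k).sub hS).norm_apply_sq ζ).1.1) (ζ.integrable_sq.const_mul _)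
      (fun k => ?_) ?_
    · filter_upwards [hbd, hs] with x h1 h2
      rw [norm_pow, norm_norm, ← mul_pow]
      refine pow_le_pow_left₀ (norm_nonneg _) (norm_apply_le_of_norm_le ?_ _) 2
      exact (norm_sub_le _ _).trans (by linarith [h1 k, norm_le_of_strong_limit h1 h2])
    · filter_upwards [hs] with x hx
      have := (tendsto_iff_norm_sub_tendsto_zero.1 (hx (ζ.val x))).pow 2
      simpa using this
  rw [integral_zero] at h2
  simp only [← h1] at h2
  have h3 := h2.sqrt
  simp only [Real.sqrt_sq (norm_nonneg _), Real.sqrt_zero] at h3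
  exact h3

variable (F) in
/-- A bounded sequence of decomposable operators that converges on suitable countably many vectors
has a subsequence converging strongly, also in almost every fiber. -/
theorem exists_vectors_subseq_limit [SigmaFinite μ] : ∃ η : ℕ → F.DirectIntegral,
    (∀ (S : F.DirectIntegral →L[ℂ] F.DirectIntegral) (s : ∀ x, H x →L[ℂ] H x),
      F.IsIntegralOf S s → (∀ n, S (η n) = 0) → ∀ᵐ x ∂μ, s x = 0) ∧
    ∀ (T : ℕ → F.DirectIntegral →L[ℂ] F.DirectIntegral) (t : ℕ → ∀ x, H x →L[ℂ] H x),
      (∀ k, F.IsIntegralOf (T k) (t k)) → (∃ C, ∀ k, ‖T k‖ ≤ C) →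
      (∀ n, CauchySeq fun k => T k (η n)) →
      ∃ φ : ℕ → ℕ, StrictMono φ ∧ ∃ (S : F.DirectIntegral →L[ℂ] F.DirectIntegral)
        (s : ∀ x, H x →L[ℂ] H x), F.IsIntegralOf S s ∧
        (∀ᵐ x ∂μ, ∀ v, Tendsto (fun k => t (φ k) x v) atTop (𝓝 (s x v))) ∧
        ∀ η, Tendsto (fun k => T (φ k) η) atTop (𝓝 (S η)) := by
  obtain ⟨ζ, hζ⟩ := F.exists_total_seq
  refine ⟨fun n => F.toDirectIntegral (ζ n), fun S s hS h0 => ?_, ?_⟩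
  · have h1 : ∀ n, ∀ᵐ x ∂μ, s x ((ζ n).val x) = 0 := fun n => by
      have h2 := h0 n
      rw [hS.2, show (0 : F.DirectIntegral) = F.toDirectIntegral 0 from rfl,
        toDirectIntegral_eq_iff] at h2
      exact h2
    filter_upwards [hζ, ae_all_iff.2 h1] with x hx h
    refine ContinuousLinearMap.ext_on (s := Set.range fun n => (ζ n).val x) ?_ ?_
    · exact Submodule.dense_iff_topologicalClosure_eq_top.2 hx
    · rintro _ ⟨n, rfl⟩
      exact h n
  rintro T t hT ⟨C, hC⟩ hcauchy
  -- Along the extracted subsequence the j-th step is at most 4^{-j} on the vectors with index at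
  -- most j, so its square is at most 16^{-j}. For a fixed vector n the estimate therefore starts
  -- only at j = n.
  have hev : ∀ j : ℕ, ∀ᶠ k in atTop, ∀ l ≥ k, ∀ n ≤ j,
      ‖T k (F.toDirectIntegral (ζ n)) - T l (F.toDirectIntegral (ζ n))‖ ≤ (1 / 4 : ℝ) ^ j := by
    intro j
    have h1 : ∀ n, ∀ᶠ k in atTop, ∀ l ≥ k,
        ‖T k (F.toDirectIntegral (ζ n)) - T l (F.toDirectIntegral (ζ n))‖ ≤ (1 / 4 : ℝ) ^ j := by
      intro n
      obtain ⟨N, hN⟩ := Metric.cauchySeq_iff.1 (hcauchy n) ((1 / 4 : ℝ) ^ j) (by positivity)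
      filter_upwards [eventually_ge_atTop N] with k hk l hl
      rw [← dist_eq_norm]
      exact (hN k hk l (le_trans hk hl)).le
    have h2 : ∀ᶠ k in atTop, ∀ n ∈ Finset.range (j + 1), ∀ l ≥ k,
        ‖T k (F.toDirectIntegral (ζ n)) - T l (F.toDirectIntegral (ζ n))‖ ≤ (1 / 4 : ℝ) ^ j :=
      (Finset.eventually_all _).2 fun n _ => h1 n
    filter_upwards [h2] with k hk l hl n hn
    exact hk n (Finset.mem_range.2 (Nat.lt_succ_of_le hn)) l hl
  obtain ⟨φ, hφ, hφj⟩ := extraction_forall_of_eventually hev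
  have hbd : ∀ᵐ x ∂μ, ∀ k, ‖t k x‖ ≤ C := ae_all_iff.2 fun k => by
    filter_upwards [(hT k).ae_norm_le] with x hx
    exact hx.trans (hC k)
  have hcx : ∀ n, ∀ᵐ x ∂μ, CauchySeq fun j => t (φ j) x ((ζ n).val x) := by
    intro n
    have hd : ∀ j, F.IsIntegralOf (T (φ j) - T (φ (j + 1))) fun x => t (φ j) x - t (φ (j + 1)) x :=
      fun j => (hT _).sub (hT _)
    have h1 := ae_exists_forall_le_of_integral_le (μ := μ) (n := n)
      (f := fun j x => ‖(t (φ j) x - t (φ (j + 1)) x) ((ζ n).val x)‖ ^ 2)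
      (fun j => ((hd j).norm_apply_sq (ζ n)).1)
      (fun j => Eventually.of_forall fun x => by positivity) (fun j hj => by
        rw [← ((hd j).norm_apply_sq (ζ n)).2]
        have := hφj j (φ (j + 1)) (hφ (Nat.lt_succ_self j)).le n hj
        calc _ ≤ ((1 / 4 : ℝ) ^ j) ^ 2 := pow_le_pow_left₀ (norm_nonneg _) this 2
          _ = (1 / 16 : ℝ) ^ j := by rw [← pow_mul, mul_comm, pow_mul]; norm_num)
    filter_upwards [h1] with x hx
    obtain ⟨D, hD0, hD⟩ := hx
    exact cauchySeq_of_sq_dist_le hD0 hD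
  have hlim : ∀ᵐ x ∂μ, ∃ b : H x →L[ℂ] H x, ∀ v, Tendsto (fun k => t (φ k) x v) atTop (𝓝 (b v)) := by
    filter_upwards [hζ, hbd, ae_all_iff.2 hcx] with x hx hb hc
    refine exists_strong_limit (fun k => hb (φ k)) hx ?_
    rintro _ ⟨n, rfl⟩
    exact hc n
  classical
  let s : ∀ x, H x →L[ℂ] H x := fun x =>
    if h : ∃ b : H x →L[ℂ] H x, ∀ v, Tendsto (fun k => t (φ k) x v) atTop (𝓝 (b v)) then h.choose
    else 0
  have hs : ∀ᵐ x ∂μ, ∀ v, Tendsto (fun k => t (φ k) x v) atTop (𝓝 (s x v)) := by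
    filter_upwards [hlim] with x hx
    simp only [s, dif_pos hx]
    exact hx.choose_spec
  obtain ⟨S, hS, hSη⟩ := exists_limit_of_ae_tendsto (fun k => hT (φ k)) (fun k => hC (φ k)) hs
  exact ⟨φ, hφ, S, s, hS, hs, hSη⟩

/-! ### Fibers of operators; each identity holds off a null set depending on the operators involved.
-/

section Fibers

variable {M : ∀ x, VonNeumannAlgebra (H x)}

theorem ae_mem_of_mem_integralAlgebra [SigmaFinite μ] {T : F.DirectIntegral →L[ℂ] F.DirectIntegral}
    (hT : T ∈ F.integralAlgebra M) {t : ∀ x, H x →L[ℂ] H x} (ht : F.IsIntegralOf T t) :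
    ∀ᵐ x ∂μ, t x ∈ M x := by
  obtain ⟨s, hs, hsM⟩ := hT
  filter_upwards [hs.ae_eq ht, hsM] with x h1 h2
  exact h1 ▸ h2

theorem exists_fiber (T : F.integralAlgebra M) : ∃ t : ∀ x, (M x).toStarSubalgebra,
    F.IsIntegralOf (T : F.DirectIntegral →L[ℂ] F.DirectIntegral)
      fun x => (t x : H x →L[ℂ] H x) := by
  classical
  obtain ⟨t, ht, htM⟩ := T.2
  refine ⟨fun x => if h : t x ∈ M x then ⟨t x, h⟩ else 0, ht.congr ?_⟩
  filter_upwards [htM] with x hx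
  simp [hx]

/-- A choice of fibers, in the fiber algebras, of an operator in the direct integral. -/
noncomputable def fiber (T : F.integralAlgebra M) : ∀ x, (M x).toStarSubalgebra :=
  (exists_fiber T).choose

theorem isIntegralOf_fiber (T : F.integralAlgebra M) :
    F.IsIntegralOf (T : F.DirectIntegral →L[ℂ] F.DirectIntegral)
      fun x => (fiber T x : H x →L[ℂ] H x) :=
  (exists_fiber T).choose_spec

variable [SigmaFinite μ]

theorem fiber_ae_eq {T : F.integralAlgebra M} {t : ∀ x, H x →L[ℂ] H x}
    (ht : F.IsIntegralOf (T : F.DirectIntegral →L[ℂ] F.DirectIntegral) t) :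
    ∀ᵐ x ∂μ, (fiber T x : H x →L[ℂ] H x) = t x :=
  (isIntegralOf_fiber T).ae_eq ht

theorem fiber_add (S T : F.integralAlgebra M) : ∀ᵐ x ∂μ, fiber (S + T) x = fiber S x + fiber T x := by
  filter_upwards [fiber_ae_eq (T := S + T) ((isIntegralOf_fiber S).add (isIntegralOf_fiber T))]
    with x hx using Subtype.ext hx

theorem fiber_sub (S T : F.integralAlgebra M) : ∀ᵐ x ∂μ, fiber (S - T) x = fiber S x - fiber T x := by
  filter_upwards [fiber_ae_eq (T := S - T) ((isIntegralOf_fiber S).sub (isIntegralOf_fiber T))]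
    with x hx using Subtype.ext hx

theorem fiber_mul (S T : F.integralAlgebra M) : ∀ᵐ x ∂μ, fiber (S * T) x = fiber S x * fiber T x := by
  filter_upwards [fiber_ae_eq (T := S * T) ((isIntegralOf_fiber S).mul (isIntegralOf_fiber T))]
    with x hx using Subtype.ext hx

theorem fiber_star (T : F.integralAlgebra M) : ∀ᵐ x ∂μ, fiber (star T) x = star (fiber T x) := by
  filter_upwards [fiber_ae_eq (T := star T) (isIntegralOf_fiber T).star]
    with x hx using Subtype.ext hx

theorem fiber_smul (c : ℂ) (T : F.integralAlgebra M) :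
    ∀ᵐ x ∂μ, fiber (c • T) x = c • fiber T x := by
  filter_upwards [fiber_ae_eq (T := c • T) ((isIntegralOf_fiber T).smul c)]
    with x hx using Subtype.ext hx

variable (F M) in
theorem fiber_algebraMap (c : ℂ) :
    ∀ᵐ x ∂μ, fiber (algebraMap ℂ (F.integralAlgebra M) c) x = algebraMap ℂ _ c := by
  filter_upwards [fiber_ae_eq (T := algebraMap ℂ (F.integralAlgebra M) c) (.scalar F c)]
    with x hx using Subtype.ext hx

variable (F M) in
theorem fiber_one : ∀ᵐ x ∂μ, fiber (1 : F.integralAlgebra M) x = 1 := by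
  filter_upwards [fiber_algebraMap F M 1] with x hx
  simpa using hx

theorem fiber_norm_le (T : F.integralAlgebra M) : ∀ᵐ x ∂μ, ‖fiber T x‖ ≤ ‖T‖ :=
  (isIntegralOf_fiber T).ae_norm_le

theorem eq_of_fiber_ae_eq {S T : F.integralAlgebra M} (h : ∀ᵐ x ∂μ, fiber S x = fiber T x) :
    S = T := by
  refine Subtype.ext ((isIntegralOf_fiber S).ext_of_eq ((isIntegralOf_fiber T).congr ?_))
  filter_upwards [h] with x hx
  rw [hx]

end Fibers

/-! ### The trace of the direct integral. -/

section Trace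

variable {M : ∀ x, VonNeumannAlgebra (H x)} [SigmaFinite μ]
  {τf : ∀ x, (M x).toStarSubalgebra →ₗ[ℂ] ℂ} {τ : F.integralAlgebra M →ₗ[ℂ] ℂ} {w : X → ℝ}

theorem IsIntegralTrace.traceSq_eq (hτ : F.IsIntegralTrace w τ τf) (T : F.integralAlgebra M) :
    Integrable (fun x => w x * traceSq (τf x) (fiber T x)) μ ∧
      traceSq τ T = ∫ x, w x * traceSq (τf x) (fiber T x) ∂μ := by
  obtain ⟨h1, h2⟩ := hτ (star T * T) (fun x => star (fiber T x) * fiber T x)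
    ((isIntegralOf_fiber T).star.mul (isIntegralOf_fiber T))
  refine ⟨h1.re.congr (Eventually.of_forall fun x => ?_), ?_⟩
  · simp [traceSq]
  · rw [traceSq, h2]
    refine (integral_re h1).symm.trans (integral_congr_ae (Eventually.of_forall fun x => ?_))
    simp [traceSq]

/-- All properties are integrated from the fibers. For continuity and completeness a subsequence is
taken along which the fibers converge, strongly or in the 2-norm, almost everywhere; dominated
convergence with bound C² w τ_x(1) returns to the global 2-norm. -/
theorem IsIntegralTrace.isNormalTracial (hτ : F.IsIntegralTrace w τ τf)
    (hτf : ∀ᵐ x ∂μ, IsFaithfulNormalTrace (τf x)) (hw : ∀ᵐ x ∂μ, 0 < w x) :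
    IsNormalTracial τ := by
  have hN : ∀ᵐ x ∂μ, IsNormalTracial (τf x) := by
    filter_upwards [hτf] with x hx using hx.isNormalTracial
  have hpos : ∀ T : F.integralAlgebra M, ∀ᵐ x ∂μ, 0 ≤ w x * traceSq (τf x) (fiber T x) := fun T => by
    filter_upwards [hN, hw] with x h1 h2 using mul_nonneg h2.le (h1.nonneg _)
  have happ : ∀ T : F.integralAlgebra M, τ T = ∫ x, (w x : ℂ) * τf x (fiber T x) ∂μ := fun T =>
    (hτ T _ (isIntegralOf_fiber T)).2
  have hone : Integrable (fun x => w x * traceSq (τf x) 1) μ := by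
    refine (hτ.traceSq_eq 1).1.congr ?_
    filter_upwards [fiber_one F M] with x hx
    rw [hx]
  -- convergence in the `2`-norm follows from convergence in the fibers
  have hdct : ∀ (T : ℕ → F.integralAlgebra M) (C : ℝ), (∀ k, ‖T k‖ ≤ C) →
      (∀ᵐ x ∂μ, Tendsto (fun k => traceSq (τf x) (fiber (T k) x)) atTop (𝓝 0)) →
      Tendsto (fun k => traceSq τ (T k)) atTop (𝓝 0) := by
    intro T C hC h
    simp only [(hτ.traceSq_eq _).2]
    rw [show (0 : ℝ) = ∫ _, 0 ∂μ by simp]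
    refine tendsto_integral_of_dominated_convergence (fun x => C ^ 2 * (w x * traceSq (τf x) 1))
      (fun k => (hτ.traceSq_eq _).1.1) (hone.const_mul _) (fun k => ?_) ?_
    · filter_upwards [hpos (T k), hN, hw, fiber_norm_le (T k)] with x h1 h2 h3 h4
      rw [Real.norm_eq_abs, abs_of_nonneg h1]
      have h5 := h2.mul_le (fiber (T k) x) 1
      rw [mul_one] at h5
      have h6 : ‖fiber (T k) x‖ ^ 2 ≤ C ^ 2 :=
        pow_le_pow_left₀ (norm_nonneg _) (h4.trans (hC k)) 2
      have h7 := mul_le_mul_of_nonneg_right h6 (h2.nonneg 1)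
      calc _ ≤ w x * (C ^ 2 * traceSq (τf x) 1) := by gcongr; exact h5.trans h7
        _ = _ := by ring
    · filter_upwards [h] with x hx
      simpa using hx.const_mul (w x)
  have hfaith : ∀ T : F.integralAlgebra M, traceSq τ T = 0 → T = 0 := by
    intro T hT
    rw [(hτ.traceSq_eq T).2, integral_eq_zero_iff_of_nonneg_ae (hpos T) (hτ.traceSq_eq T).1] at hT
    have h0 := fiber_smul 0 T
    refine eq_of_fiber_ae_eq ?_
    filter_upwards [hT, hN, hw, h0] with x h1 h2 h3 h4
    rw [zero_smul, zero_smul] at h4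
    rw [h4]
    refine h2.faithful _ ?_
    have h5 : w x * traceSq (τf x) (fiber T x) = 0 := h1
    exact (mul_eq_zero.1 h5).resolve_left h3.ne'
  refine ⟨fun S T => ?_, fun T => ?_, fun T => ?_, hfaith, fun S T => ?_, ?_, ?_⟩
  · rw [happ, happ]
    refine integral_congr_ae ?_
    filter_upwards [fiber_mul S T, fiber_mul T S, hN] with x h1 h2 h3
    rw [h1, h2, h3.tracial]
  · rw [happ, happ, ← integral_conj]
    refine integral_congr_ae ?_
    filter_upwards [fiber_star T, hN] with x h1 h2
    rw [h1, h2.map_star]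
    simp
  · rw [(hτ.traceSq_eq T).2]
    exact integral_nonneg_of_ae (hpos T)
  · rw [(hτ.traceSq_eq _).2, (hτ.traceSq_eq T).2, ← integral_const_mul]
    refine integral_mono_ae (hτ.traceSq_eq _).1 ((hτ.traceSq_eq T).1.const_mul _) ?_
    filter_upwards [fiber_mul S T, hN, hw, fiber_norm_le S, hpos T] with x h1 h2 h3 h4 h5
    rw [h1]
    calc w x * traceSq (τf x) (fiber S x * fiber T x)
        ≤ w x * (‖fiber S x‖ ^ 2 * traceSq (τf x) (fiber T x)) :=
          mul_le_mul_of_nonneg_left (h2.mul_le _ _) h3.le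
      _ = ‖fiber S x‖ ^ 2 * (w x * traceSq (τf x) (fiber T x)) := by ring
      _ ≤ _ := mul_le_mul_of_nonneg_right (pow_le_pow_left₀ (norm_nonneg _) h4 2) h5
  · obtain ⟨η, hη0, hη⟩ := F.exists_vectors_subseq_limit
    refine ⟨η, ?_⟩
    rintro T ⟨C, hC⟩ hTη
    -- Fiberwise strong convergence is available only along a subsequence, so it is enough that
    -- every subsequence has a further one with the required limit.
    refine tendsto_of_subseq_tendsto fun ns hns => ?_
    obtain ⟨φ, hφ, S, s, hS, hs, hSη⟩ := hη (fun k => T (ns k)) (fun k x => fiber (T (ns k)) x)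
      (fun k => isIntegralOf_fiber _) ⟨C, fun k => hC _⟩
      fun n => ((hTη n).comp hns).cauchySeq
    have hSη0 : ∀ n, S (η n) = 0 := fun n =>
      tendsto_nhds_unique (hSη (η n)) (((hTη n).comp hns).comp hφ.tendsto_atTop)
    refine ⟨φ, hdct _ C (fun k => hC _) ?_⟩
    have hbd : ∀ᵐ x ∂μ, ∀ k, ‖fiber (T (ns (φ k))) x‖ ≤ C := ae_all_iff.2 fun k => by
      filter_upwards [fiber_norm_le (T (ns (φ k)))] with x hx using hx.trans (hC _)
    filter_upwards [hη0 S s hS hSη0, hs, hN, hbd] with x h1 h2 h3 h4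
    obtain ⟨ξ, hξ⟩ := h3.cont
    refine hξ _ ⟨C, h4⟩ fun n => ?_
    simpa [h1] using h2 (ξ n)
  · rintro T ⟨C, hC⟩ hcauchy
    have hnonneg : ∀ T, 0 ≤ traceSq τ T := fun T => by
      rw [(hτ.traceSq_eq T).2]
      exact integral_nonneg_of_ae (hpos T)
    -- Steps of squared 2-norm at most 16^{-j} make almost every fiber sequence Cauchy in its own
    -- 2-norm.
    have hev : ∀ j : ℕ, ∀ᶠ k in atTop, ∀ l ≥ k, traceSq τ (T k - T l) ≤ (1 / 16 : ℝ) ^ j := by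
      intro j
      obtain ⟨N, hN⟩ := hcauchy ((1 / 16 : ℝ) ^ j) (by positivity)
      filter_upwards [eventually_ge_atTop N] with k hk l hl
      exact (hN k hk l (le_trans hk hl)).le
    obtain ⟨φ, hφ, hφj⟩ := extraction_forall_of_eventually hev
    have hbd : ∀ᵐ x ∂μ, ∀ k, ‖fiber (T k) x‖ ≤ C := ae_all_iff.2 fun k => by
      filter_upwards [fiber_norm_le (T k)] with x hx using hx.trans (hC k)
    have hgeo := ae_exists_forall_le_of_integral_le (μ := μ) (n := 0)
      (f := fun j x => w x * traceSq (τf x) (fiber (T (φ j) - T (φ (j + 1))) x))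
      (fun j => (hτ.traceSq_eq _).1) (fun j => hpos _) (fun j _ => by
        rw [← (hτ.traceSq_eq _).2]
        exact hφj j _ (hφ (Nat.lt_succ_self j)).le)
    have hsub : ∀ᵐ x ∂μ, ∀ j, fiber (T (φ j) - T (φ (j + 1))) x =
        fiber (T (φ j)) x - fiber (T (φ (j + 1))) x := ae_all_iff.2 fun j => fiber_sub _ _
    have hlim : ∀ᵐ x ∂μ, ∃ b : (M x).toStarSubalgebra,
        Tendsto (fun k => traceSq (τf x) (fiber (T (φ k)) x - b)) atTop (𝓝 0) ∧
        ∀ v, Tendsto (fun k => (fiber (T (φ k)) x : H x →L[ℂ] H x) v) atTop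
          (𝓝 ((b : H x →L[ℂ] H x) v)) := by
      filter_upwards [hgeo, hsub, hbd, hN, hw] with x h1 h2 h3 h4 h5
      obtain ⟨D, -, hD⟩ := h1
      refine h4.exists_limit ⟨C, fun k => h3 (φ k)⟩
        (h4.cauchy_of_geometric (C := (w x)⁻¹ * D) fun j => ?_)
      have h6 := hD j (Nat.zero_le j)
      rw [h2 j] at h6
      rw [mul_assoc, le_inv_mul_iff₀ h5]
      exact h6
    classical
    let s : ∀ x, (M x).toStarSubalgebra := fun x =>
      if h : ∃ b : (M x).toStarSubalgebra,
        Tendsto (fun k => traceSq (τf x) (fiber (T (φ k)) x - b)) atTop (𝓝 0) ∧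
        ∀ v, Tendsto (fun k => (fiber (T (φ k)) x : H x →L[ℂ] H x) v) atTop
          (𝓝 ((b : H x →L[ℂ] H x) v)) then h.choose else 0
    have hs : ∀ᵐ x ∂μ, Tendsto (fun k => traceSq (τf x) (fiber (T (φ k)) x - s x)) atTop (𝓝 0) ∧
        ∀ v, Tendsto (fun k => (fiber (T (φ k)) x : H x →L[ℂ] H x) v) atTop
          (𝓝 ((s x : H x →L[ℂ] H x) v)) := by
      filter_upwards [hlim] with x hx
      simp only [s, dif_pos hx]
      exact hx.choose_spec
    obtain ⟨S, hS, hSη⟩ := exists_limit_of_ae_tendsto (fun k => isIntegralOf_fiber (T (φ k)))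
      (fun k => hC (φ k)) (s := fun x => (s x : H x →L[ℂ] H x)) (by
        filter_upwards [hs] with x hx using hx.2)
    let S' : F.integralAlgebra M := ⟨S, _, hS, Eventually.of_forall fun x => (s x).2⟩
    have hq : Tendsto (fun k => traceSq τ (T (φ k) - S')) atTop (𝓝 0) := by
      refine hdct _ (C + ‖S'‖) (fun k => (norm_sub_le _ _).trans (add_le_add_left (hC _) _)) ?_
      have h1 : ∀ᵐ x ∂μ, ∀ k, fiber (T (φ k) - S') x = fiber (T (φ k)) x - fiber S' x :=
        ae_all_iff.2 fun k => fiber_sub _ _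
      filter_upwards [h1, hs, fiber_ae_eq (T := S') hS] with x h2 h3 h4
      simp only [h2]
      rw [Subtype.ext h4]
      exact h3.1
    refine ⟨S', ?_, φ, hφ, hSη⟩
    -- So far only the subsequence converges in the 2-norm; the Cauchy condition, with one late term
    -- of the subsequence in between, yields the whole sequence.
    rw [Metric.tendsto_atTop]
    intro ε hε
    obtain ⟨N, hN⟩ := hcauchy (ε / 4) (by positivity)
    obtain ⟨j, hj, hjN⟩ := ((hq.eventually_lt_const (by positivity : 0 < ε / 4)).and
      (hφ.tendsto_atTop.eventually_ge_atTop N)).exists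
    refine ⟨N, fun k hk => ?_⟩
    rw [Real.dist_eq, sub_zero, abs_of_nonneg (hnonneg _)]
    have := traceSq_sub_le_of_nonneg hnonneg (T k) (T (φ j)) S'
    linarith [hN k hk _ hjN]

end Trace

end MeasurableHilbertField

/-! ### Countable *-subrings with a dense set of scalars. -/

section CountableSubrings

/-- A countable `*`-subring containing a given sequence and a dense set of scalars. -/
theorem exists_countable_star_subring {A : Type*} [Ring A] [StarRing A] [Algebra ℂ A]
    (g : ℕ → A) : ∃ R : Subring A, (R : Set A).Countable ∧ (∀ a ∈ R, star a ∈ R) ∧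
      (∀ n, algebraMap ℂ A (TopologicalSpace.denseSeq ℂ n) ∈ R) ∧ ∀ n, g n ∈ R := by
  let b : ℕ ⊕ ℕ → A := Sum.elim g fun n => algebraMap ℂ A (TopologicalSpace.denseSeq ℂ n)
  let h : (ℕ ⊕ ℕ) ⊕ (ℕ ⊕ ℕ) → A := Sum.elim b fun i => star (b i)
  have hh : ∀ i, star (h i) ∈ Set.range h := by
    rintro (i | i)
    · exact ⟨Sum.inr i, rfl⟩
    · exact ⟨Sum.inl i, by simp [h]⟩
  refine ⟨Subring.closure (Set.range h), ?_, fun a ha => ?_, fun n =>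
    Subring.subset_closure ⟨Sum.inl (Sum.inr n), rfl⟩, fun n =>
    Subring.subset_closure ⟨Sum.inl (Sum.inl n), rfl⟩⟩
  -- The subring is a quotient of a free ring on countably many generators, hence countable.
  · have h1 : Subring.closure (Set.range h) ≤ (FreeRing.lift h).range :=
      Subring.closure_le.2 (by rintro _ ⟨i, rfl⟩; exact ⟨FreeRing.of i, by simp⟩)
    refine Set.Countable.mono h1 ?_
    rw [RingHom.coe_range]
    exact Set.countable_range _
  · induction ha using Subring.closure_induction with
    | mem a ha =>
      obtain ⟨i, rfl⟩ := ha
      exact Subring.subset_closure (hh i)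
    | zero => simp
    | one => simp
    | add a b _ _ ha hb => rw [star_add]; exact add_mem ha hb
    | neg a _ ha => rw [star_neg]; exact neg_mem ha
    | mul a b _ _ ha hb => rw [star_mul]; exact mul_mem hb ha

theorem algebraMap_mem_topologicalClosure {A : Type*} [NormedRing A] [NormedAlgebra ℂ A]
    {R : Subring A} (h : ∀ n, algebraMap ℂ A (TopologicalSpace.denseSeq ℂ n) ∈ R) (c : ℂ) :
    algebraMap ℂ A c ∈ R.topologicalClosure :=
  map_mem_closure (f := algebraMap ℂ A) (continuous_algebraMap ℂ A)
    (TopologicalSpace.denseRange_denseSeq ℂ c) (by rintro _ ⟨n, rfl⟩; exact h n)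

end CountableSubrings

/-! ### Countable subrings of the direct integral and their fibers. -/

namespace MeasurableHilbertField

variable {X : Type u} [MeasurableSpace X] {μ : Measure X} {H : X → Type v}
  [∀ x, NormedAddCommGroup (H x)] [∀ x, InnerProductSpace ℂ (H x)] [∀ x, CompleteSpace (H x)]
  {F : MeasurableHilbertField μ H}

section SubringFibers

variable {M : ∀ x, VonNeumannAlgebra (H x)} [SigmaFinite μ]

/-- On a countable subring, the passage to almost every fiber is a `*`-homomorphism. -/
theorem ae_exists_ringHom {R : Subring (F.integralAlgebra M)}
    (hR : (R : Set (F.integralAlgebra M)).Countable) :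
    ∀ᵐ x ∂μ, ∃ π : R →+* (M x).toStarSubalgebra, (∀ T : R, π T = fiber (T : F.integralAlgebra M) x) ∧
      (∀ S T : R, (S : F.integralAlgebra M) = star (T : F.integralAlgebra M) → π S = star (π T)) ∧
      (∀ n, ∀ T : R, (T : F.integralAlgebra M) =
        algebraMap ℂ _ (TopologicalSpace.denseSeq ℂ n) →
          π T = algebraMap ℂ _ (TopologicalSpace.denseSeq ℂ n)) ∧
      ∀ T : R, ‖π T‖ ≤ ‖(T : F.integralAlgebra M)‖ := by
  have : Countable R := hR.to_subtype
  have hadd : ∀ᵐ x ∂μ, ∀ S T : R, fiber (S.1 + T.1) x = fiber S.1 x + fiber T.1 x :=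
    ae_all_iff.2 fun S => ae_all_iff.2 fun T => fiber_add _ _
  have hmul : ∀ᵐ x ∂μ, ∀ S T : R, fiber (S.1 * T.1) x = fiber S.1 x * fiber T.1 x :=
    ae_all_iff.2 fun S => ae_all_iff.2 fun T => fiber_mul _ _
  have hstar : ∀ᵐ x ∂μ, ∀ T : R, fiber (star T.1) x = star (fiber T.1 x) :=
    ae_all_iff.2 fun T => fiber_star _
  have hscal : ∀ᵐ x ∂μ, ∀ n, fiber (algebraMap ℂ (F.integralAlgebra M)
      (TopologicalSpace.denseSeq ℂ n)) x = algebraMap ℂ _ (TopologicalSpace.denseSeq ℂ n) :=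
    ae_all_iff.2 fun n => fiber_algebraMap F M _
  have hnorm : ∀ᵐ x ∂μ, ∀ T : R, ‖fiber T.1 x‖ ≤ ‖T.1‖ := ae_all_iff.2 fun T => fiber_norm_le _
  have h0 := fiber_algebraMap F M 0
  filter_upwards [hadd, hmul, hstar, hscal, hnorm, fiber_one F M, h0] with x h1 h2 h3 h4 h5 h6 h7
  rw [map_zero, map_zero] at h7
  refine ⟨{ toFun := fun T => fiber T.1 x, map_one' := h6, map_mul' := fun S T => h2 S T,
            map_zero' := h7, map_add' := fun S T => h1 S T }, fun T => rfl, fun S T hST => ?_,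
            fun n T hT => ?_, h5⟩
  · change fiber S.1 x = star (fiber T.1 x)
    rw [hST, h3]
  · change fiber T.1 x = _
    rw [hT, h4]

/-- The fibers of a countable `*`-subring are dense, in the sense of the Kaplansky density
theorem, in the algebra they generate. -/
theorem ae_exists_subring {R : Subring (F.integralAlgebra M)}
    (hR : (R : Set (F.integralAlgebra M)).Countable) (hstar : ∀ a ∈ R, star a ∈ R)
    (hscal : ∀ n, algebraMap ℂ _ (TopologicalSpace.denseSeq ℂ n) ∈ R) :
    ∀ᵐ x ∂μ, ∃ R' : Subring (H x →L[ℂ] H x), (∀ a ∈ R', star a ∈ R') ∧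
      (∀ c : ℂ, algebraMap ℂ (H x →L[ℂ] H x) c ∈ R'.topologicalClosure) ∧
      ∀ a, a ∈ R' ↔ ∃ T ∈ R, a = fiber T x := by
  filter_upwards [ae_exists_ringHom hR] with x hx
  obtain ⟨π, hπ, hs, hc, -⟩ := hx
  let ρ : R →+* (H x →L[ℂ] H x) := (M x).toStarSubalgebra.subtype.toRingHom.comp π
  refine ⟨ρ.range, ?_, algebraMap_mem_topologicalClosure fun n => ?_, fun a => ?_⟩
  · rintro _ ⟨T, rfl⟩
    exact ⟨⟨star T.1, hstar _ T.2⟩, congrArg Subtype.val (hs ⟨star T.1, hstar _ T.2⟩ T rfl)⟩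
  · exact ⟨⟨_, hscal n⟩, congrArg Subtype.val (hc n ⟨_, hscal n⟩ rfl)⟩
  · constructor
    · rintro ⟨T, rfl⟩
      exact ⟨T, T.2, congrArg Subtype.val (hπ T)⟩
    · rintro ⟨T, hT, rfl⟩
      exact ⟨⟨T, hT⟩, congrArg Subtype.val (hπ ⟨T, hT⟩)⟩

/-- A measurable field of algebras is generated, fiberwise, by a sequence of the direct
integral. -/
theorem IsMeasurableAlgebraField.exists_generators (hM : F.IsMeasurableAlgebraField M) :
    ∃ T : ℕ → F.integralAlgebra M, ∀ᵐ x ∂μ, M x =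
      generatedVonNeumannAlgebra (Set.range fun n => (fiber (T n) x : H x →L[ℂ] H x)) := by
  obtain ⟨a, ha, hgen⟩ := hM
  choose S hS using fun n => (ha n).exists_isIntegralOf
  have hmem : ∀ n, S n ∈ F.integralAlgebra M := fun n => by
    refine ⟨a n, hS n, ?_⟩
    filter_upwards [hgen] with x hx
    rw [hx]
    exact subset_generatedVonNeumannAlgebra ⟨n, rfl⟩
  refine ⟨fun n => ⟨S n, hmem n⟩, ?_⟩
  filter_upwards [hgen, ae_all_iff.2 fun n => fiber_ae_eq (T := ⟨S n, hmem n⟩) (hS n)] with x h1 h2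
  simp only [h2]
  exact h1

/-- A measurable field of algebras is generated, fiberwise, by a countable `*`-subring of the
direct integral. -/
theorem IsMeasurableAlgebraField.exists_subring (hM : F.IsMeasurableAlgebraField M) :
    ∃ R : Subring (F.integralAlgebra M), (R : Set (F.integralAlgebra M)).Countable ∧
      ∀ᵐ x ∂μ, ∃ R' : Subring (H x →L[ℂ] H x), (∀ a ∈ R', star a ∈ R') ∧
        (∀ c : ℂ, algebraMap ℂ (H x →L[ℂ] H x) c ∈ R'.topologicalClosure) ∧
        (∀ a, a ∈ R' ↔ ∃ T ∈ R, a = fiber T x) ∧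
        ∀ a, a ∈ M x ↔ a ∈ generatedVonNeumannAlgebra (R' : Set (H x →L[ℂ] H x)) := by
  obtain ⟨T, hT⟩ := hM.exists_generators
  obtain ⟨R, hR, hstar, hscal, hTR⟩ := exists_countable_star_subring T
  refine ⟨R, hR, ?_⟩
  filter_upwards [hT, ae_exists_subring hR hstar hscal] with x h1 h2
  obtain ⟨R', h3, h4, h5⟩ := h2
  refine ⟨R', h3, h4, h5, fun a => ⟨fun ha => ?_, generatedVonNeumannAlgebra_le fun b hb => ?_⟩⟩
  · rw [h1] at ha
    refine generatedVonNeumannAlgebra_le ?_ ha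
    rintro _ ⟨n, rfl⟩
    exact subset_generatedVonNeumannAlgebra ((h5 _).2 ⟨T n, hTR n, rfl⟩)
  · obtain ⟨S, -, rfl⟩ := (h5 b).1 hb
    exact (fiber S x).2

end SubringFibers

variable (F) in
/-- The diagonal projection of a measurable set. -/
theorem exists_diagonal_indicator {Z : Set X} (hZ : MeasurableSet Z) :
    ∃ e : F.DirectIntegral →L[ℂ] F.DirectIntegral,
      F.IsIntegralOf e (fun x => Z.indicator (fun _ => (1 : ℂ)) x • ContinuousLinearMap.id ℂ (H x)) ∧
      ∀ A : ∀ x, VonNeumannAlgebra (H x), e ∈ F.integralAlgebra A := by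
  obtain ⟨e, he⟩ := IsIntegralOf.exists_diagonal (F := F) (f := Z.indicator fun _ => (1 : ℂ)) (C := 1)
    (stronglyMeasurable_const.indicator hZ).aestronglyMeasurable
    (Eventually.of_forall fun x => by by_cases hx : x ∈ Z <;> simp [hx])
  exact ⟨e, he, fun A => ⟨_, he, Eventually.of_forall fun x =>
    (A x).toStarSubalgebra.smul_mem (one_mem (A x)) _⟩⟩

/-! ### Descent of the expectation and of the index to the fibers. -/

section Trace

variable {M : ∀ x, VonNeumannAlgebra (H x)} [SigmaFinite μ]
  {τf : ∀ x, (M x).toStarSubalgebra →ₗ[ℂ] ℂ} {τ : F.integralAlgebra M →ₗ[ℂ] ℂ} {w : X → ℝ}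

theorem IsIntegralTrace.apply_indicator_mul (hτ : F.IsIntegralTrace w τ τf)
    {Z : Set X} (hZ : MeasurableSet Z) {e : F.integralAlgebra M}
    (he : F.IsIntegralOf (e : F.DirectIntegral →L[ℂ] F.DirectIntegral)
      (fun x => Z.indicator (fun _ => (1 : ℂ)) x • ContinuousLinearMap.id ℂ (H x)))
    (T : F.integralAlgebra M) : τ (e * T) = ∫ x in Z, (w x : ℂ) * τf x (fiber T x) ∂μ := by
  have h1 := (hτ (e * T) (fun x => Z.indicator (fun _ => (1 : ℂ)) x • fiber T x)
    ((he.mul (isIntegralOf_fiber T)).congr (Eventually.of_forall fun x => by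
      ext v; simp))).2
  rw [h1, ← integral_indicator hZ]
  refine integral_congr_ae (Eventually.of_forall fun x => ?_)
  by_cases hx : x ∈ Z <;> simp [hx]

variable {P : ∀ x, VonNeumannAlgebra (H x)}

/-- For every measurable Z the operator 1_Z S lies in P, so bimodularity and trace preservation give
τ(1_Z S E(T)) = τ(1_Z S T). Two integrable functions with equal integrals over all sets of finite
measure agree almost everywhere, and the weight w ≠ 0 cancels. -/
theorem IsIntegralTrace.ae_apply_mul_eq (hτ : F.IsIntegralTrace w τ τf)
    (hw : ∀ᵐ x ∂μ, 0 < w x) {E : F.integralAlgebra M →ₗ[ℂ] F.integralAlgebra M}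
    (hE : IsTraceExpectation τ (F.integralAlgebra P) E) (T S : F.integralAlgebra M)
    (hS : (S : F.DirectIntegral →L[ℂ] F.DirectIntegral) ∈ F.integralAlgebra P) :
    ∀ᵐ x ∂μ, τf x (fiber S x * fiber (E T) x) = τf x (fiber S x * fiber T x) := by
  have h1 := (hτ _ _ (isIntegralOf_fiber (S * E T))).1
  have h2 := (hτ _ _ (isIntegralOf_fiber (S * T))).1
  have h3 : ∀ Z, MeasurableSet Z → μ Z < ∞ →
      ∫ x in Z, (w x : ℂ) * τf x (fiber (S * E T) x) ∂μ =
        ∫ x in Z, (w x : ℂ) * τf x (fiber (S * T) x) ∂μ := by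
    intro Z hZ _
    obtain ⟨e, he, heA⟩ := F.exists_diagonal_indicator hZ
    let d : F.integralAlgebra M := ⟨e, heA M⟩
    rw [← hτ.apply_indicator_mul (e := d) hZ he, ← hτ.apply_indicator_mul (e := d) hZ he,
      ← mul_assoc, ← mul_assoc, ← hE.preserves (d * S * T)]
    have hdS : ((d * S : F.integralAlgebra M) : F.DirectIntegral →L[ℂ] F.DirectIntegral) ∈
        F.integralAlgebra P := mul_mem (heA P) hS
    have h4 := hE.bimodular T (d * S) 1 hdS (one_mem _)
    rw [mul_one, mul_one] at h4
    rw [h4]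
  have h4 := Integrable.ae_eq_of_forall_setIntegral_eq _ _ h1 h2 h3
  filter_upwards [h4, hw, fiber_mul S (E T), fiber_mul S T] with x h5 h6 h7 h8
  rw [h7, h8] at h5
  have h9 : (w x : ℂ) ≠ 0 := by exact_mod_cast h6.ne'
  exact mul_left_cancel₀ h9 h5

/-- The fibers of the expectation of `T` represent the functional given by the fibers of `T`. -/
theorem IsIntegralTrace.ae_isExpectationValue (hτ : F.IsIntegralTrace w τ τf)
    (hτf : ∀ᵐ x ∂μ, IsFaithfulNormalTrace (τf x)) (hw : ∀ᵐ x ∂μ, 0 < w x)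
    (hP : F.IsMeasurableAlgebraField P) (hPM : F.integralAlgebra P ≤ F.integralAlgebra M)
    (hPMx : ∀ᵐ x ∂μ, (P x).toStarSubalgebra ≤ (M x).toStarSubalgebra)
    {E : F.integralAlgebra M →ₗ[ℂ] F.integralAlgebra M}
    (hE : IsTraceExpectation τ (F.integralAlgebra P) E) (T : F.integralAlgebra M) :
    ∀ᵐ x ∂μ, IsExpectationValue (τf x) (P x) (fiber T x) (fiber (E T) x) := by
  obtain ⟨R, hR, hRx⟩ := hP.exists_subring
  have : Countable R := hR.to_subtype
  let inc : F.integralAlgebra P → F.integralAlgebra M := fun S => ⟨S.1, hPM S.2⟩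
  have htest : ∀ S : F.integralAlgebra P, ∀ᵐ x ∂μ,
      τf x (fiber (inc S) x * fiber (E T) x) = τf x (fiber (inc S) x * fiber T x) := fun S =>
    hτ.ae_apply_mul_eq hw hE T (inc S) S.2
  have hinc : ∀ᵐ x ∂μ, ∀ S : R, (fiber (inc S.1) x : H x →L[ℂ] H x) = fiber S.1 x :=
    ae_all_iff.2 fun S => fiber_ae_eq (T := inc S.1) (isIntegralOf_fiber S.1)
  filter_upwards [hRx, hPMx, hτf, ae_all_iff.2 fun S : R => htest S, hinc,
    ae_mem_of_mem_integralAlgebra (hE.mem T) (isIntegralOf_fiber (E T))] with x h1 h2 h3 h4 h5 h6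
  obtain ⟨R', hstar, hscal, hR', hgen⟩ := h1
  have hN := h3.isNormalTracial
  refine ⟨h6, fun b hb => ?_⟩
  -- At this x the identity is known for countably many test operators; their fibers are 2-norm
  -- dense on bounded sets of P x, and τ_x(· z) is continuous there.
  obtain ⟨a, haR, -, ha⟩ := hN.exists_seq_tendsto R' hstar hscal
    (fun a ha => by
      obtain ⟨S, -, rfl⟩ := (hR' a).1 ha
      exact h2 (fiber S x).2) b ((hgen _).1 hb)
  have hlim : ∀ z, Tendsto (fun k => τf x (a k * z)) atTop (𝓝 (τf x (b * z))) := by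
    intro z
    have h7 := (hN.tendsto_apply (hN.tendsto_mul_right z ha)).add_const (τf x (b * z))
    simpa [sub_mul] using h7
  have heq : ∀ k, τf x (a k * fiber (E T) x) = τf x (a k * fiber T x) := by
    intro k
    obtain ⟨S, hS, hak⟩ := (hR' _).1 (haR k)
    have h8 : a k = fiber (inc S) x := Subtype.ext (hak.trans (h5 ⟨S, hS⟩).symm)
    rw [h8]
    exact h4 ⟨S, hS⟩
  have h9 := hlim (fiber (E T) x)
  simp only [heq] at h9
  exact tendsto_nhds_unique h9 (hlim _)

/-- Only countably many generators of P x have to be tested, each lying in M x off a null set. -/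
theorem ae_le_of_integralAlgebra_le (hP : F.IsMeasurableAlgebraField P)
    (hPM : F.integralAlgebra P ≤ F.integralAlgebra M) :
    ∀ᵐ x ∂μ, (P x).toStarSubalgebra ≤ (M x).toStarSubalgebra := by
  obtain ⟨T, hT⟩ := hP.exists_generators
  filter_upwards [hT, ae_all_iff.2 fun n =>
    ae_mem_of_mem_integralAlgebra (hPM (T n).2) (isIntegralOf_fiber (T n))] with x h1 h2
  intro a ha
  change a ∈ P x at ha
  rw [h1] at ha
  exact generatedVonNeumannAlgebra_le (by rintro _ ⟨n, rfl⟩; exact h2 n) ha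

theorem fiber_sum {ι : Type*} (s : Finset ι) (T : ι → F.integralAlgebra M) :
    ∀ᵐ x ∂μ, fiber (∑ i ∈ s, T i) x = ∑ i ∈ s, fiber (T i) x := by
  classical
  induction s using Finset.induction_on with
  | empty =>
    filter_upwards [fiber_algebraMap F M 0] with x hx
    simpa using hx
  | insert i s hi ih =>
    rw [Finset.sum_insert hi]
    filter_upwards [ih, fiber_add (T i) (∑ i ∈ s, T i)] with x h1 h2
    rw [Finset.sum_insert hi, h2, h1]

/-- Finite index of a direct integral passes to almost every fiber. -/
theorem IsIntegralTrace.ae_isFiniteIndex (hM : F.IsMeasurableAlgebraField M)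
    (hτ : F.IsIntegralTrace w τ τf)
    (hτf : ∀ᵐ x ∂μ, IsFaithfulNormalTrace (τf x)) (hw : ∀ᵐ x ∂μ, 0 < w x)
    (hP : F.IsMeasurableAlgebraField P) (hindex : IsFiniteIndex τ (F.integralAlgebra P)) :
    ∀ᵐ x ∂μ, IsFiniteIndex (τf x) (P x).toStarSubalgebra := by
  obtain ⟨hPM, E, hE, k, m, p, hp, hEm, hbasis⟩ := hindex
  have hPMx := ae_le_of_integralAlgebra_le hP hPM
  obtain ⟨R, hR, hRx⟩ := hM.exists_subring
  have : Countable R := hR.to_subtype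
  have hval := hτ.ae_isExpectationValue hτf hw hP hPM hPMx hE
  have hpx : ∀ᵐ x ∂μ, ∀ i, (fiber (p i) x : H x →L[ℂ] H x) ∈ P x ∧ IsStarProjection (fiber (p i) x) := by
    refine ae_all_iff.2 fun i => ?_
    filter_upwards [ae_mem_of_mem_integralAlgebra (hp i).1 (isIntegralOf_fiber (p i)),
      fiber_mul (p i) (p i), fiber_star (p i)] with x h1 h2 h3
    rw [(hp i).2.1.isIdempotentElem.eq] at h2
    rw [(hp i).2.1.isSelfAdjoint.star_eq] at h3
    exact ⟨h1, h2.symm, h3.symm⟩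
  have hmx : ∀ᵐ x ∂μ, ∀ i j, IsExpectationValue (τf x) (P x)
      (fiber (m i) x * star (fiber (m j) x)) (if i = j then fiber (p i) x else 0) := by
    refine ae_all_iff.2 fun i => ae_all_iff.2 fun j => ?_
    filter_upwards [hval (m i * star (m j)), fiber_mul (m i) (star (m j)), fiber_star (m j),
      fiber_algebraMap F M 0] with x h1 h2 h3 h4
    rw [h2, h3, hEm] at h1
    rw [map_zero, map_zero] at h4
    split_ifs with h
    · simpa [h] using h1
    · simpa [h, h4] using h1
  have hbx : ∀ᵐ x ∂μ, ∀ T : R,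
      (∀ i, IsExpectationValue (τf x) (P x) (fiber T.1 x * star (fiber (m i) x))
        (fiber (E (T.1 * star (m i))) x)) ∧
      fiber T.1 x = ∑ i, fiber (E (T.1 * star (m i))) x * fiber (m i) x := by
    refine ae_all_iff.2 fun T => ?_
    filter_upwards [ae_all_iff.2 fun i => hval (T.1 * star (m i)),
      ae_all_iff.2 fun i => fiber_mul T.1 (star (m i)), ae_all_iff.2 fun i => fiber_star (m i),
      fiber_sum Finset.univ fun i => E (T.1 * star (m i)) * m i,
      ae_all_iff.2 fun i => fiber_mul (E (T.1 * star (m i))) (m i)] with x h1 h2 h3 h4 h5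
    refine ⟨fun i => ?_, ?_⟩
    · have := h1 i
      rwa [h2 i, h3 i] at this
    · rw [← hbasis T.1] at h4
      rw [h4]
      exact Finset.sum_congr rfl fun i _ => h5 i
  filter_upwards [hτf, hPMx, hRx, hpx, hmx, hbx, ae_all_iff.2 fun T : R => hval T.1]
    with x h1 h2 h3 h4 h5 h6 h7
  obtain ⟨R', hstar, hscal, hR', hgen⟩ := h3
  have hN := h1.isNormalTracial
  -- The dense set consists of the fibers of the countable subring generating M x; the fibers of the
  -- mᵢ and pᵢ serve as basis.
  refine hN.isFiniteIndex_of_dense h2 {y | ∃ T ∈ R, y = fiber T x} (fun y => ?_) ?_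
    (fun i => fiber (m i) x) (fun i => fiber (p i) x) h4 h5 ?_
  · obtain ⟨a, haR, haC, ha⟩ := hN.exists_seq_tendsto R' hstar hscal
      (fun a ha => by
        obtain ⟨S, -, rfl⟩ := (hR' a).1 ha
        exact (fiber S x).2) y ((hgen _).1 y.2)
    refine ⟨a, fun k => ?_, ⟨_, haC⟩, ha⟩
    obtain ⟨T, hT, hTa⟩ := (hR' _).1 (haR k)
    exact ⟨T, hT, Subtype.ext hTa⟩
  · rintro _ ⟨T, hT, rfl⟩
    exact ⟨_, h7 ⟨T, hT⟩⟩
  · rintro _ ⟨T, hT, rfl⟩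
    exact ⟨_, h6 ⟨T, hT⟩⟩

end Trace

end MeasurableHilbertField

/-! ### The operator monotone function s/(1+s) = 1 - (1+s)⁻¹. -/

section ResolventOrder

variable {R : Type*} [CStarAlgebra R] [PartialOrder R] [StarOrderedRing R]

theorem isStrictlyPositive_one_add {s : R} (hs : 0 ≤ s) : IsStrictlyPositive (1 + s) :=
  IsStrictlyPositive.add_nonneg isStrictlyPositive_one hs

/-- Sums of positive contractions need not be bounded, and operators have no pairwise suprema.
Applying s/(1+s) to partial sums gives increasing sequences inside the positive unit ball, which
substitute for suprema in `IsNormalPositive.exists_forall_lt`. -/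
theorem one_sub_inverse_one_add_mono {s t : R} (hs : 0 ≤ s) (hst : s ≤ t) :
    1 - Ring.inverse (1 + s) ≤ 1 - Ring.inverse (1 + t) :=
  sub_le_sub_left (CStarAlgebra.ringInverse_le_ringInverse (add_le_add_right hst 1)
    (isStrictlyPositive_one_add hs)) 1

theorem inverse_one_add_nonneg {s : R} (hs : 0 ≤ s) : 0 ≤ Ring.inverse (1 + s) := by
  have h := isStrictlyPositive_one_add hs
  obtain ⟨y, hy⟩ := h.isUnit
  rw [← hy, Ring.inverse_unit]
  exact CFC.inv_nonneg_of_nonneg y (hy ▸ h.nonneg)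

theorem one_sub_inverse_one_add_nonneg {s : R} (hs : 0 ≤ s) : 0 ≤ 1 - Ring.inverse (1 + s) := by
  simpa using one_sub_inverse_one_add_mono le_rfl hs

theorem one_sub_inverse_one_add_le_one {s : R} (hs : 0 ≤ s) : 1 - Ring.inverse (1 + s) ≤ 1 :=
  sub_le_self 1 (inverse_one_add_nonneg hs)

theorem one_sub_inverse_one_add_le {s : R} (hs : 0 ≤ s) : 1 - Ring.inverse (1 + s) ≤ s := by
  have h0 := inverse_one_add_nonneg hs
  obtain ⟨y, hy⟩ := (isStrictlyPositive_one_add hs).isUnit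
  rw [← hy, Ring.inverse_unit] at h0 ⊢
  have hs' : s = y - 1 := by rw [hy]; abel
  have h1 : s - (1 - (↑y⁻¹ : R)) = s * ↑y⁻¹ * s := by
    rw [hs', sub_mul, one_mul, Units.mul_inv, mul_sub, sub_mul, Units.inv_mul]
    simp only [mul_one, one_mul]
  rw [← sub_nonneg, h1]
  simpa only [(IsSelfAdjoint.of_nonneg hs).star_eq] using star_left_conjugate_nonneg h0 s

/-- Conjugating the difference e/(1+e) - e/2 by 1+e gives (e - e³)/2, which is nonnegative for 0 ≤ e
≤ 1. So each summand survives, up to the factor 1/2, in the bounded substitute for the sum. -/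
theorem half_smul_le_one_sub_inverse_one_add {e : R} (he : 0 ≤ e) (he1 : e ≤ 1) :
    (1 / 2 : ℝ) • e ≤ 1 - Ring.inverse (1 + e) := by
  have h0 := inverse_one_add_nonneg he
  obtain ⟨y, hy⟩ := (isStrictlyPositive_one_add he).isUnit
  rw [← hy, Ring.inverse_unit] at h0 ⊢
  have hc : (y : R) * e = e * y := by rw [hy, add_mul, mul_add, one_mul, mul_one]
  have h3 : e ^ 3 ≤ e := by simpa using CStarAlgebra.pow_antitone he he1 (by norm_num : 1 ≤ 3)
  have h1 : (↑y⁻¹ : R) * ((1 / 2 : ℝ) • (e - e ^ 3)) * ↑y⁻¹ = 1 - ↑y⁻¹ - (1 / 2 : ℝ) • e := by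
    have h4 : (1 / 2 : ℝ) • (e - e ^ 3) = ↑y * (1 - ↑y⁻¹ - (1 / 2 : ℝ) • e) * ↑y := by
      rw [mul_sub, mul_sub, sub_mul, sub_mul, mul_one, Units.mul_inv, one_mul, mul_smul_comm,
        smul_mul_assoc, hy]
      have h5 : (1 + e) * (1 + e) - (1 + e) = e + e ^ 2 := by noncomm_ring
      have h6 : (1 + e) * e * (1 + e) = e + (2 : ℝ) • e ^ 2 + e ^ 3 := by
        rw [two_smul]; noncomm_ring
      rw [h5, h6]
      module
    rw [h4, mul_assoc, mul_assoc, mul_assoc, Units.mul_inv, mul_one, ← mul_assoc, Units.inv_mul,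
      one_mul]
  rw [← sub_nonneg, ← h1]
  have h2 : (0 : R) ≤ (1 / 2 : ℝ) • (e - e ^ 3) := smul_nonneg (by norm_num) (sub_nonneg.2 h3)
  simpa only [(IsSelfAdjoint.of_nonneg h0).star_eq] using star_left_conjugate_nonneg h2 ↑y⁻¹

end ResolventOrder

/-! ### Normal positive functionals and their absolute continuity. -/

section MonotoneLimits

variable {K : Type*} [NormedAddCommGroup K] [InnerProductSpace ℂ K] [CompleteSpace K]

theorem nonneg_of_strong_limit {a : ℕ → K →L[ℂ] K} {b : K →L[ℂ] K} (ha : ∀ k, 0 ≤ a k)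
    (h : ∀ v, Tendsto (fun k => a k v) atTop (𝓝 (b v))) : 0 ≤ b := by
  rw [ContinuousLinearMap.nonneg_iff_isPositive, ContinuousLinearMap.isPositive_iff_complex]
  intro v
  have h1 : Tendsto (fun k => (inner ℂ (a k v) v : ℂ)) atTop (𝓝 (inner ℂ (b v) v)) :=
    (h v).inner tendsto_const_nhds
  have h2 : ∀ k, ((RCLike.re (inner ℂ (a k v) v : ℂ) : ℝ) : ℂ) = inner ℂ (a k v) v ∧
      0 ≤ RCLike.re (inner ℂ (a k v) v : ℂ) := fun k =>
    (ContinuousLinearMap.isPositive_iff_complex _).1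
      ((ContinuousLinearMap.nonneg_iff_isPositive _).1 (ha k)) v
  have h3 := (RCLike.continuous_re (K := ℂ)).tendsto _ |>.comp h1
  refine ⟨tendsto_nhds_unique ?_ h1, ge_of_tendsto h3 (Eventually.of_forall fun k => (h2 k).2)⟩
  have h4 := (Complex.continuous_ofReal.tendsto _).comp h3
  exact h4.congr fun k => (h2 k).1

theorem le_of_strong_limit {a : ℕ → K →L[ℂ] K} {b c : K →L[ℂ] K} (ha : ∀ k, a k ≤ c)
    (h : ∀ v, Tendsto (fun k => a k v) atTop (𝓝 (b v))) : b ≤ c :=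
  sub_nonneg.1 (nonneg_of_strong_limit (fun k => sub_nonneg.2 (ha k)) fun v =>
    (h v).const_sub (c v))

theorem ge_of_strong_limit {a : ℕ → K →L[ℂ] K} {b : K →L[ℂ] K} (hm : Monotone a)
    (h : ∀ v, Tendsto (fun k => a k v) atTop (𝓝 (b v))) (n : ℕ) : a n ≤ b :=
  sub_nonneg.1 (nonneg_of_strong_limit (a := fun k => a (k + n) - a n)
    (fun k => sub_nonneg.2 (hm (Nat.le_add_left n k))) fun v =>
    (((tendsto_add_atTop_iff_nat n).2 (h v)).sub_const (a n v)))

/-- A bounded increasing sequence of operators converges strongly. -/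
theorem exists_strong_limit_of_monotone {h : ℕ → K →L[ℂ] K} (hm : Monotone h)
    (h0 : ∀ k, 0 ≤ h k) (h1 : ∀ k, h k ≤ 1) :
    ∃ b : K →L[ℂ] K, ∀ v, Tendsto (fun k => h k v) atTop (𝓝 (b v)) := by
  have hn : ∀ k, ‖h k‖ ≤ 1 := fun k => (CStarAlgebra.norm_le_one_iff_of_nonneg _ (h0 k)).2 (h1 k)
  refine exists_strong_limit hn (S := Set.univ)
    (by rw [Submodule.span_univ]; exact top_le_iff.1 (Submodule.le_topologicalClosure _)) fun v _ => ?_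
  -- For d = h l - h k one has 0 ≤ d ≤ 1, hence d² ≤ d and ‖dv‖² ≤ ⟨dv, v⟩: convergence of the
  -- quadratic form gives strong convergence.
  have hmono : ∀ {k l}, k ≤ l → ‖h k v - h l v‖ ^ 2 ≤
      (inner ℂ (h l v) v : ℂ).re - (inner ℂ (h k v) v : ℂ).re := by
    intro k l hkl
    have hd0 : 0 ≤ h l - h k := sub_nonneg.2 (hm hkl)
    have hd1 : h l - h k ≤ 1 := (sub_le_self _ (h0 k)).trans (h1 l)
    have hd2 : (h l - h k) * (h l - h k) ≤ h l - h k := by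
      simpa [sq] using CStarAlgebra.pow_antitone hd0 hd1 (by norm_num : 1 ≤ 2)
    have h2 := ((ContinuousLinearMap.isPositive_iff_complex _).1
      ((ContinuousLinearMap.le_def _ _).1 hd2) v).2
    have h3 : (inner ℂ (((h l - h k) * (h l - h k)) v) v : ℂ) = ((‖h k v - h l v‖ ^ 2 : ℝ) : ℂ) := by
      have hsa : ContinuousLinearMap.adjoint (h l - h k) = h l - h k :=
        (IsSelfAdjoint.of_nonneg hd0).star_eq
      change (inner ℂ ((h l - h k) ((h l - h k) v)) v : ℂ) = _
      nth_rewrite 1 [← hsa]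
      rw [ContinuousLinearMap.adjoint_inner_left, inner_self_eq_norm_sq_to_K, norm_sub_rev]
      simp
    rw [sub_apply, inner_sub_left, h3, sub_apply, inner_sub_left] at h2
    simpa only [Complex.ofReal_re, RCLike.re_eq_complex_re, map_sub, sub_nonneg] using h2
  have hf : Monotone fun k => (inner ℂ (h k v) v : ℂ).re := fun k l hkl => by
    have := hmono hkl
    nlinarith [sq_nonneg ‖h k v - h l v‖]
  have hb : BddAbove (Set.range fun k => (inner ℂ (h k v) v : ℂ).re) := by
    refine ⟨‖v‖ * ‖v‖, ?_⟩
    rintro _ ⟨k, rfl⟩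
    refine (Complex.re_le_norm _).trans ((norm_inner_le_norm _ _).trans ?_)
    refine mul_le_mul_of_nonneg_right ?_ (norm_nonneg _)
    simpa using norm_apply_le_of_norm_le (hn k) v
  have hc := (tendsto_atTop_ciSup hf hb).cauchySeq
  rw [Metric.cauchySeq_iff'] at hc ⊢
  intro ε hε
  obtain ⟨N, hN⟩ := hc (ε ^ 2) (by positivity)
  refine ⟨N, fun n hn => ?_⟩
  have h2 := hN n hn
  rw [dist_comm, dist_eq_norm]
  refine lt_of_pow_lt_pow_left₀ 2 hε.le ((hmono hn).trans_lt ?_)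
  exact (le_abs_self _).trans_lt h2

theorem StarSubalgebra.exists_star_mul_self_eq {S : StarSubalgebra ℂ (K →L[ℂ] K)}
    (hS : IsClosed (S : Set (K →L[ℂ] K))) {a : K →L[ℂ] K} (ha : a ∈ S) (h0 : 0 ≤ a) :
    ∃ s ∈ S, star s * s = a := by
  refine ⟨CFC.sqrt a, ?_, ?_⟩
  · rw [CFC.sqrt_eq_real_sqrt a h0]
    rw [cfcₙ_eq_cfc]
    have := hS
    exact cfc_mem Real.sqrt ha
  · rw [(IsSelfAdjoint.of_nonneg (CFC.sqrt_nonneg a)).star_eq, CFC.sqrt_mul_sqrt_self a h0]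

/-- A positive functional that is continuous along increasing sequences. -/
structure IsNormalPositive {A : StarSubalgebra ℂ (K →L[ℂ] K)} (α : A →ₗ[ℂ] ℂ) : Prop where
  mono : ∀ a b : A, (a : K →L[ℂ] K) ≤ b → (α a).re ≤ (α b).re
  lim : ∀ (h : ℕ → A) (b : A), Monotone (fun k => (h k : K →L[ℂ] K)) →
    (∀ k, (0 : K →L[ℂ] K) ≤ h k) → (∀ k, (h k : K →L[ℂ] K) ≤ 1) →
    (∀ v, Tendsto (fun k => (h k : K →L[ℂ] K) v) atTop (𝓝 ((b : K →L[ℂ] K) v))) →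
    Tendsto (fun k => (α (h k)).re) atTop (𝓝 (α b).re)

theorem IsNormalPositive.lim_antitone {A : StarSubalgebra ℂ (K →L[ℂ] K)} {α : A →ₗ[ℂ] ℂ}
    (hα : IsNormalPositive α) (h : ℕ → A) (b : A) (hm : Antitone fun k => (h k : K →L[ℂ] K))
    (h0 : ∀ k, (0 : K →L[ℂ] K) ≤ h k) (h1 : ∀ k, (h k : K →L[ℂ] K) ≤ 1)
    (hb : ∀ v, Tendsto (fun k => (h k : K →L[ℂ] K) v) atTop (𝓝 ((b : K →L[ℂ] K) v))) :
    Tendsto (fun k => (α (h k)).re) atTop (𝓝 (α b).re) := by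
  have h2 := hα.lim (fun k => 1 - h k) (1 - b) (fun k l hkl => sub_le_sub_left (hm hkl) 1)
    (fun k => sub_nonneg.2 (h1 k)) (fun k => sub_le_self 1 (h0 k)) fun v => (hb v).const_sub v
  simpa using h2.const_sub (α 1).re

theorem VonNeumannAlgebra.inverse_mem (A : VonNeumannAlgebra K) {a : K →L[ℂ] K} (ha : a ∈ A) :
    Ring.inverse a ∈ A := by
  by_cases hu : IsUnit a
  · obtain ⟨y, rfl⟩ := hu
    rw [Ring.inverse_unit]
    refine A.mem_iff_commute.2 fun s hs => ?_
    have h1 : s * y = y * s := A.mem_iff_commute.1 ha s hs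
    have h2 : (↑y⁻¹ : K →L[ℂ] K) * (s * y) * ↑y⁻¹ = ↑y⁻¹ * (y * s) * ↑y⁻¹ := by rw [h1]
    rw [mul_assoc, mul_assoc, Units.mul_inv, mul_one, ← mul_assoc, Units.inv_mul, one_mul] at h2
    exact h2.symm
  · rw [Ring.inverse_non_unit _ hu]
    exact zero_mem A

/-- Absolute continuity of normal positive functionals with respect to a faithful one. -/
theorem IsNormalPositive.exists_forall_lt {A : VonNeumannAlgebra K}
    {α β : A.toStarSubalgebra →ₗ[ℂ] ℂ} (hα : IsNormalPositive α) (hβ : IsNormalPositive β)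
    (hfaith : ∀ a : A.toStarSubalgebra, (0 : K →L[ℂ] K) ≤ a → (α a).re = 0 → a = 0)
    {ε : ℝ} (hε : 0 < ε) : ∃ δ > 0, ∀ e : A.toStarSubalgebra, (0 : K →L[ℂ] K) ≤ e →
      (e : K →L[ℂ] K) ≤ 1 → (α e).re < δ → (β e).re < ε := by
  by_contra! hcon
  choose e he0 he1 heα heβ using fun k : ℕ => hcon ((1 / 2 : ℝ) ^ k) (by positivity)
  -- A noncommutative Borel-Cantelli argument. The e k have α(e k) < 2^{-k} and β(e k) ≥ ε; a
  -- substitute for lim sup e k will have α = 0 and β ≥ ε/2, against faithfulness.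
  let S : ℕ → ℕ → A.toStarSubalgebra := fun n m => ∑ k ∈ Finset.Icc n m, e k
  have hScoe : ∀ n m, (S n m : K →L[ℂ] K) = ∑ k ∈ Finset.Icc n m, (e k : K →L[ℂ] K) := fun n m => by
    simp [S]
  have hS0 : ∀ n m, (0 : K →L[ℂ] K) ≤ S n m := fun n m => by
    rw [hScoe]; exact Finset.sum_nonneg fun k _ => he0 k
  have hSmono : ∀ {n m n' m'}, n' ≤ n → m ≤ m' → (S n m : K →L[ℂ] K) ≤ S n' m' := by
    intro n m n' m' hn hm
    rw [hScoe, hScoe]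
    exact Finset.sum_le_sum_of_subset_of_nonneg (Finset.Icc_subset_Icc hn hm) fun k _ _ => he0 k
  -- S/(1+S) plays the role of the supremum of e n, …, e m: it increases with m, decreases with n,
  -- and is dominated by S, so α is at most the geometric tail 2 · 2^{-n}.
  let R : ℕ → ℕ → A.toStarSubalgebra := fun n m =>
    ⟨1 - Ring.inverse (1 + (S n m : K →L[ℂ] K)), sub_mem (one_mem A)
      (A.inverse_mem (add_mem (one_mem A) (S n m).2))⟩
  have hR0 : ∀ n m, (0 : K →L[ℂ] K) ≤ R n m := fun n m => one_sub_inverse_one_add_nonneg (hS0 n m)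
  have hR1 : ∀ n m, (R n m : K →L[ℂ] K) ≤ 1 := fun n m => one_sub_inverse_one_add_le_one (hS0 n m)
  have hRmono : ∀ {n m n' m'}, n' ≤ n → m ≤ m' → (R n m : K →L[ℂ] K) ≤ R n' m' := fun hn hm =>
    one_sub_inverse_one_add_mono (hS0 _ _) (hSmono hn hm)
  have hRα : ∀ n m, (α (R n m)).re ≤ 2 * (1 / 2 : ℝ) ^ n := by
    intro n m
    refine (hα.mono _ (S n m) (one_sub_inverse_one_add_le (hS0 n m))).trans ?_
    simp only [S, map_sum, Complex.re_sum]
    refine (Finset.sum_le_sum fun k _ => (heα k).le).trans ?_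
    have h1 : ∑ k ∈ Finset.Icc n m, (1 / 2 : ℝ) ^ k ≤
        ∑ k ∈ Finset.range (m + 1), (1 / 2 : ℝ) ^ (n + k) := by
      rw [← Finset.sum_image (s := Finset.range (m + 1)) (g := fun k => n + k)
        (f := fun k => (1 / 2 : ℝ) ^ k) (by intro a _ b _ h; exact Nat.add_left_cancel h)]
      refine Finset.sum_le_sum_of_subset_of_nonneg (fun k hk => ?_) fun k _ _ => by positivity
      rw [Finset.mem_Icc] at hk
      exact Finset.mem_image.2 ⟨k - n, Finset.mem_range.2 (by omega), by omega⟩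
    refine h1.trans ?_
    simp only [pow_add, ← Finset.mul_sum]
    rw [mul_comm]
    refine mul_le_mul_of_nonneg_right ?_ (by positivity)
    have h2 := Summable.sum_le_tsum (Finset.range (m + 1))
      (fun k _ => by positivity) summable_geometric_two
    rwa [tsum_geometric_two] at h2
  have hRβ : ∀ n, ε / 2 ≤ (β (R n n)).re := by
    intro n
    have h1 : (((1 / 2 : ℂ) • e n : A.toStarSubalgebra) : K →L[ℂ] K) ≤ R n n := by
      have h2 := half_smul_le_one_sub_inverse_one_add (he0 n) (he1 n)
      have h3 : (((1 / 2 : ℂ) • e n : A.toStarSubalgebra) : K →L[ℂ] K) =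
          (1 / 2 : ℝ) • (e n : K →L[ℂ] K) := by
        rw [show (1 / 2 : ℂ) = ((1 / 2 : ℝ) : ℂ) by norm_num]
        exact Complex.coe_smul _ _
      rw [h3]
      refine h2.trans (le_of_eq ?_)
      simp [R, S]
    have h2 := hβ.mono _ _ h1
    rw [map_smul, smul_eq_mul, show (1 / 2 : ℂ) = ((1 / 2 : ℝ) : ℂ) by norm_num,
      Complex.re_ofReal_mul] at h2
    linarith [heβ n]
  choose r hr using fun n => exists_strong_limit_of_monotone (h := fun m => (R n m : K →L[ℂ] K))
    (fun m m' hm => hRmono le_rfl hm) (hR0 n) (hR1 n)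
  have hrA : ∀ n, r n ∈ A := fun n => A.mem_of_strong_limit (fun m => (R n m).2) (hr n)
  let r' : ℕ → A.toStarSubalgebra := fun n => ⟨r n, hrA n⟩
  have hrge : ∀ n m, (R n m : K →L[ℂ] K) ≤ r n := fun n m =>
    ge_of_strong_limit (fun m m' hm => hRmono le_rfl hm) (hr n) m
  have hr0 : ∀ n, 0 ≤ r n := fun n => (hR0 n 0).trans (hrge n 0)
  have hr1 : ∀ n, r n ≤ 1 := fun n => le_of_strong_limit (hR1 n) (hr n)
  have hranti : Antitone r := fun n n' hn => le_of_strong_limit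
    (fun m => (hRmono hn le_rfl).trans (hrge n m)) (hr n')
  have hrα : ∀ n, (α (r' n)).re ≤ 2 * (1 / 2 : ℝ) ^ n := fun n => le_of_tendsto
    (hα.lim (R n) (r' n) (fun m m' hm => hRmono le_rfl hm) (hR0 n) (hR1 n) (hr n))
    (Eventually.of_forall (hRα n))
  have hrβ : ∀ n, ε / 2 ≤ (β (r' n)).re := fun n => (hRβ n).trans (hβ.mono _ _ (hrge n n))
  obtain ⟨q, hq⟩ := exists_strong_limit_of_monotone (h := fun n => 1 - r n)
    (fun n n' hn => sub_le_sub_left (hranti hn) 1) (fun n => sub_nonneg.2 (hr1 n))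
    fun n => sub_le_self 1 (hr0 n)
  have hlim : ∀ v, Tendsto (fun n => r n v) atTop (𝓝 ((1 - q) v)) := fun v => by
    have := (hq v).const_sub v
    simpa using this
  -- The decreasing limit in n of the increasing limits in m. Both limits are monotone, so both
  -- functionals pass to them.
  let p : A.toStarSubalgebra := ⟨1 - q, A.mem_of_strong_limit hrA hlim⟩
  have hpα := hα.lim_antitone r' p hranti hr0 hr1 hlim
  have hpβ := hβ.lim_antitone r' p hranti hr0 hr1 hlim
  have hp0 : (0 : K →L[ℂ] K) ≤ p := nonneg_of_strong_limit hr0 hlim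
  have hz : (α p).re = 0 := by
    refine le_antisymm ?_ (by simpa using hα.mono 0 p hp0)
    have h1 : Tendsto (fun n : ℕ => 2 * (1 / 2 : ℝ) ^ n) atTop (𝓝 0) := by
      simpa using (tendsto_pow_atTop_nhds_zero_of_lt_one (by norm_num : (0 : ℝ) ≤ 1 / 2)
        (by norm_num)).const_mul 2
    exact le_of_tendsto_of_tendsto' hpα h1 hrα
  have hp := hfaith p hp0 hz
  have := ge_of_tendsto' hpβ hrβ
  rw [hp, map_zero, Complex.zero_re] at this
  linarith

end MonotoneLimits

/-! ### Normal functionals from *-isomorphisms and from slices. -/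

section NormalFunctionals

variable {K L : Type*} [NormedAddCommGroup K] [InnerProductSpace ℂ K] [CompleteSpace K]
  [NormedAddCommGroup L] [InnerProductSpace ℂ L] [CompleteSpace L]
  {M : StarSubalgebra ℂ (K →L[ℂ] K)} {τ : M →ₗ[ℂ] ℂ} {A : VonNeumannAlgebra L}

theorem VonNeumannAlgebra.exists_star_mul_self_eq {a : A.toStarSubalgebra}
    (h0 : (0 : L →L[ℂ] L) ≤ a) : ∃ s : A.toStarSubalgebra, star s * s = a := by
  obtain ⟨s, hs, h⟩ := StarSubalgebra.exists_star_mul_self_eq A.isClosed_coe a.2 h0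
  exact ⟨⟨s, hs⟩, Subtype.ext h⟩

/-- A `*`-isomorphism onto an algebra closed under strong limits of bounded sequences transports
normal traces to normal positive functionals. -/
theorem IsNormalTracial.isNormalPositive_of_equiv (hτ : IsNormalTracial τ)
    {P : StarSubalgebra ℂ (K →L[ℂ] K)} (hPM : P ≤ M)
    (hP : ∀ (T : ℕ → K →L[ℂ] K) (S : K →L[ℂ] K), (∀ k, T k ∈ P) → (∃ C, ∀ k, ‖T k‖ ≤ C) →
      (∀ v, Tendsto (fun k => T k v) atTop (𝓝 (S v))) → S ∈ P)
    (θ : A.toStarSubalgebra ≃⋆ₐ[ℂ] P) {α : A.toStarSubalgebra →ₗ[ℂ] ℂ}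
    (hα : ∀ a, α a = τ ⟨θ a, hPM (θ a).2⟩) : IsNormalPositive α := by
  have hclosed : IsClosed (P : Set (K →L[ℂ] K)) := by
    refine IsSeqClosed.isClosed fun a b ha hab => ?_
    obtain ⟨C, hC⟩ := hab.norm.bddAbove_range
    exact hP a b ha ⟨C, fun k => hC ⟨k, rfl⟩⟩ fun v =>
      ((ContinuousLinearMap.apply ℂ K v).continuous.tendsto b).comp hab
  have hmono : ∀ a b : A.toStarSubalgebra, (a : L →L[ℂ] L) ≤ b → (θ a : K →L[ℂ] K) ≤ θ b := by
    intro a b hab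
    obtain ⟨s, hs⟩ := VonNeumannAlgebra.exists_star_mul_self_eq (A := A) (a := b - a)
      (sub_nonneg.2 hab)
    rw [← sub_nonneg]
    have h1 : (θ b : K →L[ℂ] K) - θ a = star (θ s : K →L[ℂ] K) * θ s := by
      have h2 := congrArg (fun c => (θ c : K →L[ℂ] K)) hs
      simp only [map_mul, StarHomClass.map_star, map_sub] at h2
      exact h2.symm
    rw [h1]
    exact star_mul_self_nonneg _
  have hmono' : ∀ a b : A.toStarSubalgebra, (θ a : K →L[ℂ] K) ≤ θ b → (a : L →L[ℂ] L) ≤ b := by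
    intro a b hab
    obtain ⟨s, hsP, hs⟩ := StarSubalgebra.exists_star_mul_self_eq hclosed
      (sub_mem (θ b).2 (θ a).2) (sub_nonneg.2 hab)
    have h1 : b - a = star (θ.symm ⟨s, hsP⟩) * θ.symm ⟨s, hsP⟩ := by
      rw [← StarHomClass.map_star, ← map_mul, ← θ.symm_apply_apply (b - a)]
      congr 1
      rw [map_sub]
      exact Subtype.ext hs.symm
    rw [← sub_nonneg]
    have h2 : (b : L →L[ℂ] L) - a = star (θ.symm ⟨s, hsP⟩ : L →L[ℂ] L) * θ.symm ⟨s, hsP⟩ :=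
      congrArg Subtype.val h1
    rw [h2]
    exact star_mul_self_nonneg _
  refine ⟨fun a b hab => ?_, fun h b hm h0 h1 hb => ?_⟩
  · obtain ⟨s, hs⟩ := VonNeumannAlgebra.exists_star_mul_self_eq (A := A) (a := b - a)
      (sub_nonneg.2 hab)
    have h1 : α (b - a) = τ (star ⟨θ s, hPM (θ s).2⟩ * ⟨θ s, hPM (θ s).2⟩) := by
      rw [hα, ← hs]
      congr 1
      apply Subtype.ext
      simp only [map_mul, StarHomClass.map_star]
      rfl
    have h2 : 0 ≤ (α (b - a)).re := h1 ▸ hτ.nonneg _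
    rw [map_sub, Complex.sub_re] at h2
    linarith
  · have h0' : ∀ k, (0 : K →L[ℂ] K) ≤ θ (h k) := fun k => by simpa using hmono 0 (h k) (h0 k)
    have h1' : ∀ k, (θ (h k) : K →L[ℂ] K) ≤ 1 := fun k => by simpa using hmono (h k) 1 (h1 k)
    have hn : ∀ k, ‖(θ (h k) : K →L[ℂ] K)‖ ≤ 1 := fun k =>
      (CStarAlgebra.norm_le_one_iff_of_nonneg _ (h0' k)).2 (h1' k)
    have hm' : Monotone fun k => (θ (h k) : K →L[ℂ] K) := fun k l hkl => hmono _ _ (hm hkl)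
    -- The isomorphism and its inverse preserve order because positive elements are squares inside
    -- each algebra. Hence the strong limit c of the images, a least upper bound in P, must be the
    -- image of b.
    obtain ⟨c, hc⟩ := exists_strong_limit_of_monotone hm' h0' h1'
    have hcP : c ∈ P := hP _ c (fun k => (θ (h k)).2) ⟨1, hn⟩ hc
    have hle : c ≤ θ b := le_of_strong_limit (fun k => hmono _ _ (ge_of_strong_limit hm hb k)) hc
    have hge : (b : L →L[ℂ] L) ≤ θ.symm ⟨c, hcP⟩ := le_of_strong_limit (fun k => hmono' _ _ (by
      rw [θ.apply_symm_apply]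
      exact ge_of_strong_limit hm' hc k)) hb
    have hbc : (θ b : K →L[ℂ] K) = c := by
      refine le_antisymm ?_ hle
      simpa using hmono _ _ hge
    obtain ⟨η, hη⟩ := hτ.cont
    have h2 := hτ.tendsto_apply (hη (fun k => ⟨θ (h k), hPM (θ (h k)).2⟩ - ⟨θ b, hPM (θ b).2⟩)
      ⟨1 + ‖c‖, fun k => by
        refine (norm_sub_le _ _).trans (add_le_add (hn k) (le_of_eq ?_))
        change ‖(θ b : K →L[ℂ] K)‖ = _
        rw [hbc]⟩ fun n => by
        have := (hc (η n)).sub_const (c (η n))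
        rw [sub_self] at this
        refine this.congr fun k => ?_
        change _ = (θ (h k) : K →L[ℂ] K) (η n) - (θ b : K →L[ℂ] K) (η n)
        rw [hbc])
    simp only [map_sub, ← hα] at h2
    have h3 := (Complex.continuous_re.tendsto _).comp (h2.add_const (α b))
    simpa [Function.comp_def] using h3

/-- The functional `T ↦ τ(J*TJ)`. -/
noncomputable def sliceFunctional (τ : M →ₗ[ℂ] ℂ) (J : K →L[ℂ] L)
    (hJ : ∀ T ∈ A, J.adjoint ∘L T ∘L J ∈ M) : A.toStarSubalgebra →ₗ[ℂ] ℂ where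
  toFun T := τ ⟨_, hJ T T.2⟩
  map_add' S T := by
    rw [← map_add]
    congr 1
    apply Subtype.ext
    ext v
    simp
  map_smul' c T := by
    rw [RingHom.id_apply, ← map_smul]
    congr 1
    apply Subtype.ext
    ext v
    simp

variable {Q : VonNeumannAlgebra K} {J : K →L[ℂ] L}

theorem slice_nonneg {a : L →L[ℂ] L} (ha : 0 ≤ a) (J : K →L[ℂ] L) :
    0 ≤ J.adjoint ∘L a ∘L J := by
  rw [ContinuousLinearMap.nonneg_iff_isPositive] at ha ⊢
  exact ha.adjoint_conj J

/-- The map T ↦ J*TJ is positive and strongly continuous, and τ is continuous on bounded sequences.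
Positivity of the trace applies because the square root of a positive slice is taken inside Q, hence
inside M. -/
theorem isNormalPositive_sliceFunctional (hτ : IsNormalTracial τ)
    (hQM : Q.toStarSubalgebra ≤ M) (hJ : ∀ T ∈ A, J.adjoint ∘L T ∘L J ∈ Q) :
    IsNormalPositive (sliceFunctional (A := A) τ J fun T hT => hQM (hJ T hT)) := by
  refine ⟨fun a b hab => ?_, fun h b hm h0 h1 hb => ?_⟩
  · have h1 : 0 ≤ (sliceFunctional (A := A) τ J (fun T hT => hQM (hJ T hT)) (b - a)).re := by
      obtain ⟨s, hs⟩ := VonNeumannAlgebra.exists_star_mul_self_eq (A := Q)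
        (a := ⟨_, hJ _ (b - a).2⟩) (slice_nonneg (sub_nonneg.2 hab) J)
      have h2 : sliceFunctional (A := A) τ J (fun T hT => hQM (hJ T hT)) (b - a) =
          τ (star ⟨s, hQM s.2⟩ * ⟨s, hQM s.2⟩) := by
        change τ _ = τ _
        congr 1
        exact Subtype.ext (congrArg Subtype.val hs).symm
      rw [h2]
      exact hτ.nonneg _
    rw [map_sub, Complex.sub_re] at h1
    linarith
  · obtain ⟨η, hη⟩ := hτ.cont
    have hn : ∀ k, ‖(h k : L →L[ℂ] L)‖ ≤ 1 := fun k =>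
      (CStarAlgebra.norm_le_one_iff_of_nonneg _ (h0 k)).2 (h1 k)
    have h2 := hτ.tendsto_apply (hη (fun k => ⟨_, hQM (hJ _ (h k - b).2)⟩)
      ⟨‖J.adjoint‖ * ((1 + ‖(b : L →L[ℂ] L)‖) * ‖J‖), fun k => by
        refine (ContinuousLinearMap.opNorm_comp_le _ _).trans ?_
        gcongr
        refine (ContinuousLinearMap.opNorm_comp_le _ _).trans ?_
        gcongr
        exact (norm_sub_le _ _).trans (add_le_add_left (hn k) _)⟩ fun n => by
        have h3 := (hb (J (η n))).sub_const ((b : L →L[ℂ] L) (J (η n)))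
        rw [sub_self] at h3
        have h4 := (J.adjoint.continuous.tendsto 0).comp h3
        rw [map_zero] at h4
        exact h4)
    have h5 : ∀ k, τ ⟨_, hQM (hJ _ (h k - b).2)⟩ =
        sliceFunctional (A := A) τ J (fun T hT => hQM (hJ T hT)) (h k) -
          sliceFunctional (A := A) τ J (fun T hT => hQM (hJ T hT)) b := fun k => by
      rw [← map_sub]
      rfl
    simp only [h5] at h2
    have h3 := (Complex.continuous_re.tendsto _).comp (h2.add_const
      (sliceFunctional (A := A) τ J (fun T hT => hQM (hJ T hT)) b))
    simpa [Function.comp_def] using h3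

/-- Faithfulness of τ gives J*aJ = 0; writing a = t*t this says tJ = 0, hence aJ = 0. -/
theorem apply_eq_zero_of_sliceFunctional (hτ : IsNormalTracial τ)
    (hQM : Q.toStarSubalgebra ≤ M) (hJ : ∀ T ∈ A, J.adjoint ∘L T ∘L J ∈ Q)
    {a : A.toStarSubalgebra} (ha : (0 : L →L[ℂ] L) ≤ a)
    (h : (sliceFunctional (A := A) τ J (fun T hT => hQM (hJ T hT)) a).re = 0) (v : K) :
    (a : L →L[ℂ] L) (J v) = 0 := by
  obtain ⟨s, hs⟩ := VonNeumannAlgebra.exists_star_mul_self_eq (A := Q)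
    (a := ⟨_, hJ _ a.2⟩) (slice_nonneg ha J)
  have h1 : traceSq τ ⟨s, hQM s.2⟩ = 0 := by
    rw [← h]
    change (τ _).re = (τ _).re
    have h2 : (star ⟨s, hQM s.2⟩ * ⟨s, hQM s.2⟩ : M) = ⟨_, hQM (hJ _ a.2)⟩ :=
      Subtype.ext (show star (s : K →L[ℂ] K) * s = _ from congrArg Subtype.val hs)
    rw [h2]
  have h2 : (s : K →L[ℂ] K) = 0 := congrArg Subtype.val (hτ.faithful _ h1)
  have h3 : J.adjoint ∘L (a : L →L[ℂ] L) ∘L J = 0 := by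
    have h4 : star (s : K →L[ℂ] K) * s = J.adjoint ∘L (a : L →L[ℂ] L) ∘L J :=
      congrArg Subtype.val hs
    rw [← h4, h2, mul_zero]
  obtain ⟨t, ht⟩ := VonNeumannAlgebra.exists_star_mul_self_eq (A := A) ha
  have h5 : (a : L →L[ℂ] L) = star (t : L →L[ℂ] L) * t := congrArg Subtype.val ht.symm
  have h6 : (t : L →L[ℂ] L) (J v) = 0 := by
    have h7 : (inner ℂ (J v) ((a : L →L[ℂ] L) (J v)) : ℂ) = 0 := by
      rw [← ContinuousLinearMap.adjoint_inner_right]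
      have := DFunLike.congr_fun h3 v
      change J.adjoint ((a : L →L[ℂ] L) (J v)) = 0 at this
      rw [this, inner_zero_right]
    rw [h5] at h7
    change inner ℂ (J v) ((ContinuousLinearMap.adjoint (t : L →L[ℂ] L))
      ((t : L →L[ℂ] L) (J v))) = 0 at h7
    rw [ContinuousLinearMap.adjoint_inner_right] at h7
    exact inner_self_eq_zero.1 h7
  rw [h5]
  change star (t : L →L[ℂ] L) ((t : L →L[ℂ] L) (J v)) = 0
  rw [h6, map_zero]

end NormalFunctionals

/-! ### Multiplication operators, slices and central cutoffs on L²(X; K). -/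

section VectorValued

variable {K : Type*} [NormedAddCommGroup K] [InnerProductSpace ℂ K] [CompleteSpace K]
  {X : Type*} [MeasurableSpace X] {μ : Measure X}

/-- The operator `f ⊗ 1` on `L²(X, μ; K)`. -/
noncomputable abbrev linftyMul (K : Type*) [NormedAddCommGroup K] [InnerProductSpace ℂ K]
    (f : Lp ℂ ∞ μ) : Lp K 2 μ →L[ℂ] Lp K 2 μ :=
  (ContinuousLinearMap.lsmul ℂ ℂ).holderL μ ∞ 2 2 f

theorem coeFn_linftyMul (f : Lp ℂ ∞ μ) (ξ : Lp K 2 μ) :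
    linftyMul K f ξ =ᵐ[μ] fun x => f x • ξ x :=
  ContinuousLinearMap.coeFn_holder _ f ξ

theorem star_linftyMul (f : Lp ℂ ∞ μ) : star (linftyMul K f) = linftyMul K (star f) := by
  refine Eq.symm ((ContinuousLinearMap.eq_adjoint_iff _ _).2 fun ξ η => ?_)
  rw [L2.inner_def, L2.inner_def]
  refine integral_congr_ae ?_
  filter_upwards [coeFn_linftyMul (star f) ξ, coeFn_linftyMul f η, Lp.coeFn_star f] with x h1 h2 h3
  rw [h1, h2, h3, Pi.star_apply, inner_smul_left, inner_smul_right]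
  simp

theorem star_compLpL (q : K →L[ℂ] K) : star (q.compLpL 2 μ) = (star q).compLpL 2 μ := by
  refine Eq.symm ((ContinuousLinearMap.eq_adjoint_iff _ _).2 fun ξ η => ?_)
  rw [L2.inner_def, L2.inner_def]
  refine integral_congr_ae ?_
  filter_upwards [(star q).coeFn_compLpL (p := 2) ξ, q.coeFn_compLpL (p := 2) η] with x h1 h2
  rw [h1, h2, ContinuousLinearMap.star_eq_adjoint, ContinuousLinearMap.adjoint_inner_left]

theorem compLpL_mul (q r : K →L[ℂ] K) :
    (q * r).compLpL 2 μ = q.compLpL 2 μ * r.compLpL 2 μ := by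
  ext1 ξ
  refine Lp.ext ?_
  filter_upwards [(q * r).coeFn_compLpL (p := 2) ξ, r.coeFn_compLpL (p := 2) ξ,
    q.coeFn_compLpL (p := 2) (r.compLpL 2 μ ξ)] with x h1 h2 h3
  rw [h1]
  exact (h3.trans (by rw [h2]; rfl)).symm

theorem linftyMul_commute_compLpL (f : Lp ℂ ∞ μ) (q : K →L[ℂ] K) :
    linftyMul K f * q.compLpL 2 μ = q.compLpL 2 μ * linftyMul K f := by
  ext1 ξ
  refine Lp.ext ?_
  filter_upwards [coeFn_linftyMul f (q.compLpL 2 μ ξ), q.coeFn_compLpL (p := 2) ξ,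
    q.coeFn_compLpL (p := 2) (linftyMul K f ξ), coeFn_linftyMul f ξ] with x h1 h2 h3 h4
  refine h1.trans (Eq.trans ?_ h3.symm)
  rw [h2, h4, map_smul]

theorem linftyMul_commute (f g : Lp ℂ ∞ μ) :
    linftyMul K f * linftyMul K g = linftyMul K g * linftyMul K f := by
  ext1 ξ
  refine Lp.ext ?_
  filter_upwards [coeFn_linftyMul f (linftyMul K g ξ), coeFn_linftyMul g ξ,
    coeFn_linftyMul g (linftyMul K f ξ), coeFn_linftyMul f ξ] with x h1 h2 h3 h4
  refine h1.trans (Eq.trans ?_ h3.symm)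
  rw [h2, h4, smul_comm]

variable {Q : VonNeumannAlgebra K}

theorem linftyMul_mem (Q : VonNeumannAlgebra K) (f : Lp ℂ ∞ μ) :
    linftyMul K f ∈ linftyTensor μ Q :=
  subset_generatedVonNeumannAlgebra (Or.inl ⟨f, rfl⟩)

theorem compLpL_mem {q : K →L[ℂ] K} (hq : q ∈ Q) : q.compLpL 2 μ ∈ linftyTensor μ Q :=
  subset_generatedVonNeumannAlgebra (Or.inr ⟨q, hq, rfl⟩)

theorem linftyMul_central (f : Lp ℂ ∞ μ) {T : Lp K 2 μ →L[ℂ] Lp K 2 μ}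
    (hT : T ∈ linftyTensor μ Q) : T * linftyMul K f = linftyMul K f * T := by
  refine mem_generatedVonNeumannAlgebra_iff.1 hT _ ?_
  rintro _ (⟨g, rfl⟩ | ⟨q, hq, rfl⟩)
  · rw [star_linftyMul]
    exact ⟨linftyMul_commute g f, linftyMul_commute g (star f)⟩
  · rw [star_linftyMul]
    exact ⟨(linftyMul_commute_compLpL f q).symm, (linftyMul_commute_compLpL (star f) q).symm⟩

/-- The operator `k ↦ g ⊗ k`. -/
noncomputable def tensorLeft (K : Type*) [NormedAddCommGroup K] [InnerProductSpace ℂ K]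
    (g : Lp ℂ 2 μ) : K →L[ℂ] Lp K 2 μ :=
  ((ContinuousLinearMap.lsmul ℂ ℂ).flip.compLpL₂ 2 μ).flip g

theorem coeFn_tensorLeft (g : Lp ℂ 2 μ) (k : K) : tensorLeft K g k =ᵐ[μ] fun x => g x • k :=
  ContinuousLinearMap.coeFn_compLp _ g

theorem compLpL_tensorLeft (g : Lp ℂ 2 μ) (q : K →L[ℂ] K) (k : K) :
    q.compLpL 2 μ (tensorLeft K g k) = tensorLeft K g (q k) := by
  refine Lp.ext ?_
  filter_upwards [q.coeFn_compLpL (p := 2) (tensorLeft K g k), coeFn_tensorLeft g k,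
    coeFn_tensorLeft g (q k)] with x h1 h2 h3
  rw [h1, h2, h3, map_smul]

/-- Slices of elements of `L^∞(X, μ) ⊗̄ Q` belong to `Q`. -/
theorem slice_mem (g : Lp ℂ 2 μ) : ∀ T ∈ linftyTensor μ Q,
    (tensorLeft K g).adjoint ∘L T ∘L tensorLeft K g ∈ Q := by
  intro T hT
  refine Q.mem_iff_commute.2 fun s hs => ?_
  -- For s in the commutant of Q, 1 ⊗ s commutes with the generators of the tensor product, hence
  -- with T; and 1 ⊗ s intertwines k ↦ g ⊗ k with s.
  have hcomm : T * s.compLpL 2 μ = s.compLpL 2 μ * T := by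
    refine mem_generatedVonNeumannAlgebra_iff.1 hT _ ?_
    rintro _ (⟨f, rfl⟩ | ⟨q, hq, rfl⟩)
    · rw [star_compLpL]
      exact ⟨linftyMul_commute_compLpL f s, linftyMul_commute_compLpL f (star s)⟩
    · rw [star_compLpL, ← compLpL_mul, ← compLpL_mul, ← compLpL_mul, ← compLpL_mul,
        Q.mem_iff_commute.1 hq s hs, Q.mem_iff_commute.1 hq _ (star_mem hs)]
      exact ⟨rfl, rfl⟩
  ext k
  refine ext_inner_right ℂ fun l => ?_
  change inner ℂ (s ((tensorLeft K g).adjoint (T (tensorLeft K g k)))) l =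
    inner ℂ ((tensorLeft K g).adjoint (T (tensorLeft K g (s k)))) l
  rw [ContinuousLinearMap.adjoint_inner_left, ← compLpL_tensorLeft,
    ← ContinuousLinearMap.adjoint_inner_right, ContinuousLinearMap.adjoint_inner_left,
    ← ContinuousLinearMap.star_eq_adjoint, ← compLpL_tensorLeft, ← star_compLpL,
    ContinuousLinearMap.star_eq_adjoint, ContinuousLinearMap.adjoint_inner_right]
  exact congrArg (fun v => inner ℂ v (tensorLeft K g l)) (DFunLike.congr_fun hcomm _).symm

/-- The indicator function of a measurable set, as an element of `L^∞`. -/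
noncomputable def linftyIndicator (μ : Measure X) (Z : Set X) : Lp ℂ ∞ μ := by
  classical
  exact if hZ : MeasurableSet Z then
    MemLp.toLp (Z.indicator fun _ => (1 : ℂ)) (memLp_top_of_bound
      (stronglyMeasurable_const.indicator hZ).aestronglyMeasurable 1
      (Eventually.of_forall fun x => by by_cases hx : x ∈ Z <;> simp [hx])) else 0

theorem coeFn_linftyIndicator {Z : Set X} (hZ : MeasurableSet Z) :
    linftyIndicator μ Z =ᵐ[μ] Z.indicator fun _ => (1 : ℂ) := by
  rw [linftyIndicator, dif_pos hZ]
  exact MemLp.coeFn_toLp _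

/-- The central projection `1_Z ⊗ 1` of `L^∞(X, μ) ⊗̄ Q`. -/
noncomputable def cutoff (μ : Measure X) (Q : VonNeumannAlgebra K) (Z : Set X) :
    (linftyTensor μ Q).toStarSubalgebra := ⟨linftyMul K (linftyIndicator μ Z), linftyMul_mem Q _⟩

theorem coeFn_cutoff {Z : Set X} (hZ : MeasurableSet Z) (ξ : Lp K 2 μ) :
    (cutoff μ Q Z : Lp K 2 μ →L[ℂ] Lp K 2 μ) ξ =ᵐ[μ]
      fun x => Z.indicator (fun _ => (1 : ℂ)) x • ξ x := by
  filter_upwards [coeFn_linftyMul (linftyIndicator μ Z) ξ, coeFn_linftyIndicator (μ := μ) hZ]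
    with x h1 h2
  rw [← h2]
  exact h1

theorem cutoff_mul {Z W : Set X} (hZ : MeasurableSet Z) (hW : MeasurableSet W) :
    cutoff μ Q Z * cutoff μ Q W = cutoff μ Q (Z ∩ W) := by
  apply Subtype.ext
  ext1 ξ
  refine Lp.ext ?_
  filter_upwards [coeFn_cutoff (Q := Q) hZ ((cutoff μ Q W : Lp K 2 μ →L[ℂ] Lp K 2 μ) ξ),
    coeFn_cutoff (Q := Q) hW ξ, coeFn_cutoff (Q := Q) (hZ.inter hW) ξ] with x h1 h2 h3
  refine h1.trans (Eq.trans ?_ h3.symm)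
  rw [h2, smul_smul]
  by_cases h4 : x ∈ Z <;> by_cases h5 : x ∈ W <;> simp [h4, h5]

theorem cutoff_add_compl {Z : Set X} (hZ : MeasurableSet Z) :
    cutoff μ Q Z + cutoff μ Q Zᶜ = 1 := by
  apply Subtype.ext
  ext1 ξ
  refine Lp.ext ?_
  filter_upwards [coeFn_cutoff (Q := Q) hZ ξ, coeFn_cutoff (Q := Q) hZ.compl ξ,
    Lp.coeFn_add ((cutoff μ Q Z : Lp K 2 μ →L[ℂ] Lp K 2 μ) ξ)
      ((cutoff μ Q Zᶜ : Lp K 2 μ →L[ℂ] Lp K 2 μ) ξ)] with x h1 h2 h3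
  refine h3.trans ?_
  rw [Pi.add_apply, h1, h2]
  by_cases h4 : x ∈ Z <;> simp [h4]

theorem cutoff_univ : cutoff μ Q Set.univ = 1 := by
  apply Subtype.ext
  ext1 ξ
  refine Lp.ext ?_
  filter_upwards [coeFn_cutoff (Q := Q) MeasurableSet.univ ξ] with x h1
  refine h1.trans ?_
  simp

theorem star_cutoff {Z : Set X} (hZ : MeasurableSet Z) : star (cutoff μ Q Z) = cutoff μ Q Z := by
  apply Subtype.ext
  change star (linftyMul K (linftyIndicator μ Z)) = linftyMul K (linftyIndicator μ Z)
  rw [star_linftyMul]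
  congr 1
  refine Lp.ext ?_
  filter_upwards [Lp.coeFn_star (linftyIndicator μ Z), coeFn_linftyIndicator (μ := μ) hZ] with x h1 h2
  rw [h1, Pi.star_apply, h2]
  by_cases h4 : x ∈ Z <;> simp [h4]

theorem linftyIndicator_mul_nonneg {Z : Set X} (hZ : MeasurableSet Z)
    {T : Lp K 2 μ →L[ℂ] Lp K 2 μ} (hT : T ∈ linftyTensor μ Q) (h0 : 0 ≤ T) :
    0 ≤ linftyMul K (linftyIndicator μ Z) * T := by
  have h1 : star (linftyMul K (linftyIndicator μ Z)) = linftyMul K (linftyIndicator μ Z) :=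
    congrArg Subtype.val (star_cutoff (Q := Q) hZ)
  have h2 : linftyMul K (linftyIndicator μ Z) * linftyMul K (linftyIndicator μ Z) =
      linftyMul K (linftyIndicator μ Z) := by
    have h3 := congrArg Subtype.val (cutoff_mul (μ := μ) (Q := Q) hZ hZ)
    rw [Set.inter_self] at h3
    exact h3
  have h3 := star_left_conjugate_nonneg h0 (linftyMul K (linftyIndicator μ Z))
  rw [h1, mul_assoc, linftyMul_central _ hT, ← mul_assoc, h2] at h3
  exact h3

theorem cutoff_mul_nonneg {Z : Set X} (hZ : MeasurableSet Z)
    {a : (linftyTensor μ Q).toStarSubalgebra} (ha : (0 : Lp K 2 μ →L[ℂ] Lp K 2 μ) ≤ a) :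
    (0 : Lp K 2 μ →L[ℂ] Lp K 2 μ) ≤ (cutoff μ Q Z * a : (linftyTensor μ Q).toStarSubalgebra) :=
  linftyIndicator_mul_nonneg hZ a.2 ha

theorem cutoff_mul_le {Z : Set X} (hZ : MeasurableSet Z)
    {a : (linftyTensor μ Q).toStarSubalgebra} (ha : (a : Lp K 2 μ →L[ℂ] Lp K 2 μ) ≤ 1) :
    ((cutoff μ Q Z * a : (linftyTensor μ Q).toStarSubalgebra) : Lp K 2 μ →L[ℂ] Lp K 2 μ) ≤
      cutoff μ Q Z := by
  have h1 := linftyIndicator_mul_nonneg (Q := Q) hZ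
    (sub_mem (one_mem (linftyTensor μ Q)) a.2) (sub_nonneg.2 ha)
  rw [mul_sub, mul_one, sub_nonneg] at h1
  exact h1

/-- Slices of `1_Z ⊗ q`. -/
theorem slice_cutoff_mul {Z : Set X} (hZ : MeasurableSet Z) (g : Lp ℂ 2 μ) (q : K →L[ℂ] K) :
    (tensorLeft K g).adjoint ∘L
        ((cutoff μ Q Z : Lp K 2 μ →L[ℂ] Lp K 2 μ) * q.compLpL 2 μ) ∘L tensorLeft K g =
      ((∫ x in Z, ‖g x‖ ^ 2 ∂μ : ℝ) : ℂ) • q := by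
  ext k
  refine ext_inner_left ℂ fun l => ?_
  change inner ℂ l ((tensorLeft K g).adjoint ((cutoff μ Q Z : Lp K 2 μ →L[ℂ] Lp K 2 μ)
    (q.compLpL 2 μ (tensorLeft K g k)))) = inner ℂ l (((∫ x in Z, ‖g x‖ ^ 2 ∂μ : ℝ) : ℂ) • q k)
  rw [ContinuousLinearMap.adjoint_inner_right, compLpL_tensorLeft, L2.inner_def, inner_smul_right,
    ← integral_complex_ofReal, ← integral_mul_const, ← integral_indicator hZ]
  refine integral_congr_ae ?_
  filter_upwards [coeFn_tensorLeft g l, coeFn_tensorLeft g (q k),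
    coeFn_cutoff (Q := Q) hZ (tensorLeft K g (q k))] with x h1 h2 h3
  rw [h1, h3, h2]
  by_cases h4 : x ∈ Z
  · rw [Set.indicator_of_mem h4, Set.indicator_of_mem h4, one_smul, inner_smul_left,
      inner_smul_right, ← mul_assoc, Complex.conj_mul', Complex.ofReal_pow]
  · simp [h4]

/-- If `g` does not vanish, the vectors `fg ⊗ k` are total. -/
theorem eq_zero_of_forall_tensorLeft {g : Lp ℂ 2 μ} {g₀ : X → ℝ} (hg₀ : Measurable g₀)
    (hpos : ∀ x, 0 < g₀ x) (hg : ∀ᵐ x ∂μ, g x = g₀ x) {T : Lp K 2 μ →L[ℂ] Lp K 2 μ}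
    (hT : T ∈ linftyTensor μ Q) (h : ∀ k, T (tensorLeft K g k) = 0) : T = 0 := by
  have hf : ∀ f : Lp ℂ ∞ μ, ∀ k, T (linftyMul K f (tensorLeft K g k)) = 0 := fun f k => by
    have h1 := DFunLike.congr_fun (linftyMul_central f hT) (tensorLeft K g k)
    change T (linftyMul K f (tensorLeft K g k)) = linftyMul K f (T (tensorLeft K g k)) at h1
    rw [h1, h, map_zero]
  have hind : ∀ (k : K) {s : Set X} (hs : MeasurableSet s) (hμs : μ s ≠ ∞),
      T (indicatorConstLp 2 hs hμs k) = 0 := by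
    intro k s hs hμs
    -- On t n the function 1/g₀ is bounded, so multiplication by it carries g ⊗ k to 1_{t n} ⊗ k.
    -- These sets exhaust s because g₀ > 0, and indicators span a dense subspace of L².
    let t : ℕ → Set X := fun n => s ∩ {x | 1 / ((n : ℝ) + 1) < g₀ x}
    have ht : ∀ n, MeasurableSet (t n) := fun n => hs.inter (measurableSet_lt measurable_const hg₀)
    have hμt : ∀ n, μ (t n) ≠ ∞ := fun n =>
      ne_top_of_le_ne_top hμs (measure_mono Set.inter_subset_left)
    have hlim : Tendsto (fun n => indicatorConstLp 2 (ht n) (hμt n) k) atTop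
        (𝓝 (indicatorConstLp 2 hs hμs k)) := by
      refine tendsto_indicatorConstLp_set (by norm_num) ?_
      have h1 : ∀ n, symmDiff (t n) s = s \ t n := fun n => by
        rw [symmDiff_def, show t n \ s = ⊥ from Set.sdiff_eq_empty.2 Set.inter_subset_left,
          bot_sup_eq]
      simp only [h1]
      have h2 : ⋂ n, s \ t n = ∅ := by
        rw [← Set.sdiff_iUnion, Set.sdiff_eq_empty]
        intro x hx
        obtain ⟨n, hn⟩ := exists_nat_one_div_lt (hpos x)
        exact Set.mem_iUnion.2 ⟨n, hx, hn⟩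
      rw [← measure_empty (μ := μ), ← h2]
      refine tendsto_measure_iInter_atTop (fun n => (hs.diff (ht n)).nullMeasurableSet)
        (fun n m hnm => Set.sdiff_subset_sdiff_right (Set.inter_subset_inter_right _ fun x hx => ?_))
        ⟨0, ne_top_of_le_ne_top hμs (measure_mono Set.sdiff_subset)⟩
      refine lt_of_le_of_lt (a := 1 / ((m : ℝ) + 1)) ?_ (show _ < g₀ x from hx)
      exact one_div_le_one_div_of_le (by positivity) (by exact_mod_cast Nat.succ_le_succ hnm)
    have hz : ∀ n, T (indicatorConstLp 2 (ht n) (hμt n) k) = 0 := by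
      intro n
      have hmem : MemLp ((t n).indicator fun x => ((g₀ x)⁻¹ : ℂ)) ∞ μ := by
        refine memLp_top_of_bound ((Complex.measurable_ofReal.comp hg₀).inv.indicator
          (ht n)).aestronglyMeasurable (n + 1) (Eventually.of_forall fun x => ?_)
        by_cases hx : x ∈ t n
        · rw [Set.indicator_of_mem hx, norm_inv, Complex.norm_real, Real.norm_of_nonneg (hpos x).le,
            inv_le_comm₀ (hpos x) (by positivity), ← one_div]
          exact hx.2.le
        · rw [Set.indicator_of_notMem hx, norm_zero]
          positivity
      rw [← hf (hmem.toLp _) k]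
      congr 1
      refine Lp.ext ?_
      filter_upwards [indicatorConstLp_coeFn (p := 2) (hs := ht n) (hμs := hμt n) (c := k),
        coeFn_linftyMul (hmem.toLp _) (tensorLeft K g k), coeFn_tensorLeft g k,
        hmem.coeFn_toLp, hg] with x h1 h2 h3 h4 h5
      rw [h1, h2, h3, h4, h5, smul_smul]
      by_cases hx : x ∈ t n
      · rw [Set.indicator_of_mem hx, Set.indicator_of_mem hx, inv_mul_cancel₀, one_smul]
        exact_mod_cast (hpos x).ne'
      · rw [Set.indicator_of_notMem hx, Set.indicator_of_notMem hx, zero_mul, zero_smul]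
    have h3 := (T.continuous.tendsto _).comp hlim
    have h4 : (T ∘ fun n => indicatorConstLp 2 (ht n) (hμt n) k) = fun _ => 0 := funext hz
    rw [h4] at h3
    exact tendsto_nhds_unique h3 tendsto_const_nhds
  ext1 ξ
  refine Lp.induction (p := 2) (by norm_num) (fun ξ => T ξ = 0) (fun k s hs hμs => ?_)
    (fun f g hf hg _ h1 h2 => ?_) (isClosed_eq T.continuous continuous_const) ξ
  · exact hind k hs hμs.ne
  · rw [map_add, h1, h2, add_zero]

end VectorValued

/-- The square root of a positive function of integral less than 1. Strict positivity makes the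
slice along g faithful; the bound by 1 fixes the scale in `ae_exists_forall_lt`. -/
theorem exists_pos_memLp_two {X : Type*} [MeasurableSpace X] (μ : Measure X) [SigmaFinite μ] :
    ∃ (g₀ : X → ℝ) (g : Lp ℂ 2 μ), Measurable g₀ ∧ (∀ x, 0 < g₀ x) ∧ (∀ᵐ x ∂μ, g x = g₀ x) ∧
      Integrable (fun x => g₀ x ^ 2) μ ∧ ∫ x, g₀ x ^ 2 ∂μ ≤ 1 := by
  obtain ⟨h, hpos, hm, hlt⟩ := exists_pos_lintegral_lt_of_sigmaFinite μ one_ne_zero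
  have hsq : ∀ x, √(h x : ℝ) ^ 2 = h x := fun x => Real.sq_sqrt (h x).2
  have hmeas : Measurable fun x => √(h x : ℝ) := (measurable_coe_nnreal_real.comp hm).sqrt
  have hint : Integrable (fun x => √(h x : ℝ) ^ 2) μ := by
    simp only [hsq]
    refine ⟨(measurable_coe_nnreal_real.comp hm).aestronglyMeasurable, ?_⟩
    simpa [hasFiniteIntegral_iff_enorm] using hlt.trans ENNReal.one_lt_top
  have hmem : MemLp (fun x => ((√(h x : ℝ) : ℝ) : ℂ)) 2 μ := by
    refine (memLp_two_iff_integrable_sq_norm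
      (Complex.measurable_ofReal.comp hmeas).aestronglyMeasurable).2 ?_
    simpa [abs_of_nonneg (Real.sqrt_nonneg _)] using hint
  refine ⟨fun x => √(h x : ℝ), hmem.toLp _, hmeas, fun x => Real.sqrt_pos.2 (hpos x),
    hmem.coeFn_toLp, hint, ?_⟩
  simp only [hsq]
  refine (integral_eq_lintegral_of_nonneg_ae (Eventually.of_forall fun x => (h x).2)
    (measurable_coe_nnreal_real.comp hm).aestronglyMeasurable).trans_le ?_
  refine ENNReal.toReal_le_of_le_ofReal zero_le_one ?_
  simpa using hlt.le

/-! ### Gluing along diagonal projections and pointwise absolute continuity. -/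

section Gluing

variable {K : Type*} [NormedAddCommGroup K] [InnerProductSpace ℂ K] [CompleteSpace K]
  {X : Type*} [MeasurableSpace X] {μ : Measure X} {Q : VonNeumannAlgebra K}
  {α β : (linftyTensor μ Q).toStarSubalgebra →ₗ[ℂ] ℂ}

theorem cutoff_mul_add_cutoff_mul_le_one {Z : Set X} (hZ : MeasurableSet Z)
    {a b : (linftyTensor μ Q).toStarSubalgebra} (ha : (a : Lp K 2 μ →L[ℂ] Lp K 2 μ) ≤ 1)
    (hb : (b : Lp K 2 μ →L[ℂ] Lp K 2 μ) ≤ 1) :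
    ((cutoff μ Q Z * a + cutoff μ Q Zᶜ * b : (linftyTensor μ Q).toStarSubalgebra) :
      Lp K 2 μ →L[ℂ] Lp K 2 μ) ≤ 1 := by
  have h1 := add_le_add (cutoff_mul_le hZ ha) (cutoff_mul_le hZ.compl hb)
  have h2 : (cutoff μ Q Z : Lp K 2 μ →L[ℂ] Lp K 2 μ) + (cutoff μ Q Zᶜ : Lp K 2 μ →L[ℂ] Lp K 2 μ) = 1 :=
    congrArg Subtype.val (cutoff_add_compl hZ)
  rw [h2] at h1
  exact h1

theorem cutoff_mul_glue {Z V : Set X} (hZ : MeasurableSet Z) (hV : MeasurableSet V)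
    (a b : (linftyTensor μ Q).toStarSubalgebra) :
    cutoff μ Q Z * (cutoff μ Q V * a + cutoff μ Q Vᶜ * b) =
      cutoff μ Q (Z ∩ V) * a + cutoff μ Q (Z ∩ Vᶜ) * b := by
  rw [mul_add, ← mul_assoc, ← mul_assoc, cutoff_mul hZ hV, cutoff_mul hZ hV.compl]

/-- The diagonal projections are central, so different elements may be used over different parts of
X without leaving the positive unit ball. Choosing over each point the element with the largest
density realizes the maximum of u 0, …, u n as one density, while the bound on α, being additive in
Z, is kept. -/
theorem exists_glue {e : ℕ → (linftyTensor μ Q).toStarSubalgebra} {u : ℕ → X → ℝ} {G : X → ℝ}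
    (he0 : ∀ i, (0 : Lp K 2 μ →L[ℂ] Lp K 2 μ) ≤ e i)
    (he1 : ∀ i, (e i : Lp K 2 μ →L[ℂ] Lp K 2 μ) ≤ 1)
    (hu : ∀ i, Measurable (u i)) (hui : ∀ i, Integrable (u i) μ) (hG : Integrable G μ)
    (hα : ∀ i Z, MeasurableSet Z → (α (cutoff μ Q Z * e i)).re ≤ ∫ x in Z, G x ∂μ)
    (hβ : ∀ i Z, MeasurableSet Z → (β (cutoff μ Q Z * e i)).re = ∫ x in Z, u i x ∂μ) (n : ℕ) :
    ∃ E : (linftyTensor μ Q).toStarSubalgebra, (0 : Lp K 2 μ →L[ℂ] Lp K 2 μ) ≤ E ∧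
      (E : Lp K 2 μ →L[ℂ] Lp K 2 μ) ≤ 1 ∧
      (∀ Z, MeasurableSet Z → (α (cutoff μ Q Z * E)).re ≤ ∫ x in Z, G x ∂μ) ∧
      Measurable (partialSups u n) ∧ Integrable (partialSups u n) μ ∧
      ∀ Z, MeasurableSet Z → (β (cutoff μ Q Z * E)).re = ∫ x in Z, partialSups u n x ∂μ := by
  induction n with
  | zero => exact ⟨e 0, he0 0, he1 0, hα 0, by simpa using hu 0, by simpa using hui 0,
      by simpa using hβ 0⟩
  | succ n ih =>
    obtain ⟨E, hE0, hE1, hEα, hm, hi, hEβ⟩ := ih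
    rw [show partialSups u (n + 1) = partialSups u n ⊔ u (n + 1) from partialSups_succ u n]
    let V : Set X := {x | u (n + 1) x ≤ partialSups u n x}
    have hV : MeasurableSet V := measurableSet_le (hu _) hm
    refine ⟨cutoff μ Q V * E + cutoff μ Q Vᶜ * e (n + 1),
      add_nonneg (cutoff_mul_nonneg hV hE0) (cutoff_mul_nonneg hV.compl (he0 _)),
      cutoff_mul_add_cutoff_mul_le_one hV hE1 (he1 _), fun Z hZ => ?_, hm.sup (hu _),
      hi.sup (hui _), fun Z hZ => ?_⟩
    · rw [cutoff_mul_glue hZ hV, map_add, Complex.add_re, ← integral_inter_add_sdiff hV hG.integrableOn]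
      exact add_le_add (hEα _ (hZ.inter hV)) (hα _ _ (hZ.inter hV.compl))
    · rw [cutoff_mul_glue hZ hV, map_add, Complex.add_re, hEβ _ (hZ.inter hV),
        hβ _ _ (hZ.inter hV.compl), ← integral_inter_add_sdiff hV (hi.sup (hui _)).integrableOn]
      congr 1
      · refine setIntegral_congr_fun (hZ.inter hV) fun x hx => ?_
        exact (sup_eq_left.2 (show u (n + 1) x ≤ partialSups u n x from hx.2)).symm
      · refine setIntegral_congr_fun (hZ.inter hV.compl) fun x hx => ?_
        exact (sup_eq_right.2 (not_le.1 (show ¬u (n + 1) x ≤ partialSups u n x from hx.2)).le).symm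

/-- Absolute continuity of `β` with respect to `α` bounds almost everywhere the densities of the
functionals `Z ↦ β(1_Z e)`. -/
theorem ae_exists_forall_lt
    (hac : ∀ ε > 0, ∃ δ > 0, ∀ e : (linftyTensor μ Q).toStarSubalgebra,
      (0 : Lp K 2 μ →L[ℂ] Lp K 2 μ) ≤ e → (e : Lp K 2 μ →L[ℂ] Lp K 2 μ) ≤ 1 →
      (α e).re < δ → (β e).re < ε)
    {G : X → ℝ} (hG : Integrable G μ) (hG1 : ∫ x, G x ∂μ ≤ 1)
    {e : ℝ → ℕ → (linftyTensor μ Q).toStarSubalgebra} {u : ℝ → ℕ → X → ℝ}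
    (he0 : ∀ δ i, (0 : Lp K 2 μ →L[ℂ] Lp K 2 μ) ≤ e δ i)
    (he1 : ∀ δ i, (e δ i : Lp K 2 μ →L[ℂ] Lp K 2 μ) ≤ 1)
    (hu : ∀ δ i, Measurable (u δ i)) (hui : ∀ δ i, Integrable (u δ i) μ)
    (hu0 : ∀ δ i, ∀ᵐ x ∂μ, 0 ≤ u δ i x)
    (hα : ∀ δ > 0, ∀ i Z, MeasurableSet Z →
      (α (cutoff μ Q Z * e δ i)).re ≤ ∫ x in Z, δ * G x ∂μ)
    (hβ : ∀ δ i Z, MeasurableSet Z →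
      (β (cutoff μ Q Z * e δ i)).re = ∫ x in Z, u δ i x ∂μ) :
    ∀ᵐ x ∂μ, ∀ η > 0, ∃ δ > 0, ∀ i, u δ i x < η := by
  have hkey : ∀ j : ℕ, ∃ δ > 0, ∫⁻ x, ⨆ i, ENNReal.ofReal (u δ i x) ∂μ ≤
      ENNReal.ofReal (1 / ((j : ℝ) + 1)) := by
    intro j
    obtain ⟨δ, hδ, hδe⟩ := hac (1 / ((j : ℝ) + 1)) (by positivity)
    -- With ∫ G ≤ 1 the glued element has α at most δ/2, strictly below the threshold δ.
    refine ⟨δ / 2, by positivity, ?_⟩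
    have h1 : ∀ x, ⨆ i, ENNReal.ofReal (u (δ / 2) i x) =
        ⨆ n, ENNReal.ofReal (partialSups (u (δ / 2)) n x) := by
      intro x
      refine le_antisymm (iSup_mono fun i => ENNReal.ofReal_le_ofReal ?_) (iSup_le fun n => ?_)
      · exact le_partialSups (u (δ / 2)) i x
      · have h2 : ENNReal.ofReal (partialSups (u (δ / 2)) n x) ≤
            ⨆ i, ENNReal.ofReal (u (δ / 2) i x) := by
          induction n with
          | zero => simpa using le_iSup (fun i => ENNReal.ofReal (u (δ / 2) i x)) 0
          | succ n ih =>
            rw [show partialSups (u (δ / 2)) (n + 1) = partialSups (u (δ / 2)) n ⊔ u (δ / 2) (n + 1)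
              from partialSups_succ _ n, Pi.sup_apply, (ENNReal.ofReal_mono).map_sup]
            exact sup_le ih (le_iSup (fun i => ENNReal.ofReal (u (δ / 2) i x)) (n + 1))
        exact h2
    simp only [h1]
    have hglue := exists_glue (he0 (δ / 2)) (he1 (δ / 2)) (hu (δ / 2)) (hui (δ / 2))
      (hG.const_mul (δ / 2)) (hα (δ / 2) (by positivity)) (hβ (δ / 2))
    -- Monotone convergence reduces the supremum over all i to the finite maxima, each the density
    -- of one glued element.
    rw [lintegral_iSup]
    · refine iSup_le fun n => ?_
      obtain ⟨E, hE0, hE1, hEα, hm, hi, hEβ⟩ := hglue n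
      have hα1 := hEα _ MeasurableSet.univ
      have hβ1 := hEβ _ MeasurableSet.univ
      rw [cutoff_univ, one_mul, setIntegral_univ] at hα1 hβ1
      rw [integral_const_mul] at hα1
      have h3 := hδe E hE0 hE1 (by nlinarith)
      rw [hβ1] at h3
      rw [← ofReal_integral_eq_lintegral_ofReal hi]
      · exact ENNReal.ofReal_le_ofReal h3.le
      · filter_upwards [hu0 (δ / 2) 0] with x hx
        exact hx.trans (le_partialSups_of_le (u (δ / 2)) (Nat.zero_le n) x)
    · intro n
      obtain ⟨E, hE0, hE1, hEα, hm, -⟩ := hglue n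
      exact hm.ennreal_ofReal
    · exact fun n m hnm x => ENNReal.ofReal_le_ofReal ((partialSups (u (δ / 2))).mono hnm x)
  choose δ hδ hδj using hkey
  have hmeas : ∀ j, Measurable fun x => ⨆ i, ENNReal.ofReal (u (δ j) i x) := fun j =>
    Measurable.iSup fun i => (hu _ i).ennreal_ofReal
  -- The infimum over j has integral at most 1/(j+1) for every j, so it vanishes almost everywhere;
  -- this selects, at each x, a scale δ j with uniformly small densities.
  have hzero : ∫⁻ x, ⨅ j, ⨆ i, ENNReal.ofReal (u (δ j) i x) ∂μ = 0 := by
    have h1 : Tendsto (fun j : ℕ => ENNReal.ofReal (1 / ((j : ℝ) + 1))) atTop (𝓝 0) := by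
      have := ENNReal.tendsto_ofReal tendsto_one_div_add_atTop_nhds_zero_nat
      simpa using this
    refine le_antisymm (ge_of_tendsto' h1 fun j => ?_) zero_le
    exact (lintegral_mono fun x => iInf_le _ j).trans (hδj j)
  rw [lintegral_eq_zero_iff (Measurable.iInf hmeas)] at hzero
  filter_upwards [hzero] with x hx η hη
  have h1 : ⨅ j, ⨆ i, ENNReal.ofReal (u (δ j) i x) < ENNReal.ofReal η := by
    rw [show (⨅ j, ⨆ i, ENNReal.ofReal (u (δ j) i x)) = 0 from hx]
    exact ENNReal.ofReal_pos.2 hη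
  obtain ⟨j, hj⟩ := iInf_lt_iff.1 h1
  refine ⟨δ j, hδ j, fun i => ?_⟩
  have h2 := (le_iSup (fun i => ENNReal.ofReal (u (δ j) i x)) i).trans_lt hj
  exact (ENNReal.ofReal_lt_ofReal_iff hη).1 h2

end Gluing

section Scaled

variable {L : Type*} [NormedAddCommGroup L] [InnerProductSpace ℂ L] [CompleteSpace L]

theorem scaled_star_mul_self_nonneg (t : L →L[ℂ] L) {c : ℝ} (hc : 0 ≤ c) :
    0 ≤ (c : ℂ) • (star t * t) := by
  rw [Complex.coe_smul]
  exact smul_nonneg hc (star_mul_self_nonneg t)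

theorem scaled_star_mul_self_le_one {t : L →L[ℂ] L} {N : ℝ} (hN : 0 < N) (ht : ‖t‖ ≤ N) :
    (((N ^ 2)⁻¹ : ℝ) : ℂ) • (star t * t) ≤ 1 := by
  refine (CStarAlgebra.norm_le_one_iff_of_nonneg _
    (scaled_star_mul_self_nonneg t (by positivity))).1 ?_
  rw [norm_smul, Complex.norm_real, Real.norm_of_nonneg (by positivity),
    inv_mul_le_iff₀ (by positivity), mul_one]
  refine (norm_mul_le _ _).trans ?_
  rw [norm_star, sq]
  gcongr

end Scaled

section ScaledTensor

variable {K : Type*} [NormedAddCommGroup K] [InnerProductSpace ℂ K] [CompleteSpace K]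
  {X : Type*} [MeasurableSpace X] {μ : Measure X}

/-- The element `N⁻² (1 ⊗ q*q)` of `L^∞(X, μ) ⊗̄ Q`. -/
noncomputable def scaledSquare (μ : Measure X) (N : ℝ) {Q : VonNeumannAlgebra K} (q : K →L[ℂ] K)
    (hq : q ∈ Q) : (linftyTensor μ Q).toStarSubalgebra :=
  (((N ^ 2)⁻¹ : ℝ) : ℂ) • ⟨(star q * q).compLpL 2 μ, compLpL_mem (mul_mem (star_mem hq) hq)⟩

theorem coe_scaledSquare (N : ℝ) {Q : VonNeumannAlgebra K} (q : K →L[ℂ] K) (hq : q ∈ Q) :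
    (scaledSquare μ N q hq : Lp K 2 μ →L[ℂ] Lp K 2 μ) =
      (((N ^ 2)⁻¹ : ℝ) : ℂ) • (star (q.compLpL 2 μ) * q.compLpL 2 μ) := by
  rw [star_compLpL, ← compLpL_mul]
  rfl

theorem scaledSquare_nonneg (N : ℝ) {Q : VonNeumannAlgebra K} (q : K →L[ℂ] K) (hq : q ∈ Q) :
    (0 : Lp K 2 μ →L[ℂ] Lp K 2 μ) ≤ scaledSquare μ N q hq := by
  rw [coe_scaledSquare]
  exact scaled_star_mul_self_nonneg _ (by positivity)

theorem scaledSquare_le_one {N : ℝ} (hN : 0 < N) {Q : VonNeumannAlgebra K} (q : K →L[ℂ] K)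
    (hq : q ∈ Q) (hqN : ‖q‖ ≤ N) :
    (scaledSquare μ N q hq : Lp K 2 μ →L[ℂ] Lp K 2 μ) ≤ 1 := by
  rw [coe_scaledSquare]
  exact scaled_star_mul_self_le_one hN ((ContinuousLinearMap.norm_compLpL_le q).trans hqN)

end ScaledTensor

/-! ### The transported trace and the slice functional on L^∞(X, μ) ⊗̄ Q. -/

namespace MeasurableHilbertField

variable {X : Type u} [MeasurableSpace X] {μ : Measure X} {H : X → Type v}
  [∀ x, NormedAddCommGroup (H x)] [∀ x, InnerProductSpace ℂ (H x)] [∀ x, CompleteSpace (H x)]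
  {F : MeasurableHilbertField μ H} {M P : ∀ x, VonNeumannAlgebra (H x)}

/-- The direct integral of a field of von Neumann algebras is closed under strong limits of bounded
sequences. -/
theorem mem_integralAlgebra_of_strong_limit [SigmaFinite μ]
    (T : ℕ → F.DirectIntegral →L[ℂ] F.DirectIntegral) (S : F.DirectIntegral →L[ℂ] F.DirectIntegral)
    (hT : ∀ k, T k ∈ F.integralAlgebra P) (hC : ∃ C, ∀ k, ‖T k‖ ≤ C)
    (hS : ∀ v, Tendsto (fun k => T k v) atTop (𝓝 (S v))) : S ∈ F.integralAlgebra P := by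
  obtain ⟨η, -, hη⟩ := F.exists_vectors_subseq_limit
  choose t ht htP using hT
  obtain ⟨φ, hφ, S', s, hS', hs, hlim⟩ := hη T t ht hC fun n => (hS (η n)).cauchySeq
  have h1 : S' = S := by
    ext1 v
    exact tendsto_nhds_unique (hlim v) ((hS v).comp hφ.tendsto_atTop)
  refine ⟨s, h1 ▸ hS', ?_⟩
  filter_upwards [hs, ae_all_iff.2 htP] with x h2 h3
  exact (P x).mem_of_strong_limit (fun k => h3 (φ k)) h2

/-- The trace transported along an isomorphism onto a subalgebra. -/
noncomputable def pullbackTrace {L : Type*} [NormedAddCommGroup L] [InnerProductSpace ℂ L]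
    [CompleteSpace L] {A : StarSubalgebra ℂ (L →L[ℂ] L)} (τ : F.integralAlgebra M →ₗ[ℂ] ℂ)
    (hPM : F.integralAlgebra P ≤ F.integralAlgebra M) (θ : A ≃⋆ₐ[ℂ] F.integralAlgebra P) :
    A →ₗ[ℂ] ℂ where
  toFun a := τ ⟨θ a, hPM (θ a).2⟩
  map_add' a b := by
    rw [← map_add]
    congr 1
    apply Subtype.ext
    simp
  map_smul' c a := by
    rw [RingHom.id_apply, ← map_smul]
    congr 1
    apply Subtype.ext
    simp

variable [SigmaFinite μ] {τf : ∀ x, (M x).toStarSubalgebra →ₗ[ℂ] ℂ}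
  {τ : F.integralAlgebra M →ₗ[ℂ] ℂ} {w : X → ℝ}

/-- Since θ(z) is the diagonal projection of Z, the transported trace restricted to Z is an integral
over Z; this identifies the density w τ_x(T_x*T_x) used in the gluing argument. -/
theorem IsIntegralTrace.pullbackTrace_indicator_mul {L : Type*} [NormedAddCommGroup L]
    [InnerProductSpace ℂ L] [CompleteSpace L] {A : StarSubalgebra ℂ (L →L[ℂ] L)}
    (hτ : F.IsIntegralTrace w τ τf) (hPM : F.integralAlgebra P ≤ F.integralAlgebra M)
    (θ : A ≃⋆ₐ[ℂ] F.integralAlgebra P) {Z : Set X} (hZ : MeasurableSet Z) {z a : A}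
    (hz : F.IsIntegralOf (θ z : F.DirectIntegral →L[ℂ] F.DirectIntegral)
      (fun x => Z.indicator (fun _ => (1 : ℂ)) x • ContinuousLinearMap.id ℂ (H x)))
    (T : F.integralAlgebra M)
    (ha : (θ a : F.DirectIntegral →L[ℂ] F.DirectIntegral) = (star T * T : F.integralAlgebra M)) :
    (pullbackTrace τ hPM θ (z * a)).re = ∫ x in Z, w x * traceSq (τf x) (fiber T x) ∂μ := by
  have h1 : pullbackTrace τ hPM θ (z * a) = τ (⟨θ z, hPM (θ z).2⟩ * (star T * T)) := by
    change τ _ = τ _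
    congr 1
    apply Subtype.ext
    change (θ (z * a) : F.DirectIntegral →L[ℂ] F.DirectIntegral) =
      θ z * ((star T * T : F.integralAlgebra M) : F.DirectIntegral →L[ℂ] F.DirectIntegral)
    rw [map_mul, ← ha]
    rfl
  have h2 := (hτ _ _ (isIntegralOf_fiber (star T * T))).1
  rw [h1, hτ.apply_indicator_mul hZ hz]
  refine (integral_re h2.integrableOn).symm.trans (integral_congr_ae (ae_restrict_of_ae ?_))
  filter_upwards [fiber_mul (star T) T, fiber_star T] with x h3 h4
  rw [h3, h4]
  simp [traceSq]

end MeasurableHilbertField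

theorem re_apply_mul_smul {A : Type*} [Ring A] [Algebra ℂ A] (α : A →ₗ[ℂ] ℂ) (z a : A) (c : ℝ) :
    (α (z * ((c : ℂ) • a))).re = c * (α (z * a)).re := by
  rw [mul_smul_comm, map_smul, smul_eq_mul, Complex.re_ofReal_mul]

namespace MeasurableHilbertField

variable {X : Type u} [MeasurableSpace X] {μ : Measure X} {H : X → Type v}
  [∀ x, NormedAddCommGroup (H x)] [∀ x, InnerProductSpace ℂ (H x)] [∀ x, CompleteSpace (H x)]
  {F : MeasurableHilbertField μ H} {M P : ∀ x, VonNeumannAlgebra (H x)}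
  [SigmaFinite μ] {τf : ∀ x, (M x).toStarSubalgebra →ₗ[ℂ] ℂ}
  {τ : F.integralAlgebra M →ₗ[ℂ] ℂ} {w : X → ℝ} {Q : VonNeumannAlgebra F.DirectIntegral}

omit [SigmaFinite μ] in
theorem pullbackTrace_faithful {L : Type*} [NormedAddCommGroup L] [InnerProductSpace ℂ L]
    [CompleteSpace L] {A : VonNeumannAlgebra L} (hN : IsNormalTracial τ)
    (hPM : F.integralAlgebra P ≤ F.integralAlgebra M)
    (θ : A.toStarSubalgebra ≃⋆ₐ[ℂ] F.integralAlgebra P) (a : A.toStarSubalgebra)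
    (ha : (0 : L →L[ℂ] L) ≤ a) (ha0 : (pullbackTrace τ hPM θ a).re = 0) : a = 0 := by
  obtain ⟨s, hs⟩ := VonNeumannAlgebra.exists_star_mul_self_eq ha
  have h3 : traceSq τ ⟨θ s, hPM (θ s).2⟩ = 0 := by
    rw [← ha0, ← hs]
    change (τ _).re = (τ _).re
    congr 2
    apply Subtype.ext
    change star (θ s : F.DirectIntegral →L[ℂ] F.DirectIntegral) * θ s =
      (θ (star s * s) : F.DirectIntegral →L[ℂ] F.DirectIntegral)
    rw [map_mul, show θ (star s) = star (θ s) from θ.map_star' s]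
    rfl
  have h4 : (θ s : F.DirectIntegral →L[ℂ] F.DirectIntegral) = 0 :=
    congrArg Subtype.val (hN.faithful _ h3)
  have h5 : s = 0 := θ.injective (by rw [map_zero]; exact Subtype.ext h4)
  rw [← hs, h5, mul_zero]

/-- The defining property of the isomorphism in `IsLinftyTensor`. -/
def IsTensorIso (θ : (linftyTensor μ Q).toStarSubalgebra ≃⋆ₐ[ℂ] F.integralAlgebra P) : Prop :=
  (∀ (f : Lp ℂ ∞ μ) (S : (linftyTensor μ Q).toStarSubalgebra),
    (S : Lp F.DirectIntegral 2 μ →L[ℂ] Lp F.DirectIntegral 2 μ) =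
        (ContinuousLinearMap.lsmul ℂ ℂ).holderL μ ∞ 2 2 f →
      F.IsIntegralOf (θ S : F.DirectIntegral →L[ℂ] F.DirectIntegral)
        (fun x => f x • ContinuousLinearMap.id ℂ (H x))) ∧
  ∀ q ∈ Q, ∀ S : (linftyTensor μ Q).toStarSubalgebra,
    (S : Lp F.DirectIntegral 2 μ →L[ℂ] Lp F.DirectIntegral 2 μ) = q.compLpL 2 μ →
      (θ S : F.DirectIntegral →L[ℂ] F.DirectIntegral) = q

variable {θ : (linftyTensor μ Q).toStarSubalgebra ≃⋆ₐ[ℂ] F.integralAlgebra P}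

omit [SigmaFinite μ] in
theorem IsTensorIso.mem (hθ : IsTensorIso θ) {q : F.DirectIntegral →L[ℂ] F.DirectIntegral}
    (hq : q ∈ Q) : q ∈ F.integralAlgebra P := by
  rw [← hθ.2 q hq ⟨_, compLpL_mem hq⟩ rfl]
  exact (θ _).2

omit [SigmaFinite μ] in
theorem IsTensorIso.isIntegralOf_cutoff (hθ : IsTensorIso θ) {Z : Set X} (hZ : MeasurableSet Z) :
    F.IsIntegralOf (θ (cutoff μ Q Z) : F.DirectIntegral →L[ℂ] F.DirectIntegral)
      (fun x => Z.indicator (fun _ => (1 : ℂ)) x • ContinuousLinearMap.id ℂ (H x)) := by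
  refine (hθ.1 (linftyIndicator μ Z) (cutoff μ Q Z) rfl).congr ?_
  filter_upwards [coeFn_linftyIndicator (μ := μ) hZ] with x hx
  rw [hx]

theorem IsTensorIso.pullbackTrace_cutoff_mul (hθ : IsTensorIso θ)
    (hτ : F.IsIntegralTrace w τ τf) (hPM : F.integralAlgebra P ≤ F.integralAlgebra M)
    {Z : Set X} (hZ : MeasurableSet Z) {T : F.integralAlgebra M}
    (hT : (T : F.DirectIntegral →L[ℂ] F.DirectIntegral) ∈ Q) (N : ℝ) :
    (pullbackTrace τ hPM θ (cutoff μ Q Z * scaledSquare μ N _ hT)).re =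
      ∫ x in Z, (N ^ 2)⁻¹ * (w x * traceSq (τf x) (fiber T x)) ∂μ := by
  let a : (linftyTensor μ Q).toStarSubalgebra := ⟨_, compLpL_mem (mul_mem (star_mem hT) hT)⟩
  have ha : (θ a : F.DirectIntegral →L[ℂ] F.DirectIntegral) = (star T * T : F.integralAlgebra M) :=
    hθ.2 _ (mul_mem (star_mem hT) hT) a rfl
  have h := hτ.pullbackTrace_indicator_mul hPM θ hZ (hθ.isIntegralOf_cutoff hZ) T ha
  have h2 := re_apply_mul_smul (pullbackTrace τ hPM θ) (cutoff μ Q Z) a (N ^ 2)⁻¹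
  exact h2.trans ((congrArg (fun r => (N ^ 2)⁻¹ * r) h).trans (integral_const_mul _ _).symm)

omit [SigmaFinite μ] in
-- The slice of 1_Z ⊗ q is (∫_Z |g|²) q, so the slice functional has a density of product form, in
-- which the 2-norm of T in the direct integral appears as a constant factor.
theorem sliceFunctional_cutoff_mul (g : Lp ℂ 2 μ) (hQM : Q.toStarSubalgebra ≤ F.integralAlgebra M)
    {Z : Set X} (hZ : MeasurableSet Z) {T : F.integralAlgebra M}
    (hT : (T : F.DirectIntegral →L[ℂ] F.DirectIntegral) ∈ Q) (N : ℝ) :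
    (sliceFunctional (A := linftyTensor μ Q) τ (tensorLeft F.DirectIntegral g)
      (fun S hS => hQM (slice_mem g S hS)) (cutoff μ Q Z * scaledSquare μ N _ hT)).re =
      (N ^ 2)⁻¹ * traceSq τ T * ∫ x in Z, ‖g x‖ ^ 2 ∂μ := by
  have h1 : sliceFunctional (A := linftyTensor μ Q) τ (tensorLeft F.DirectIntegral g)
      (fun S hS => hQM (slice_mem g S hS))
      (cutoff μ Q Z * ⟨_, compLpL_mem (mul_mem (star_mem hT) hT)⟩) =
      τ (((∫ x in Z, ‖g x‖ ^ 2 ∂μ : ℝ) : ℂ) • (star T * T)) := by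
    change τ _ = τ _
    congr 1
    exact Subtype.ext (slice_cutoff_mul (Q := Q) hZ g (star _ * _))
  rw [scaledSquare, re_apply_mul_smul, h1, map_smul, smul_eq_mul, Complex.re_ofReal_mul, traceSq]
  ring

/-- The two functionals on `L^∞(X, μ) ⊗̄ Q` given by the trace of the direct integral and by the
slices along a positive square-integrable function are absolutely continuous with respect to each
other. -/
theorem absolutelyContinuous_pullbackTrace_sliceFunctional
    (θ : (linftyTensor μ Q).toStarSubalgebra ≃⋆ₐ[ℂ] F.integralAlgebra P)
    (hN : IsNormalTracial τ) (hPM : F.integralAlgebra P ≤ F.integralAlgebra M)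
    (hQM : Q.toStarSubalgebra ≤ F.integralAlgebra M)
    {g₀ : X → ℝ} {g : Lp ℂ 2 μ} (hg₀ : Measurable g₀) (hpos : ∀ x, 0 < g₀ x)
    (hg : ∀ᵐ x ∂μ, g x = g₀ x) :
    (∀ ε > 0, ∃ δ > 0, ∀ e : (linftyTensor μ Q).toStarSubalgebra,
      (0 : Lp F.DirectIntegral 2 μ →L[ℂ] Lp F.DirectIntegral 2 μ) ≤ e →
      (e : Lp F.DirectIntegral 2 μ →L[ℂ] Lp F.DirectIntegral 2 μ) ≤ 1 →
      (sliceFunctional (A := linftyTensor μ Q) τ (tensorLeft F.DirectIntegral g)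
        (fun S hS => hQM (slice_mem g S hS)) e).re < δ → (pullbackTrace τ hPM θ e).re < ε) ∧
    (∀ ε > 0, ∃ δ > 0, ∀ e : (linftyTensor μ Q).toStarSubalgebra,
      (0 : Lp F.DirectIntegral 2 μ →L[ℂ] Lp F.DirectIntegral 2 μ) ≤ e →
      (e : Lp F.DirectIntegral 2 μ →L[ℂ] Lp F.DirectIntegral 2 μ) ≤ 1 →
      (pullbackTrace τ hPM θ e).re < δ →
      (sliceFunctional (A := linftyTensor μ Q) τ (tensorLeft F.DirectIntegral g)
        (fun S hS => hQM (slice_mem g S hS)) e).re < ε) := by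
  have h1 := isNormalPositive_sliceFunctional (A := linftyTensor μ Q) hN hQM (slice_mem g)
  have h2 : IsNormalPositive (pullbackTrace τ hPM θ) :=
    hN.isNormalPositive_of_equiv hPM mem_integralAlgebra_of_strong_limit θ fun _ => rfl
  -- Both functionals are normal, so only faithfulness of the dominating one is left: totality of
  -- the vectors f g ⊗ k for the slice, injectivity of θ for the transported trace.
  refine ⟨fun ε hε => h1.exists_forall_lt h2 (fun a ha ha0 => ?_) hε,
    fun ε hε => h2.exists_forall_lt h1 (fun a ha ha0 => ?_) hε⟩
  · exact Subtype.ext (eq_zero_of_forall_tensorLeft hg₀ hpos hg a.2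
      (apply_eq_zero_of_sliceFunctional hN hQM (slice_mem g) ha ha0))
  · exact pullbackTrace_faithful hN hPM θ a ha ha0

end MeasurableHilbertField

theorem cutoff_mul_cutoff_mul {K : Type*} [NormedAddCommGroup K] [InnerProductSpace ℂ K]
    [CompleteSpace K] {X : Type*} [MeasurableSpace X] {μ : Measure X} {Q : VonNeumannAlgebra K}
    {Z W : Set X} (hZ : MeasurableSet Z) (hW : MeasurableSet W)
    (a : (linftyTensor μ Q).toStarSubalgebra) :
    cutoff μ Q Z * (cutoff μ Q W * a) = cutoff μ Q (Z ∩ W) * a := by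
  rw [← mul_assoc, cutoff_mul hZ hW]

/-! ### Comparison of the 2-norm on Q with the 2-norms of the fibers. -/

namespace MeasurableHilbertField

variable {X : Type u} [MeasurableSpace X] {μ : Measure X} {H : X → Type v}
  [∀ x, NormedAddCommGroup (H x)] [∀ x, InnerProductSpace ℂ (H x)] [∀ x, CompleteSpace (H x)]
  {F : MeasurableHilbertField μ H} {M P : ∀ x, VonNeumannAlgebra (H x)}
  [SigmaFinite μ] {τf : ∀ x, (M x).toStarSubalgebra →ₗ[ℂ] ℂ}
  {τ : F.integralAlgebra M →ₗ[ℂ] ℂ} {w : X → ℝ} {Q : VonNeumannAlgebra F.DirectIntegral}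
  {θ : (linftyTensor μ Q).toStarSubalgebra ≃⋆ₐ[ℂ] F.integralAlgebra P}

omit [SigmaFinite μ] in
theorem cutoff_le_one {Z : Set X} (hZ : MeasurableSet Z) :
    (cutoff μ Q Z : Lp F.DirectIntegral 2 μ →L[ℂ] Lp F.DirectIntegral 2 μ) ≤ 1 := by
  have h1 : (cutoff μ Q Z : Lp F.DirectIntegral 2 μ →L[ℂ] Lp F.DirectIntegral 2 μ) +
      (cutoff μ Q Zᶜ : Lp F.DirectIntegral 2 μ →L[ℂ] Lp F.DirectIntegral 2 μ) = 1 :=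
    congrArg Subtype.val (cutoff_add_compl hZ)
  have h2 := linftyIndicator_mul_nonneg (μ := μ) (Q := Q) hZ.compl (one_mem _) zero_le_one
  rw [mul_one] at h2
  rw [← h1]
  exact le_add_of_nonneg_right h2

omit [SigmaFinite μ] in
theorem re_apply_cutoff_mul_zero (α : (linftyTensor μ Q).toStarSubalgebra →ₗ[ℂ] ℂ) (Z : Set X) :
    (α (cutoff μ Q Z * 0)).re = 0 := by
  have h : cutoff μ Q Z * 0 = 0 := mul_zero _
  rw [h, map_zero, Complex.zero_re]

/-- Small elements of `Q` have small fibers. -/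
theorem IsTensorIso.ae_traceSq_fiber_lt (hθ : IsTensorIso θ) (hτ : F.IsIntegralTrace w τ τf)
    (hτf : ∀ᵐ x ∂μ, IsFaithfulNormalTrace (τf x)) (hw : ∀ᵐ x ∂μ, 0 < w x)
    (hPM : F.integralAlgebra P ≤ F.integralAlgebra M)
    (hQM : Q.toStarSubalgebra ≤ F.integralAlgebra M) {T : ℕ → F.integralAlgebra M}
    (hT : ∀ i, (T i : F.DirectIntegral →L[ℂ] F.DirectIntegral) ∈ Q) {N : ℝ} (hN : 0 < N) :
    ∀ᵐ x ∂μ, ∀ ε > 0, ∃ δ > 0, ∀ i, ‖T i‖ ≤ N → traceSq τ (T i) < δ →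
      traceSq (τf x) (fiber (T i) x) < ε := by
  classical
  have hNT := hτ.isNormalTracial hτf hw
  obtain ⟨g₀, g, hg₀, hpos, hg, hint, hint1⟩ := exists_pos_memLp_two μ
  have hac := (absolutelyContinuous_pullbackTrace_sliceFunctional θ hNT hPM hQM hg₀ hpos hg).1
  choose W hWm hW using fun i => (hτ.traceSq_eq (T i)).1.aestronglyMeasurable.aemeasurable
  have hWi : ∀ i, Integrable (W i) μ := fun i => (hτ.traceSq_eq (T i)).1.congr (hW i)
  have hsq : ∀ Z, ∫ x in Z, ‖g x‖ ^ 2 ∂μ = ∫ x in Z, g₀ x ^ 2 ∂μ := fun Z => by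
    refine integral_congr_ae (ae_restrict_of_ae ?_)
    filter_upwards [hg] with x hx
    simp [hx]
  -- The family for a given δ consists of the T i of norm at most N and small 2-norm; the other
  -- indices contribute zero. The slice then has density at most δ g₀², and the transported trace
  -- has density N⁻² w τ_x(T_x*T_x).
  let C : ℝ → ℕ → Prop := fun δ i => ‖T i‖ ≤ N ∧ (N ^ 2)⁻¹ * traceSq τ (T i) ≤ δ
  have key := ae_exists_forall_lt hac hint hint1
    (e := fun δ i => if C δ i then scaledSquare μ N _ (hT i) else 0)
    (u := fun δ i => if C δ i then fun x => (N ^ 2)⁻¹ * W i x else 0)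
    (fun δ i => by
      split_ifs
      · exact scaledSquare_nonneg N _ (hT i)
      · exact le_rfl)
    (fun δ i => by
      split_ifs with h
      · exact scaledSquare_le_one hN _ (hT i) h.1
      · exact zero_le_one)
    (fun δ i => by
      split_ifs
      · exact (hWm i).const_mul _
      · exact measurable_zero)
    (fun δ i => by
      split_ifs
      · exact (hWi i).const_mul _
      · exact integrable_zero _ _ _)
    (fun δ i => by
      split_ifs
      · filter_upwards [hW i, hw, hτf] with x h1 h2 h3
        rw [← h1]
        exact mul_nonneg (by positivity) (mul_nonneg h2.le (h3.isNormalTracial.nonneg _))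
      · exact Eventually.of_forall fun x => le_rfl)
    (fun δ hδ i Z hZ => by
      split_ifs with h
      · rw [sliceFunctional_cutoff_mul g hQM hZ (hT i), hsq, integral_const_mul]
        exact mul_le_mul_of_nonneg_right h.2 (integral_nonneg fun x => by positivity)
      · rw [re_apply_cutoff_mul_zero]
        exact integral_nonneg fun x => by positivity)
    (fun δ i Z hZ => by
      split_ifs with h
      · rw [hθ.pullbackTrace_cutoff_mul hτ hPM hZ (hT i)]
        refine integral_congr_ae (ae_restrict_of_ae ?_)
        filter_upwards [hW i] with x hx
        rw [← hx]
      · rw [re_apply_cutoff_mul_zero]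
        simp)
  filter_upwards [key, ae_all_iff.2 hW, hw] with x h1 h2 h3 ε hε
  obtain ⟨δ, hδ, hδi⟩ := h1 ((N ^ 2)⁻¹ * (w x * ε)) (by positivity)
  refine ⟨N ^ 2 * δ, by positivity, fun i hi hi2 => ?_⟩
  have h4 : C δ i := ⟨hi, by rw [inv_mul_le_iff₀ (by positivity)]; exact hi2.le⟩
  have h5 := hδi i
  rw [if_pos h4, ← h2 i] at h5
  exact lt_of_mul_lt_mul_left (lt_of_mul_lt_mul_left h5 (by positivity)) h3.le

set_option maxHeartbeats 400000 in
/-- Elements of `Q` with small fibers are small. -/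
theorem IsTensorIso.ae_traceSq_lt (hθ : IsTensorIso θ) (hτ : F.IsIntegralTrace w τ τf)
    (hτf : ∀ᵐ x ∂μ, IsFaithfulNormalTrace (τf x)) (hw : ∀ᵐ x ∂μ, 0 < w x)
    (hPM : F.integralAlgebra P ≤ F.integralAlgebra M)
    (hQM : Q.toStarSubalgebra ≤ F.integralAlgebra M) {T : ℕ → F.integralAlgebra M}
    (hT : ∀ i, (T i : F.DirectIntegral →L[ℂ] F.DirectIntegral) ∈ Q) {N : ℝ} (hN : 0 < N) :
    ∀ᵐ x ∂μ, ∀ ε > 0, ∃ δ > 0, ∀ i, ‖T i‖ ≤ N → traceSq (τf x) (fiber (T i) x) < δ →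
      traceSq τ (T i) < ε := by
  classical
  have hNT := hτ.isNormalTracial hτf hw
  obtain ⟨g₀, g, hg₀, hpos, hg, hint, hint1⟩ := exists_pos_memLp_two μ
  have hac := (absolutelyContinuous_pullbackTrace_sliceFunctional θ hNT hPM hQM hg₀ hpos hg).2
  choose W hWm hW using fun i => (hτ.traceSq_eq (T i)).1.aestronglyMeasurable.aemeasurable
  have hWi : ∀ i, Integrable (W i) μ := fun i => (hτ.traceSq_eq (T i)).1.congr (hW i)
  have hsq : ∀ Z, ∫ x in Z, ‖g x‖ ^ 2 ∂μ = ∫ x in Z, g₀ x ^ 2 ∂μ := fun Z => by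
    refine integral_congr_ae (ae_restrict_of_ae ?_)
    filter_upwards [hg] with x hx
    simp [hx]
  -- Here the roles are exchanged, and the density of the transported trace is small only at some
  -- points; the element is cut off to the set where it is at most δ g₀². The density of the slice
  -- at a point of V bounds the constant τ(T*T) itself.
  let V : ℝ → ℕ → Set X := fun δ i => {x | (N ^ 2)⁻¹ * W i x ≤ δ * g₀ x ^ 2}
  have hV : ∀ δ i, MeasurableSet (V δ i) := fun δ i =>
    measurableSet_le ((hWm i).const_mul _) ((hg₀.pow_const 2).const_mul _)
  have key := ae_exists_forall_lt hac hint hint1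
    (e := fun δ i => if ‖T i‖ ≤ N then cutoff μ Q (V δ i) * scaledSquare μ N _ (hT i) else 0)
    (u := fun δ i => if ‖T i‖ ≤ N then
      (V δ i).indicator fun x => (N ^ 2)⁻¹ * traceSq τ (T i) * g₀ x ^ 2 else 0)
    (fun δ i => by
      split_ifs
      · exact cutoff_mul_nonneg (hV δ i) (scaledSquare_nonneg N _ (hT i))
      · exact le_rfl)
    (fun δ i => by
      split_ifs with h
      · exact (cutoff_mul_le (hV δ i) (scaledSquare_le_one (μ := μ) hN _ (hT i) h)).trans
          (cutoff_le_one (hV δ i))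
      · exact zero_le_one)
    (fun δ i => by
      split_ifs
      · exact ((hg₀.pow_const 2).const_mul _).indicator (hV δ i)
      · exact measurable_zero)
    (fun δ i => by
      split_ifs
      · exact (hint.const_mul _).indicator (hV δ i)
      · exact integrable_zero _ _ _)
    (fun δ i => by
      refine Eventually.of_forall fun x => ?_
      split_ifs
      · refine Set.indicator_nonneg (fun x _ => ?_) x
        have := hNT.nonneg (T i)
        positivity
      · exact le_rfl)
    (fun δ hδ i Z hZ => by
      split_ifs with h
      · rw [cutoff_mul_cutoff_mul hZ (hV δ i),
          hθ.pullbackTrace_cutoff_mul hτ hPM (hZ.inter (hV δ i)) (hT i)]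
        have h1 : ∫ x in Z ∩ V δ i, (N ^ 2)⁻¹ * (w x * traceSq (τf x) (fiber (T i) x)) ∂μ =
            ∫ x in Z ∩ V δ i, (N ^ 2)⁻¹ * W i x ∂μ := by
          refine integral_congr_ae (ae_restrict_of_ae ?_)
          filter_upwards [hW i] with x hx
          rw [← hx]
        rw [h1]
        refine (setIntegral_mono_on ((hWi i).const_mul _).integrableOn
          (hint.const_mul δ).integrableOn (hZ.inter (hV δ i)) fun x hx => hx.2).trans ?_
        exact setIntegral_mono_set (hint.const_mul δ).integrableOn
          (Eventually.of_forall fun x => by positivity)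
          (LE.le.eventuallyLE Set.inter_subset_left)
      · rw [re_apply_cutoff_mul_zero]
        exact integral_nonneg fun x => by positivity)
    (fun δ i Z hZ => by
      split_ifs with h
      · rw [cutoff_mul_cutoff_mul hZ (hV δ i),
          sliceFunctional_cutoff_mul g hQM (hZ.inter (hV δ i)) (hT i), hsq,
          setIntegral_indicator (hV δ i), integral_const_mul]
      · rw [re_apply_cutoff_mul_zero]
        simp)
  filter_upwards [key, ae_all_iff.2 hW, hw] with x h1 h2 h3 ε hε
  have hgx := hpos x
  obtain ⟨δ, hδ, hδi⟩ := h1 ((N ^ 2)⁻¹ * ε * g₀ x ^ 2) (by positivity)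
  -- Precisely the bound on the fiber that puts x into V δ i.
  refine ⟨N ^ 2 * (δ * g₀ x ^ 2) / w x, by positivity, fun i hi hi2 => ?_⟩
  have h4 : x ∈ V δ i := by
    change (N ^ 2)⁻¹ * W i x ≤ δ * g₀ x ^ 2
    rw [inv_mul_le_iff₀ (by positivity), ← h2 i, mul_comm]
    exact ((lt_div_iff₀ h3).1 hi2).le
  have h5 := hδi i
  rw [if_pos hi, Set.indicator_of_mem h4] at h5
  exact lt_of_mul_lt_mul_left (lt_of_mul_lt_mul_right h5 (by positivity)) (by positivity)

end MeasurableHilbertField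

/-- A functional relation compatible with the operations is the graph of a homomorphism. -/
theorem exists_starAlgHom_of_rel {𝕜 A B : Type*} [CommSemiring 𝕜] [StarRing 𝕜] [Semiring A]
    [StarRing A] [Algebra 𝕜 A] [Semiring B] [StarRing B] [Algebra 𝕜 B] {r : A → B → Prop}
    (hex : ∀ a, ∃ b, r a b) (huniq : ∀ a b b', r a b → r a b' → b = b')
    (hadd : ∀ a a' b b', r a b → r a' b' → r (a + a') (b + b'))
    (hmul : ∀ a a' b b', r a b → r a' b' → r (a * a') (b * b'))
    (hstar : ∀ a b, r a b → r (star a) (star b))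
    (hscalar : ∀ c, r (algebraMap 𝕜 A c) (algebraMap 𝕜 B c)) :
    ∃ Φ : A →⋆ₐ[𝕜] B, ∀ a, r a (Φ a) := by
  choose f hf using hex
  have h : ∀ a b, r a b → f a = b := fun a b hab => huniq a _ _ (hf a) hab
  exact ⟨{ toFun := f
           map_one' := h _ _ (by simpa using hscalar 1)
           map_mul' := fun a b => h _ _ (hmul _ _ _ _ (hf a) (hf b))
           map_zero' := h _ _ (by simpa using hscalar 0)
           map_add' := fun a b => h _ _ (hadd _ _ _ _ (hf a) (hf b))
           commutes' := fun c => h _ _ (hscalar c)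
           map_star' := fun a => h _ _ (hstar _ _ (hf a)) }, hf⟩

/-! ### Extension of bicontinuous homomorphisms to generated von Neumann algebras. -/

section Extension

variable {K L : Type*} [NormedAddCommGroup K] [InnerProductSpace ℂ K] [CompleteSpace K]
  [NormedAddCommGroup L] [InnerProductSpace ℂ L] [CompleteSpace L]
  {A : StarSubalgebra ℂ (K →L[ℂ] K)} {B : StarSubalgebra ℂ (L →L[ℂ] L)}
  {τ : A →ₗ[ℂ] ℂ} {σ : B →ₗ[ℂ] ℂ} {R : Subring A}

/-- The closure of the graph of `π` for bounded convergence in the `2`-norms. -/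
def IsLimitPair (τ : A →ₗ[ℂ] ℂ) (σ : B →ₗ[ℂ] ℂ) (π : R →+* B) (T : A) (S : B) : Prop :=
  ∃ a : ℕ → R, (∃ C, ∀ k, ‖(a k : A)‖ ≤ C) ∧
    Tendsto (fun k => traceSq τ ((a k : A) - T)) atTop (𝓝 0) ∧
    Tendsto (fun k => traceSq σ (π (a k) - S)) atTop (𝓝 0)

/-- A `*`-homomorphism of subrings that is contractive and bicontinuous, on bounded sets, for the
`2`-norms. -/
structure IsBicontinuousHom (τ : A →ₗ[ℂ] ℂ) (σ : B →ₗ[ℂ] ℂ) (π : R →+* B) : Prop where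
  star_mem : ∀ a ∈ R, star a ∈ R
  scalar_mem : ∀ n, algebraMap ℂ A (TopologicalSpace.denseSeq ℂ n) ∈ R
  map_star : ∀ S T : R, (S : A) = star (T : A) → π S = star (π T)
  map_scalar : ∀ n, ∀ T : R, (T : A) = algebraMap ℂ A (TopologicalSpace.denseSeq ℂ n) →
    π T = algebraMap ℂ B (TopologicalSpace.denseSeq ℂ n)
  norm_le : ∀ T : R, ‖π T‖ ≤ ‖(T : A)‖
  cont : ∀ N : ℝ, ∀ ε > 0, ∃ δ > 0, ∀ T : R, ‖(T : A)‖ ≤ N → traceSq τ (T : A) < δ →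
    traceSq σ (π T) < ε
  cont' : ∀ N : ℝ, ∀ ε > 0, ∃ δ > 0, ∀ T : R, ‖(T : A)‖ ≤ N → traceSq σ (π T) < δ →
    traceSq τ (T : A) < ε

namespace IsLimitPair

variable {π : R →+* B} {T T' : A} {S S' : B}

theorem of_mem (T : R) : IsLimitPair τ σ π T (π T) :=
  ⟨fun _ => T, ⟨‖(T : A)‖, fun _ => le_rfl⟩, by simp [traceSq], by simp [traceSq]⟩

theorem add (hτ : IsNormalTracial τ) (hσ : IsNormalTracial σ) (h : IsLimitPair τ σ π T S)
    (h' : IsLimitPair τ σ π T' S') : IsLimitPair τ σ π (T + T') (S + S') := by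
  obtain ⟨a, ⟨C, hC⟩, h1, h2⟩ := h
  obtain ⟨b, ⟨D, hD⟩, h3, h4⟩ := h'
  refine ⟨fun k => a k + b k, ⟨C + D, fun k => (norm_add_le _ _).trans (add_le_add (hC k) (hD k))⟩,
    ?_, ?_⟩
  · refine (hτ.tendsto_add h1 h3).congr fun k => ?_
    congr 1
    push_cast
    abel
  · refine (hσ.tendsto_add h2 h4).congr fun k => ?_
    congr 1
    rw [map_add]
    abel

theorem neg (h : IsLimitPair τ σ π T S) : IsLimitPair τ σ π (-T) (-S) := by
  obtain ⟨a, ⟨C, hC⟩, h1, h2⟩ := h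
  refine ⟨fun k => -a k, ⟨C, fun k => by simpa using hC k⟩, h1.congr fun k => ?_,
    h2.congr fun k => ?_⟩
  · rw [← IsNormalTracial.traceSq_neg]
    congr 1
    push_cast
    abel
  · rw [← IsNormalTracial.traceSq_neg, map_neg]
    congr 1
    abel

theorem mul (hτ : IsNormalTracial τ) (hσ : IsNormalTracial σ) (hπ : IsBicontinuousHom τ σ π)
    (h : IsLimitPair τ σ π T S) (h' : IsLimitPair τ σ π T' S') :
    IsLimitPair τ σ π (T * T') (S * S') := by
  obtain ⟨a, ⟨C, hC⟩, h1, h2⟩ := h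
  obtain ⟨b, ⟨D, hD⟩, h3, h4⟩ := h'
  refine ⟨fun k => a k * b k, ⟨C * D, fun k => (norm_mul_le _ _).trans
    (mul_le_mul (hC k) (hD k) (norm_nonneg _) ((norm_nonneg _).trans (hC k)))⟩, ?_, ?_⟩
  · refine (hτ.tendsto_add (hτ.tendsto_bounded_mul hC h3) (hτ.tendsto_mul_right T' h1)).congr
      fun k => ?_
    congr 1
    push_cast
    rw [mul_sub, sub_mul]
    abel
  · refine (hσ.tendsto_add (hσ.tendsto_bounded_mul (fun k => (hπ.norm_le (a k)).trans (hC k)) h4)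
      (hσ.tendsto_mul_right S' h2)).congr fun k => ?_
    congr 1
    rw [map_mul, mul_sub, sub_mul]
    abel

theorem star (hτ : IsNormalTracial τ) (hσ : IsNormalTracial σ) (hπ : IsBicontinuousHom τ σ π)
    (h : IsLimitPair τ σ π T S) : IsLimitPair τ σ π (star T) (star S) := by
  obtain ⟨a, ⟨C, hC⟩, h1, h2⟩ := h
  refine ⟨fun k => ⟨Star.star (a k : A), hπ.star_mem _ (a k).2⟩, ⟨C, fun k => ?_⟩,
    h1.congr fun k => ?_, h2.congr fun k => ?_⟩
  · exact (norm_star (a k : A)).trans_le (hC k)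
  · rw [← hτ.traceSq_star, star_sub]
  · rw [← hσ.traceSq_star, star_sub, hπ.map_star ⟨Star.star (a k : A), hπ.star_mem _ (a k).2⟩ (a k) rfl]

theorem scalar (hπ : IsBicontinuousHom τ σ π) (c : ℂ) :
    IsLimitPair τ σ π (algebraMap ℂ A c) (algebraMap ℂ B c) := by
  have hdense : ∀ k : ℕ, ∃ n, ‖TopologicalSpace.denseSeq ℂ n - c‖ < 1 / ((k : ℝ) + 1) := fun k => by
    obtain ⟨n, hn⟩ := (TopologicalSpace.denseRange_denseSeq ℂ).exists_dist_lt c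
      (by positivity : 0 < 1 / ((k : ℝ) + 1))
    exact ⟨n, by rwa [← dist_eq_norm, dist_comm]⟩
  choose n hn using hdense
  have hlim : Tendsto (fun k => ‖TopologicalSpace.denseSeq ℂ (n k) - c‖ ^ 2) atTop (𝓝 0) := by
    have h1 : Tendsto (fun k => ‖TopologicalSpace.denseSeq ℂ (n k) - c‖) atTop (𝓝 0) :=
      squeeze_zero (fun _ => norm_nonneg _) (fun k => (hn k).le)
        tendsto_one_div_add_atTop_nhds_zero_nat
    simpa using h1.pow 2
  refine ⟨fun k => ⟨_, hπ.scalar_mem (n k)⟩, ⟨(‖c‖ + 1) * ‖(1 : A)‖, fun k => ?_⟩, ?_, ?_⟩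
  · change ‖algebraMap ℂ A (TopologicalSpace.denseSeq ℂ (n k))‖ ≤ _
    rw [Algebra.algebraMap_eq_smul_one]
    refine (norm_smul_le _ _).trans (mul_le_mul_of_nonneg_right ?_ (norm_nonneg _))
    have h1 : 1 / ((k : ℝ) + 1) ≤ 1 := by
      rw [div_le_one (by positivity)]
      linarith [(Nat.cast_nonneg k : (0 : ℝ) ≤ k)]
    have h2 := norm_add_le (TopologicalSpace.denseSeq ℂ (n k) - c) c
    rw [sub_add_cancel] at h2
    linarith [hn k]
  · have h1 := hlim.mul_const (traceSq τ 1)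
    rw [zero_mul] at h1
    refine h1.congr fun k => ?_
    change _ = traceSq τ (algebraMap ℂ A (TopologicalSpace.denseSeq ℂ (n k)) - _)
    rw [← IsNormalTracial.traceSq_smul, sub_smul, Algebra.algebraMap_eq_smul_one,
      Algebra.algebraMap_eq_smul_one]
  · have h1 := hlim.mul_const (traceSq σ 1)
    rw [zero_mul] at h1
    refine h1.congr fun k => ?_
    rw [← IsNormalTracial.traceSq_smul, sub_smul, hπ.map_scalar (n k) _ rfl,
      Algebra.algebraMap_eq_smul_one, Algebra.algebraMap_eq_smul_one]

/-- Continuity of π for the 2-norms on bounded sets makes the limit relation single-valued. -/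
theorem eq_zero (hσ : IsNormalTracial σ) (hπ : IsBicontinuousHom τ σ π)
    (h : IsLimitPair τ σ π 0 S) : S = 0 := by
  obtain ⟨a, ⟨C, hC⟩, h1, h2⟩ := h
  simp only [sub_zero] at h1
  refine hσ.eq_of_tendsto h2 (c := 0) ?_
  rw [Metric.tendsto_atTop]
  intro ε hε
  obtain ⟨δ, hδ, hδa⟩ := hπ.cont C ε hε
  obtain ⟨n, hn⟩ := eventually_atTop.1 (h1.eventually_lt_const hδ)
  refine ⟨n, fun k hk => ?_⟩
  rw [sub_zero, Real.dist_0_eq_abs, abs_of_nonneg (hσ.nonneg _)]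
  exact hδa _ (hC k) (hn k hk)

/-- Continuity of the inverse makes the limit relation injective. -/
theorem eq_zero' (hτ : IsNormalTracial τ) (hπ : IsBicontinuousHom τ σ π)
    (h : IsLimitPair τ σ π T 0) : T = 0 := by
  obtain ⟨a, ⟨C, hC⟩, h1, h2⟩ := h
  simp only [sub_zero] at h2
  refine hτ.eq_of_tendsto h1 (c := 0) ?_
  rw [Metric.tendsto_atTop]
  intro ε hε
  obtain ⟨δ, hδ, hδa⟩ := hπ.cont' C ε hε
  obtain ⟨n, hn⟩ := eventually_atTop.1 (h2.eventually_lt_const hδ)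
  refine ⟨n, fun k hk => ?_⟩
  rw [sub_zero, Real.dist_0_eq_abs, abs_of_nonneg (hτ.nonneg _)]
  exact hδa _ (hC k) (hn k hk)

theorem unique (hτ : IsNormalTracial τ) (hσ : IsNormalTracial σ) (hπ : IsBicontinuousHom τ σ π)
    (h : IsLimitPair τ σ π T S) (h' : IsLimitPair τ σ π T S') : S = S' := by
  have h1 := h.add hτ hσ h'.neg
  rw [add_neg_cancel] at h1
  exact add_neg_eq_zero.1 (h1.eq_zero hσ hπ)

end IsLimitPair

namespace IsBicontinuousHom

variable {π : R →+* B}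

/-- Kaplansky density approximates T boundedly from R. The images are bounded and Cauchy in the
2-norm of σ, hence converge. The explicit bound 2‖T‖ + 2 allows estimates uniform in T. -/
theorem exists_isLimitPair (hτ : IsNormalTracial τ) (hσ : IsNormalTracial σ)
    (hπ : IsBicontinuousHom τ σ π) (T : A)
    (hT : (T : K →L[ℂ] K) ∈ generatedVonNeumannAlgebra ((fun a : A => (a : K →L[ℂ] K)) '' R)) :
    ∃ (S : B) (a : ℕ → R), (∀ k, ‖(a k : A)‖ ≤ 2 * ‖T‖ + 2) ∧
      Tendsto (fun k => traceSq τ ((a k : A) - T)) atTop (𝓝 0) ∧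
      Tendsto (fun k => traceSq σ (π (a k) - S)) atTop (𝓝 0) := by
  let R' : Subring (K →L[ℂ] K) := R.map A.subtype.toRingHom
  have hR' : ∀ a, a ∈ R' ↔ ∃ r ∈ R, (r : K →L[ℂ] K) = a := fun a => Subring.mem_map
  obtain ⟨a, haR, haC, ha⟩ := hτ.exists_seq_tendsto R'
    (by
      intro a ha
      obtain ⟨r, hr, rfl⟩ := (hR' a).1 ha
      exact (hR' _).2 ⟨star r, hπ.star_mem r hr, rfl⟩)
    (algebraMap_mem_topologicalClosure fun n => (hR' _).2 ⟨_, hπ.scalar_mem n, rfl⟩)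
    (by
      intro a ha
      obtain ⟨r, hr, rfl⟩ := (hR' a).1 ha
      exact r.2) T (by
      refine generatedVonNeumannAlgebra_le ?_ hT
      rintro _ ⟨r, hr, rfl⟩
      exact subset_generatedVonNeumannAlgebra ((hR' _).2 ⟨r, hr, rfl⟩))
  have haR' : ∀ k, a k ∈ R := fun k => by
    obtain ⟨r, hr, h⟩ := (hR' _).1 (haR k)
    rwa [← Subtype.ext h]
  let b : ℕ → R := fun k => ⟨a k, haR' k⟩
  obtain ⟨S, hS, -⟩ := hσ.exists_limit (a := fun k => π (b k))
    ⟨2 * ‖T‖ + 2, fun k => (hπ.norm_le (b k)).trans (haC k)⟩ (by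
      intro ε hε
      obtain ⟨δ, hδ, hδa⟩ := hπ.cont ((2 * ‖T‖ + 2) + (2 * ‖T‖ + 2)) ε hε
      obtain ⟨n, hn⟩ := hτ.cauchy_of_tendsto ha δ hδ
      refine ⟨n, fun k hk l hl => ?_⟩
      rw [← map_sub]
      refine hδa (b k - b l) ((norm_sub_le _ _).trans (add_le_add (haC k) (haC l))) ?_
      exact hn k hk l hl)
  exact ⟨S, b, haC, ha, hS⟩

theorem traceSq_lt (hτ : IsNormalTracial τ) (hσ : IsNormalTracial σ)
    (hπ : IsBicontinuousHom τ σ π) (N : ℝ) {ε : ℝ} (hε : 0 < ε) :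
    ∃ δ > 0, ∀ (T : A) (S : B),
      (T : K →L[ℂ] K) ∈ generatedVonNeumannAlgebra ((fun a : A => (a : K →L[ℂ] K)) '' R) →
      IsLimitPair τ σ π T S → ‖T‖ ≤ N →
      (traceSq τ T < δ → traceSq σ S < ε) ∧ (traceSq σ S < δ → traceSq τ T < ε) := by
  obtain ⟨δ, hδ, h⟩ := hπ.cont (2 * N + 2) (ε / 4) (by positivity)
  obtain ⟨δ', hδ', h'⟩ := hπ.cont' (2 * N + 2) (ε / 4) (by positivity)
  -- With ‖a - T‖₂² and ‖T‖₂² both below δ/4 the inequality with the factors 2 gives ‖a‖₂² < δ; in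
  -- the same way ε/4 returns ε after passing to the limit pair. The norm bound 2N + 2 is the one of
  -- the Kaplansky approximants.
  refine ⟨min δ δ' / 4, by positivity, fun T S hT hTS hN => ?_⟩
  obtain ⟨S', a, haC, h1, h2⟩ := hπ.exists_isLimitPair hτ hσ T hT
  obtain rfl := IsLimitPair.unique hτ hσ hπ hTS ⟨a, ⟨_, haC⟩, h1, h2⟩
  have haN : ∀ k, ‖(a k : A)‖ ≤ 2 * N + 2 := fun k => (haC k).trans (by linarith)
  have hmin : 0 < min δ δ' / 4 := by positivity
  have hle := min_le_left δ δ'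
  have hle' := min_le_right δ δ'
  obtain ⟨k, ⟨hk1, hk2⟩, hk3, hk4⟩ := (((h1.eventually_lt_const hmin).and
    (h2.eventually_lt_const hmin)).and ((h1.eventually_lt_const (by positivity : 0 < ε / 4)).and
      (h2.eventually_lt_const (by positivity : 0 < ε / 4)))).exists
  have e1 := hτ.traceSq_sub_le (a k : A) T 0
  have e2 := hσ.traceSq_sub_le (π (a k)) S 0
  have e3 := hτ.traceSq_sub_le T (a k : A) 0
  have e4 := hσ.traceSq_sub_le S (π (a k)) 0
  rw [IsNormalTracial.traceSq_sub_comm T (a k : A)] at e3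
  rw [IsNormalTracial.traceSq_sub_comm S (π (a k))] at e4
  simp only [sub_zero] at e1 e2 e3 e4
  refine ⟨fun h3 => ?_, fun h3 => ?_⟩
  · have := h (a k) (haN k) (by linarith)
    linarith
  · have := h' (a k) (haN k) (by linarith)
    linarith

/-- A bicontinuous homomorphism extends to the generated von Neumann algebra. -/
theorem exists_starAlgHom (hτ : IsNormalTracial τ) (hσ : IsNormalTracial σ)
    (hπ : IsBicontinuousHom τ σ π) {G : StarSubalgebra ℂ (K →L[ℂ] K)}
    (hG : ∀ t ∈ G, t ∈ generatedVonNeumannAlgebra ((fun a : A => (a : K →L[ℂ] K)) '' R))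
    (hGA : G ≤ A) :
    ∃ Φ : G →⋆ₐ[ℂ] B, ∀ t, IsLimitPair τ σ π (StarSubalgebra.inclusion hGA t) (Φ t) :=
  exists_starAlgHom_of_rel (r := fun t S => IsLimitPair τ σ π (StarSubalgebra.inclusion hGA t) S)
    (fun t => by
      obtain ⟨S, a, haC, h1, h2⟩ :=
        hπ.exists_isLimitPair hτ hσ (StarSubalgebra.inclusion hGA t) (hG t t.2)
      exact ⟨S, a, ⟨_, haC⟩, h1, h2⟩)
    (fun _ _ _ h h' => h.unique hτ hσ hπ h')
    (fun _ _ _ _ h h' => by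
      rw [map_add]
      exact h.add hτ hσ h')
    (fun _ _ _ _ h h' => by
      rw [map_mul]
      exact h.mul hτ hσ hπ h')
    (fun _ _ h => by
      rw [StarHomClass.map_star]
      exact h.star hτ hσ hπ)
    (fun c => by
      rw [AlgHomClass.commutes]
      exact IsLimitPair.scalar hπ c)

/-- The extension of a bicontinuous homomorphism to the generated von Neumann algebra is injective
and its range is closed under bounded limits. -/
theorem exists_extension (hτ : IsNormalTracial τ) (hσ : IsNormalTracial σ)
    (hπ : IsBicontinuousHom τ σ π) {G : VonNeumannAlgebra K}
    (hG : ∀ t ∈ G, t ∈ generatedVonNeumannAlgebra ((fun a : A => (a : K →L[ℂ] K)) '' R))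
    (hGA : G.toStarSubalgebra ≤ A) :
    ∃ Φ : G.toStarSubalgebra →⋆ₐ[ℂ] B, Function.Injective Φ ∧
      (∀ t, IsLimitPair τ σ π (StarSubalgebra.inclusion hGA t) (Φ t)) ∧
      ∀ (t : ℕ → G.toStarSubalgebra) (c : B), (∃ C, ∀ k, ‖Φ (t k)‖ ≤ C) →
        Tendsto (fun k => traceSq σ (Φ (t k) - c)) atTop (𝓝 0) → ∃ s, Φ s = c := by
  obtain ⟨Φ, hf⟩ := hπ.exists_starAlgHom hτ hσ hG hGA
  have hinj : Function.Injective Φ := by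
    rw [injective_iff_map_eq_zero]
    intro t ht
    have h1 := hf t
    rw [ht] at h1
    have h2 := h1.eq_zero' hτ hπ
    exact StarSubalgebra.inclusion_injective hGA (h2.trans (map_zero _).symm)
  refine ⟨Φ, hinj, hf, ?_⟩
  rintro t c ⟨C, hC⟩ hbc
  have := G.isClosed_coe
  -- An injective *-homomorphism of C*-algebras is isometric, so bounded images have bounded
  -- preimages, and the preimages converge by bicontinuity.
  have hnorm' : ∀ k, ‖t k‖ ≤ C := fun k => by
    have h1 : ‖B.subtype.comp Φ (t k)‖ = ‖t k‖ :=
      NonUnitalStarAlgHom.norm_map (B.subtype.comp Φ) (Subtype.val_injective.comp hinj) (t k)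
    exact h1.symm.trans_le (hC k)
  have hnorm : ∀ k, ‖StarSubalgebra.inclusion hGA (t k)‖ ≤ C := hnorm'
  have hpair : ∀ s s', IsLimitPair τ σ π
      (StarSubalgebra.inclusion hGA s - StarSubalgebra.inclusion hGA s') (Φ s - Φ s') :=
    fun s s' => by
      have := hf (s - s')
      rwa [map_sub, map_sub] at this
  have hmem : ∀ s s' : G.toStarSubalgebra,
      ((StarSubalgebra.inclusion hGA s - StarSubalgebra.inclusion hGA s' : A) : K →L[ℂ] K) ∈
        generatedVonNeumannAlgebra ((fun a : A => (a : K →L[ℂ] K)) '' R) :=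
    fun s s' => hG _ (s - s').2
  obtain ⟨T, hT, hTv⟩ := hτ.exists_limit (a := fun k => StarSubalgebra.inclusion hGA (t k))
    ⟨C, hnorm⟩ (by
      intro ε hε
      obtain ⟨δ, hδ, h⟩ := hπ.traceSq_lt hτ hσ (C + C) hε
      obtain ⟨n, hn⟩ := hσ.cauchy_of_tendsto hbc δ hδ
      refine ⟨n, fun k hk l hl => ?_⟩
      exact (h _ _ (hmem _ _) (hpair (t k) (t l))
        ((norm_sub_le _ _).trans (add_le_add (hnorm k) (hnorm l)))).2 (hn k hk l hl))
  have hTG : (T : K →L[ℂ] K) ∈ G := G.mem_of_strong_limit (fun k => (t k).2) hTv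
  obtain ⟨s, rfl⟩ : ∃ s, StarSubalgebra.inclusion hGA s = T := ⟨⟨T, hTG⟩, rfl⟩
  refine ⟨s, hσ.eq_of_tendsto (a := fun k => Φ (t k)) ?_ hbc⟩
  rw [Metric.tendsto_atTop]
  intro ε hε
  obtain ⟨δ, hδ, h⟩ := hπ.traceSq_lt hτ hσ (C + ‖StarSubalgebra.inclusion hGA s‖) hε
  obtain ⟨n, hn⟩ := eventually_atTop.1 (hT.eventually_lt_const hδ)
  refine ⟨n, fun k hk => ?_⟩
  rw [Real.dist_0_eq_abs, abs_of_nonneg (hσ.nonneg _)]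
  exact (h _ _ (hmem _ _) (hpair (t k) s)
    ((norm_sub_le _ _).trans (add_le_add (hnorm k) le_rfl))).1 (hn k hk)

end IsBicontinuousHom

end Extension

set_option maxHeartbeats 800000 in
/-- The generators of a von Neumann algebra generate a `*`-algebra that is sequentially dense for
functionals which are absolutely continuous with respect to the slices of a normal trace. -/
theorem IsNormalTracial.exists_seq_adjoin_tendsto {K L : Type*} [NormedAddCommGroup K]
    [InnerProductSpace ℂ K] [CompleteSpace K] [NormedAddCommGroup L] [InnerProductSpace ℂ L]
    [CompleteSpace L] {M : StarSubalgebra ℂ (K →L[ℂ] K)} {τ : M →ₗ[ℂ] ℂ} (hτ : IsNormalTracial τ)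
    {A : VonNeumannAlgebra L} {G : Set (L →L[ℂ] L)} (hGA : G ⊆ A)
    (hAG : ∀ a ∈ A, a ∈ generatedVonNeumannAlgebra G) {J : K →L[ℂ] L}
    (hJ : ∀ T ∈ A, J.adjoint ∘L T ∘L J ∈ M) {φ : A.toStarSubalgebra →ₗ[ℂ] ℂ}
    (hφ : ∀ ε > 0, ∃ δ > 0, ∀ e : A.toStarSubalgebra, (0 : L →L[ℂ] L) ≤ e →
      (e : L →L[ℂ] L) ≤ 1 → (sliceFunctional τ J hJ e).re < δ → (φ e).re < ε)
    (a : A.toStarSubalgebra) :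
    ∃ T : ℕ → A.toStarSubalgebra, (∀ k, (T k : L →L[ℂ] L) ∈ StarAlgebra.adjoin ℂ G) ∧
      (∃ C, ∀ k, ‖T k‖ ≤ C) ∧
      ∀ ε > 0, ∀ᶠ k in atTop, (φ (star (T k - a) * (T k - a))).re < ε := by
  obtain ⟨η, hη⟩ := hτ.cont
  obtain ⟨T, hT, hTη⟩ := kaplansky_density (StarAlgebra.adjoin ℂ G) (T := a)
    (fun S hS => mem_generatedVonNeumannAlgebra_iff.1 (hAG a a.2) S fun b hb =>
      hS b (StarAlgebra.subset_adjoin ℂ G hb)) (fun n => J (η n))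
  have hTA : ∀ k, T k ∈ A.toStarSubalgebra := fun k => StarAlgebra.adjoin_le hGA (hT k).1
  let N : ℝ := 2 * ‖(a : L →L[ℂ] L)‖ + 1 + ‖(a : L →L[ℂ] L)‖
  have hN : 0 < N := by positivity
  have hTN : ∀ k, ‖T k - a‖ ≤ N := fun k =>
    (norm_sub_le _ _).trans (add_le_add (hT k).2 le_rfl)
  let T' : ℕ → A.toStarSubalgebra := fun k => ⟨T k, hTA k⟩
  -- Normalizing |T k - a|² by the uniform bound N puts it into the positive unit ball, where
  -- absolute continuity transfers smallness from the slice to φ.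
  let e : ℕ → A.toStarSubalgebra := fun k =>
    (((N ^ 2)⁻¹ : ℝ) : ℂ) • (star (T' k - a) * (T' k - a))
  have he : ∀ k, (e k : L →L[ℂ] L) = (((N ^ 2)⁻¹ : ℝ) : ℂ) • (star (T k - a) * (T k - a)) :=
    fun k => rfl
  have hnorm : ∀ k, ‖(e k : L →L[ℂ] L)‖ ≤ 1 := fun k => by
    rw [he, norm_smul, CStarRing.norm_star_mul_self, Complex.norm_real, Real.norm_eq_abs,
      abs_of_nonneg (by positivity), inv_mul_le_iff₀ (by positivity), mul_one, sq]
    exact mul_self_le_mul_self (norm_nonneg _) (hTN k)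
  have hlim : Tendsto (fun k => sliceFunctional τ J hJ (e k)) atTop (𝓝 0) := by
    refine hτ.tendsto_apply (hη (fun k => ⟨_, hJ (e k) (e k).2⟩)
      ⟨‖J.adjoint‖ * (1 * ‖J‖), fun k => ?_⟩ fun n => ?_)
    · refine (ContinuousLinearMap.opNorm_comp_le _ _).trans
        (mul_le_mul_of_nonneg_left ?_ (norm_nonneg _))
      exact (ContinuousLinearMap.opNorm_comp_le _ _).trans
        (mul_le_mul_of_nonneg_right (hnorm k) (norm_nonneg _))
    · have h1 : Tendsto (fun k => (T k - (a : L →L[ℂ] L)) (J (η n))) atTop (𝓝 0) := by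
        have := (hTη n).sub_const ((a : L →L[ℂ] L) (J (η n)))
        simpa using this
      have h2 : Tendsto (fun k => (e k : L →L[ℂ] L) (J (η n))) atTop (𝓝 0) := by
        have h3 : Tendsto (fun k => (N ^ 2)⁻¹ * (N * ‖(T k - (a : L →L[ℂ] L)) (J (η n))‖))
            atTop (𝓝 0) := by
          have := (h1.norm.const_mul N).const_mul ((N ^ 2)⁻¹)
          simpa using this
        refine squeeze_zero_norm (fun k => ?_) h3
        rw [he, smul_apply, norm_smul, Complex.norm_real, Real.norm_eq_abs,
          abs_of_nonneg (by positivity)]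
        refine mul_le_mul_of_nonneg_left ?_ (by positivity)
        exact ContinuousLinearMap.le_of_opNorm_le _
          ((norm_star (T k - (a : L →L[ℂ] L))).trans_le (hTN k)) _
      have h4 := (J.adjoint.continuous.tendsto 0).comp h2
      rw [map_zero] at h4
      exact h4
  refine ⟨T', fun k => (hT k).1, ⟨_, fun k => (hT k).2⟩, fun ε hε => ?_⟩
  obtain ⟨δ, hδ, h⟩ := hφ ((N ^ 2)⁻¹ * ε) (by positivity)
  have hre : Tendsto (fun k => (sliceFunctional τ J hJ (e k)).re) atTop (𝓝 0) :=
    (Complex.continuous_re.tendsto _).comp hlim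
  filter_upwards [hre.eventually_lt_const hδ] with k hk
  have h0 : (0 : L →L[ℂ] L) ≤ e k := 
    scaled_star_mul_self_nonneg (T k - (a : L →L[ℂ] L)) (by positivity)
  have h1 := h (e k) h0 (scaled_star_mul_self_le_one hN (hTN k)) hk
  have h2 : (φ (e k)).re = (N ^ 2)⁻¹ * (φ (star (T' k - a) * (T' k - a))).re := by
    rw [map_smul, smul_eq_mul, Complex.re_ofReal_mul]
  rw [h2] at h1
  exact lt_of_mul_lt_mul_left h1 (by positivity)

/-! ### Fibers contained in closed *-algebras: countably many operators suffice. -/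

namespace MeasurableHilbertField

variable {X : Type u} [MeasurableSpace X] {μ : Measure X} {H : X → Type v}
  [∀ x, NormedAddCommGroup (H x)] [∀ x, InnerProductSpace ℂ (H x)] [∀ x, CompleteSpace (H x)]
  {F : MeasurableHilbertField μ H} {M P : ∀ x, VonNeumannAlgebra (H x)}
  [SigmaFinite μ] {τf : ∀ x, (M x).toStarSubalgebra →ₗ[ℂ] ℂ}
  {τ : F.integralAlgebra M →ₗ[ℂ] ℂ} {w : X → ℝ} {Q : VonNeumannAlgebra F.DirectIntegral}

/-- Convergence in the `2`-norm of the direct integral gives convergence in the `2`-norms of the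
fibers, along a subsequence. -/
theorem IsIntegralTrace.exists_subseq_tendsto (hτ : F.IsIntegralTrace w τ τf)
    (hτf : ∀ᵐ x ∂μ, IsFaithfulNormalTrace (τf x)) (hw : ∀ᵐ x ∂μ, 0 < w x)
    {T : ℕ → F.integralAlgebra M} (hT : Tendsto (fun k => traceSq τ (T k)) atTop (𝓝 0)) :
    ∃ n : ℕ → ℕ, ∀ᵐ x ∂μ, Tendsto (fun k => traceSq (τf x) (fiber (T (n k)) x)) atTop (𝓝 0) := by
  let f : ℕ → X → ℝ := fun k x => w x * traceSq (τf x) (fiber (T k) x)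
  have hf : ∀ k, Integrable (f k) μ := fun k => (hτ.traceSq_eq (T k)).1
  have hf0 : ∀ k, 0 ≤ᵐ[μ] f k := fun k => by
    filter_upwards [hτf, hw] with x h1 h2 using mul_nonneg h2.le (h1.isNormalTracial.nonneg _)
  have hlim : Tendsto (fun k => eLpNorm (f k - 0) 1 μ) atTop (𝓝 0) := by
    have h1 : ∀ k, eLpNorm (f k - 0) 1 μ = ENNReal.ofReal (traceSq τ (T k)) := fun k => by
      rw [sub_zero, eLpNorm_one_eq_lintegral_enorm, (hτ.traceSq_eq (T k)).2,
        ofReal_integral_eq_lintegral_ofReal (hf k) (hf0 k)]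
      refine lintegral_congr_ae ?_
      filter_upwards [hf0 k] with x hx
      exact Real.enorm_of_nonneg hx
    simp only [h1]
    have := ENNReal.tendsto_ofReal hT
    rwa [ENNReal.ofReal_zero] at this
  -- The squared 2-norm is the L¹ norm of the field w τ_x(T_x*T_x), and L¹ convergence gives almost
  -- everywhere convergence along a subsequence.
  obtain ⟨n, -, hn⟩ := (tendstoInMeasure_of_tendsto_eLpNorm one_ne_zero
    (fun k => (hf k).aestronglyMeasurable) aestronglyMeasurable_zero hlim).exists_seq_tendsto_ae
  refine ⟨n, ?_⟩
  filter_upwards [hn, hw] with x h1 h2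
  have h3 := h1.const_mul (w x)⁻¹
  simp only [f, Pi.zero_apply, mul_zero] at h3
  refine h3.congr fun k => ?_
  rw [inv_mul_cancel_left₀ h2.ne']

/-- Almost every fiber of an element of the `*`-algebra generated by some operators belongs to every
`*`-algebra that contains the fibers of suitable countably many operators. -/
theorem exists_countable_of_mem_adjoin {B : Type*} [Ring B] [StarRing B] [Algebra ℂ B]
    [StarModule ℂ B] {A : StarSubalgebra ℂ B} (Ψ : A →⋆ₐ[ℂ] F.integralAlgebra M)
    {Y₀ : Set (F.integralAlgebra M)} {G : Set B} (hGA : StarAlgebra.adjoin ℂ G ≤ A)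
    (hG : ∀ T : A, (T : B) ∈ G → ∃ Y ⊆ Y₀, Y.Countable ∧
      ∀ᵐ x ∂μ, ∀ D : StarSubalgebra ℂ (H x →L[ℂ] H x),
        (∀ y ∈ Y, (fiber y x : H x →L[ℂ] H x) ∈ D) → (fiber (Ψ T) x : H x →L[ℂ] H x) ∈ D)
    {b : B} (hb : b ∈ StarAlgebra.adjoin ℂ G) :
    ∃ Y ⊆ Y₀, Y.Countable ∧ ∀ᵐ x ∂μ, ∀ D : StarSubalgebra ℂ (H x →L[ℂ] H x),
      (∀ y ∈ Y, (fiber y x : H x →L[ℂ] H x) ∈ D) →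
        (fiber (Ψ ⟨b, hGA hb⟩) x : H x →L[ℂ] H x) ∈ D := by
  induction hb using StarAlgebra.adjoin_induction with
  | mem b hb => exact hG _ hb
  | algebraMap c =>
    refine ⟨∅, Set.empty_subset _, Set.countable_empty, ?_⟩
    filter_upwards [fiber_algebraMap F M c] with x hx D _
    have h1 : Ψ ⟨algebraMap ℂ B c, hGA (algebraMap_mem _ c)⟩ = algebraMap ℂ _ c :=
      AlgHomClass.commutes Ψ c
    rw [h1, hx]
    exact D.algebraMap_mem' c
  | add a b ha hb iha ihb =>
    obtain ⟨Y, hY0, hYc, hY⟩ := iha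
    obtain ⟨Y', hY0', hYc', hY'⟩ := ihb
    refine ⟨Y ∪ Y', Set.union_subset hY0 hY0', hYc.union hYc', ?_⟩
    filter_upwards [hY, hY', fiber_add (Ψ ⟨a, hGA ha⟩) (Ψ ⟨b, hGA hb⟩)] with x h1 h2 h3 D hD
    have h4 : Ψ ⟨a + b, hGA (add_mem ha hb)⟩ = Ψ ⟨a, hGA ha⟩ + Ψ ⟨b, hGA hb⟩ := by
      rw [← map_add]; rfl
    rw [h4, h3]
    exact add_mem (h1 D fun y hy => hD y (Or.inl hy)) (h2 D fun y hy => hD y (Or.inr hy))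
  | mul a b ha hb iha ihb =>
    obtain ⟨Y, hY0, hYc, hY⟩ := iha
    obtain ⟨Y', hY0', hYc', hY'⟩ := ihb
    refine ⟨Y ∪ Y', Set.union_subset hY0 hY0', hYc.union hYc', ?_⟩
    filter_upwards [hY, hY', fiber_mul (Ψ ⟨a, hGA ha⟩) (Ψ ⟨b, hGA hb⟩)] with x h1 h2 h3 D hD
    have h4 : Ψ ⟨a * b, hGA (mul_mem ha hb)⟩ = Ψ ⟨a, hGA ha⟩ * Ψ ⟨b, hGA hb⟩ := by
      rw [← map_mul]; rfl
    rw [h4, h3]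
    exact mul_mem (h1 D fun y hy => hD y (Or.inl hy)) (h2 D fun y hy => hD y (Or.inr hy))
  | star a ha iha =>
    obtain ⟨Y, hY0, hYc, hY⟩ := iha
    refine ⟨Y, hY0, hYc, ?_⟩
    filter_upwards [hY, fiber_star (Ψ ⟨a, hGA ha⟩)] with x h1 h3 D hD
    have h4 : Ψ ⟨star a, hGA (star_mem ha)⟩ = star (Ψ ⟨a, hGA ha⟩) := by
      rw [← StarHomClass.map_star]; rfl
    rw [h4, h3]
    exact star_mem (h1 D hD)

end MeasurableHilbertField

theorem VonNeumannAlgebra.norm_starAlgHom_apply_le {K L : Type*} [NormedAddCommGroup K]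
    [InnerProductSpace ℂ K] [CompleteSpace K] [NormedAddCommGroup L] [InnerProductSpace ℂ L]
    [CompleteSpace L] {A : VonNeumannAlgebra K} {B : StarSubalgebra ℂ (L →L[ℂ] L)}
    (Ψ : A.toStarSubalgebra →⋆ₐ[ℂ] B) (a : A.toStarSubalgebra) : ‖Ψ a‖ ≤ ‖a‖ :=
  have := A.isClosed_coe
  NonUnitalStarAlgHom.norm_apply_le (B.subtype.comp Ψ) a

section

variable {K : Type*} [NormedAddCommGroup K] [InnerProductSpace ℂ K] [CompleteSpace K]
  {A : StarSubalgebra ℂ (K →L[ℂ] K)}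

/-- `D` is closed, in `A`, under limits of bounded sequences for the `2`-norm of `τ`. -/
def IsBoundedlyClosed (τ : A →ₗ[ℂ] ℂ) (D : StarSubalgebra ℂ (K →L[ℂ] K)) : Prop :=
  ∀ (b : ℕ → A) (c : A), (∃ C, ∀ k, ‖b k‖ ≤ C) → (∀ k, (b k : K →L[ℂ] K) ∈ D) →
    Tendsto (fun k => traceSq τ (b k - c)) atTop (𝓝 0) → (c : K →L[ℂ] K) ∈ D

theorem IsNormalTracial.isBoundedlyClosed {τ : A →ₗ[ℂ] ℂ} (hτ : IsNormalTracial τ)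
    (B : VonNeumannAlgebra K) : IsBoundedlyClosed τ B.toStarSubalgebra := by
  intro b c hC hb hbc
  obtain ⟨T, hT, hTv⟩ := hτ.exists_limit hC (hτ.cauchy_of_tendsto hbc)
  rw [← hτ.eq_of_tendsto hT hbc]
  exact B.mem_of_strong_limit hb hTv

/-- Kaplansky density is applied to D ⊓ A, where the 2-norm is defined; bounded convergence on the
vectors controlling τ is 2-norm convergence, under which D is closed. -/
theorem IsBoundedlyClosed.generatedVonNeumannAlgebra_le {τ : A →ₗ[ℂ] ℂ} (hτ : IsNormalTracial τ)
    {D : StarSubalgebra ℂ (K →L[ℂ] K)} (hD : IsBoundedlyClosed τ D) {s : Set (K →L[ℂ] K)}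
    (hs : ∀ a ∈ s, a ∈ D) (hsA : ∀ a ∈ generatedVonNeumannAlgebra s, a ∈ A) :
    ∀ a ∈ generatedVonNeumannAlgebra s, a ∈ D := by
  intro T hT
  obtain ⟨η, hη⟩ := hτ.cont
  obtain ⟨a, ha, haη⟩ := kaplansky_density (D ⊓ A) (T := T)
    (fun S hS => mem_generatedVonNeumannAlgebra_iff.1 hT S fun b hb =>
      hS b ⟨hs b hb, hsA b (subset_generatedVonNeumannAlgebra hb)⟩) η
  refine hD (fun k => ⟨a k, (ha k).1.2⟩) ⟨T, hsA T hT⟩ ⟨_, fun k => (ha k).2⟩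
    (fun k => (ha k).1.1) ?_
  refine hη _ ⟨2 * ‖T‖ + 1 + ‖T‖, fun k => ?_⟩ fun n => ?_
  · exact (norm_sub_le _ _).trans (add_le_add (ha k).2 le_rfl)
  · have := (haη n).sub_const (T (η n))
    simpa using this

end

namespace MeasurableHilbertField

variable {X : Type u} [MeasurableSpace X] {μ : Measure X} {H : X → Type v}
  [∀ x, NormedAddCommGroup (H x)] [∀ x, InnerProductSpace ℂ (H x)] [∀ x, CompleteSpace (H x)]
  {F : MeasurableHilbertField μ H} {M P : ∀ x, VonNeumannAlgebra (H x)}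
  [SigmaFinite μ] {τf : ∀ x, (M x).toStarSubalgebra →ₗ[ℂ] ℂ}
  {τ : F.integralAlgebra M →ₗ[ℂ] ℂ} {w : X → ℝ} {Q : VonNeumannAlgebra F.DirectIntegral}
  {θ : (linftyTensor μ Q).toStarSubalgebra ≃⋆ₐ[ℂ] F.integralAlgebra P}

/-- Almost every fiber of an element of the range of `Ψ` belongs to every closed `*`-algebra that
contains the fibers of suitable countably many operators. -/
theorem exists_countable_of_exists_seq {L : Type*} [NormedAddCommGroup L] [InnerProductSpace ℂ L]
    [CompleteSpace L] {A : StarSubalgebra ℂ (L →L[ℂ] L)} (hτ : F.IsIntegralTrace w τ τf)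
    (hτf : ∀ᵐ x ∂μ, IsFaithfulNormalTrace (τf x)) (hw : ∀ᵐ x ∂μ, 0 < w x)
    (Ψ : A →⋆ₐ[ℂ] F.integralAlgebra M) (hΨ : ∀ a, ‖Ψ a‖ ≤ ‖a‖)
    {Y₀ : Set (F.integralAlgebra M)} {G : Set (L →L[ℂ] L)}
    (hGA : StarAlgebra.adjoin ℂ G ≤ A)
    (hG : ∀ T : A, (T : L →L[ℂ] L) ∈ G → ∃ Y ⊆ Y₀, Y.Countable ∧
      ∀ᵐ x ∂μ, ∀ D : StarSubalgebra ℂ (H x →L[ℂ] H x),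
        (∀ y ∈ Y, (fiber y x : H x →L[ℂ] H x) ∈ D) → (fiber (Ψ T) x : H x →L[ℂ] H x) ∈ D)
    {a : A} (ha : ∃ T : ℕ → A, (∀ k, (T k : L →L[ℂ] L) ∈ StarAlgebra.adjoin ℂ G) ∧
      (∃ C, ∀ k, ‖T k‖ ≤ C) ∧
      ∀ ε > 0, ∀ᶠ k in atTop, (τ (Ψ (star (T k - a) * (T k - a)))).re < ε) :
    ∃ Y ⊆ Y₀, Y.Countable ∧ ∀ᵐ x ∂μ, ∀ D : StarSubalgebra ℂ (H x →L[ℂ] H x),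
      IsBoundedlyClosed (τf x) D → (∀ y ∈ Y, (fiber y x : H x →L[ℂ] H x) ∈ D) →
        (fiber (Ψ a) x : H x →L[ℂ] H x) ∈ D := by
  obtain ⟨T, hT, ⟨C, hC⟩, hlim⟩ := ha
  have hN := hτ.isNormalTracial hτf hw
  choose Y hY₀ hYc hY using fun k => exists_countable_of_mem_adjoin Ψ hGA hG (hT k)
  have hlim' : Tendsto (fun k => traceSq τ (Ψ (T k) - Ψ a)) atTop (𝓝 0) := by
    rw [Metric.tendsto_atTop]
    intro ε hε
    obtain ⟨n, hn⟩ := eventually_atTop.1 (hlim ε hε)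
    refine ⟨n, fun k hk => ?_⟩
    rw [Real.dist_0_eq_abs, abs_of_nonneg (hN.nonneg _)]
    have := hn k hk
    rwa [map_mul, StarHomClass.map_star, map_sub] at this
  obtain ⟨n, hn⟩ := hτ.exists_subseq_tendsto hτf hw hlim'
  refine ⟨⋃ k, Y k, Set.iUnion_subset hY₀, Set.countable_iUnion hYc, ?_⟩
  filter_upwards [hn, ae_all_iff.2 hY, ae_all_iff.2 fun k => fiber_sub (Ψ (T k)) (Ψ a),
    ae_all_iff.2 fun k => fiber_norm_le (Ψ (T k))] with x h1 h2 h3 h4 D hD hYD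
  refine hD (fun k => fiber (Ψ (T (n k))) x) _
    ⟨C, fun k => (h4 _).trans ((hΨ _).trans (hC _))⟩
    (fun k => h2 (n k) D fun y hy => hYD y (Set.mem_iUnion_of_mem _ hy)) ?_
  refine h1.congr fun k => ?_
  rw [h3]

set_option maxHeartbeats 400000 in
/-- Almost every fiber of an element of `L^∞(X, μ) ⊗̄ Q` belongs to every closed `*`-algebra that
contains the fibers of suitable countably many elements of `Q`. -/
theorem IsTensorIso.exists_countable (hθ : IsTensorIso θ) (hτ : F.IsIntegralTrace w τ τf)
    (hτf : ∀ᵐ x ∂μ, IsFaithfulNormalTrace (τf x)) (hw : ∀ᵐ x ∂μ, 0 < w x)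
    (hPM : F.integralAlgebra P ≤ F.integralAlgebra M)
    (hQM : Q.toStarSubalgebra ≤ F.integralAlgebra M) (p : F.integralAlgebra P) :
    ∃ Y ⊆ {T : F.integralAlgebra M | (T : F.DirectIntegral →L[ℂ] F.DirectIntegral) ∈ Q},
      Y.Countable ∧ ∀ᵐ x ∂μ, ∀ D : StarSubalgebra ℂ (H x →L[ℂ] H x),
        IsBoundedlyClosed (τf x) D → (∀ y ∈ Y, (fiber y x : H x →L[ℂ] H x) ∈ D) →
          (fiber (StarSubalgebra.inclusion hPM p) x : H x →L[ℂ] H x) ∈ D := by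
  have hN := hτ.isNormalTracial hτf hw
  obtain ⟨g₀, g, hg₀, hpos, hg, -, -⟩ := exists_pos_memLp_two μ
  have hac := (absolutelyContinuous_pullbackTrace_sliceFunctional θ hN hPM hQM hg₀ hpos hg).1
  let Ψ : (linftyTensor μ Q).toStarSubalgebra →⋆ₐ[ℂ] F.integralAlgebra M :=
    (StarSubalgebra.inclusion hPM).comp (θ : _ →⋆ₐ[ℂ] F.integralAlgebra P)
  have hΨ : ∀ a, Ψ a = StarSubalgebra.inclusion hPM (θ a) := fun _ => rfl
  let G : Set (Lp F.DirectIntegral 2 μ →L[ℂ] Lp F.DirectIntegral 2 μ) :=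
    {S | ∃ f : Lp ℂ ∞ μ, S = (ContinuousLinearMap.lsmul ℂ ℂ).holderL μ ∞ 2 2 f} ∪
      {S | ∃ q ∈ Q, S = q.compLpL 2 μ}
  have hGA : ∀ a ∈ G, a ∈ linftyTensor μ Q := fun a ha => subset_generatedVonNeumannAlgebra ha
  have key := hN.exists_seq_adjoin_tendsto (A := linftyTensor μ Q) (G := G) hGA
    (fun a ha => ha) (fun S hS => hQM (slice_mem g S hS)) hac (θ.symm p)
  have := exists_countable_of_exists_seq hτ hτf hw Ψ (fun a => ?_)
    (Y₀ := {T : F.integralAlgebra M | (T : F.DirectIntegral →L[ℂ] F.DirectIntegral) ∈ Q})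
    (StarAlgebra.adjoin_le hGA) ?_ key
  · rwa [hΨ, θ.apply_symm_apply] at this
  · exact VonNeumannAlgebra.norm_starAlgHom_apply_le Ψ a
  · rintro T (⟨f, hf⟩ | ⟨q, hq, hT⟩)
    -- Fibers of diagonal operators are scalars and belong to every D, so only the generators 1 ⊗ q
    -- contribute to Y.
    · refine ⟨∅, Set.empty_subset _, Set.countable_empty, ?_⟩
      filter_upwards [fiber_ae_eq (T := Ψ T) (hθ.1 f T hf)] with x hx D _
      rw [hx]
      exact D.smul_mem (one_mem D) _
    · have h1 : ((Ψ T : F.integralAlgebra M) : F.DirectIntegral →L[ℂ] F.DirectIntegral) = q :=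
        hθ.2 q hq T hT
      refine ⟨{Ψ T}, ?_, Set.countable_singleton _, Eventually.of_forall fun x D hD => hD _ rfl⟩
      rintro _ rfl
      change ((Ψ T : F.integralAlgebra M) : F.DirectIntegral →L[ℂ] F.DirectIntegral) ∈ Q
      rwa [h1]

/-- Almost every fiber of `L^∞(X, μ) ⊗̄ Q` is contained in every closed `*`-algebra that contains
the fibers of suitable countably many elements of `Q`. -/
theorem IsTensorIso.exists_countable_forall_le (hθ : IsTensorIso θ)
    (hτ : F.IsIntegralTrace w τ τf)
    (hτf : ∀ᵐ x ∂μ, IsFaithfulNormalTrace (τf x)) (hw : ∀ᵐ x ∂μ, 0 < w x)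
    (hP : F.IsMeasurableAlgebraField P) (hPM : F.integralAlgebra P ≤ F.integralAlgebra M)
    (hQM : Q.toStarSubalgebra ≤ F.integralAlgebra M) :
    ∃ Y ⊆ {T : F.integralAlgebra M | (T : F.DirectIntegral →L[ℂ] F.DirectIntegral) ∈ Q},
      Y.Countable ∧ ∀ᵐ x ∂μ, ∀ D : StarSubalgebra ℂ (H x →L[ℂ] H x),
        IsBoundedlyClosed (τf x) D → (∀ y ∈ Y, (fiber y x : H x →L[ℂ] H x) ∈ D) →
          (P x).toStarSubalgebra ≤ D := by
  obtain ⟨p, hp⟩ := hP.exists_generators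
  choose Y hY₀ hYc hY using fun n => hθ.exists_countable hτ hτf hw hPM hQM (p n)
  refine ⟨⋃ k, Y k, Set.iUnion_subset hY₀, Set.countable_iUnion hYc, ?_⟩
  filter_upwards [hτf, hp, ae_le_of_integralAlgebra_le hP hPM, ae_all_iff.2 hY,
    ae_all_iff.2 fun n => fiber_ae_eq (T := StarSubalgebra.inclusion hPM (p n))
      (isIntegralOf_fiber (p n))] with x h1 h2 h3 h4 h5 D hD hYD a ha
  have h6 : ∀ a ∈ generatedVonNeumannAlgebra
      (Set.range fun n => (fiber (p n) x : H x →L[ℂ] H x)), a ∈ (M x).toStarSubalgebra := by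
    rw [← h2]
    exact fun a ha => h3 ha
  refine hD.generatedVonNeumannAlgebra_le h1.isNormalTracial ?_ h6 a (h2 ▸ ha)
  rintro _ ⟨n, rfl⟩
  change (fiber (p n) x : H x →L[ℂ] H x) ∈ D
  rw [← h5 n]
  exact h4 n D hD fun y hy => hYD y (Set.mem_iUnion_of_mem _ hy)

end MeasurableHilbertField

/-! ### Identification of Q with almost every fiber. -/

namespace MeasurableHilbertField

variable {X : Type u} [MeasurableSpace X] {μ : Measure X} {H : X → Type v}
  [∀ x, NormedAddCommGroup (H x)] [∀ x, InnerProductSpace ℂ (H x)] [∀ x, CompleteSpace (H x)]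
  {F : MeasurableHilbertField μ H} {M P : ∀ x, VonNeumannAlgebra (H x)}
  {τf : ∀ x, (M x).toStarSubalgebra →ₗ[ℂ] ℂ}
  {τ : F.integralAlgebra M →ₗ[ℂ] ℂ} {w : X → ℝ} {Q : VonNeumannAlgebra F.DirectIntegral}
  {θ : (linftyTensor μ Q).toStarSubalgebra ≃⋆ₐ[ℂ] F.integralAlgebra P}

/-- A countable set of elements of `Q` is contained in a countable `*`-subring of `Q` with a dense
set of scalars. -/
theorem exists_countable_star_subring_of_subset
    (hQM : Q.toStarSubalgebra ≤ F.integralAlgebra M) {Y : Set (F.integralAlgebra M)}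
    (hYc : Y.Countable)
    (hY : ∀ T ∈ Y, (T : F.DirectIntegral →L[ℂ] F.DirectIntegral) ∈ Q) :
    ∃ R : Subring (F.integralAlgebra M), (R : Set (F.integralAlgebra M)).Countable ∧
      (∀ a ∈ R, star a ∈ R) ∧
      (∀ n, algebraMap ℂ (F.integralAlgebra M) (TopologicalSpace.denseSeq ℂ n) ∈ R) ∧
      (∀ T ∈ R, (T : F.DirectIntegral →L[ℂ] F.DirectIntegral) ∈ Q) ∧ Y ⊆ R := by
  obtain ⟨y, hy⟩ := (hYc.insert 0).exists_eq_range (Set.insert_nonempty _ _)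
  have hyQ : ∀ n, (y n : F.DirectIntegral →L[ℂ] F.DirectIntegral) ∈ Q.toStarSubalgebra :=
    fun n => by
      have h : y n ∈ insert 0 Y := hy ▸ ⟨n, rfl⟩
      rcases h with h | h
      · rw [h]
        exact zero_mem Q
      · exact hY _ h
  obtain ⟨R, hRc, hRs, hRn, hRy⟩ :=
    exists_countable_star_subring (A := Q.toStarSubalgebra) fun n => ⟨y n, hyQ n⟩
  let ι : Q.toStarSubalgebra →+* F.integralAlgebra M :=
    (StarSubalgebra.inclusion hQM : Q.toStarSubalgebra →⋆ₐ[ℂ] F.integralAlgebra M)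
  refine ⟨R.map ι, hRc.image _, ?_, fun n => ⟨_, hRn n, rfl⟩, ?_, fun T hT => ?_⟩
  · rintro _ ⟨a, ha, rfl⟩
    exact ⟨star a, hRs a ha, rfl⟩
  · rintro _ ⟨a, -, rfl⟩
    exact a.2
  · have h : T ∈ Set.range y := hy ▸ Set.mem_insert_of_mem _ hT
    obtain ⟨n, rfl⟩ := h
    exact ⟨_, hRy n, rfl⟩

variable [SigmaFinite μ]

/-- The two comparisons of 2-norms are uniform only over a countable family and a fixed norm bound;
the bounds n + 1 exhaust R off a countable union of null sets. -/
theorem IsTensorIso.ae_exists_isBicontinuousHom (hθ : IsTensorIso θ)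
    (hτ : F.IsIntegralTrace w τ τf)
    (hτf : ∀ᵐ x ∂μ, IsFaithfulNormalTrace (τf x)) (hw : ∀ᵐ x ∂μ, 0 < w x)
    (hPM : F.integralAlgebra P ≤ F.integralAlgebra M)
    (hQM : Q.toStarSubalgebra ≤ F.integralAlgebra M) {R : Subring (F.integralAlgebra M)}
    (hRc : (R : Set (F.integralAlgebra M)).Countable) (hRs : ∀ a ∈ R, star a ∈ R)
    (hRn : ∀ n, algebraMap ℂ (F.integralAlgebra M) (TopologicalSpace.denseSeq ℂ n) ∈ R)
    (hRQ : ∀ T ∈ R, (T : F.DirectIntegral →L[ℂ] F.DirectIntegral) ∈ Q) :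
    ∀ᵐ x ∂μ, ∃ π : R →+* (M x).toStarSubalgebra,
      (∀ T : R, π T = fiber (T : F.integralAlgebra M) x) ∧ IsBicontinuousHom τ (τf x) π := by
  obtain ⟨T, hT⟩ := hRc.exists_eq_range ⟨0, R.zero_mem⟩
  have hTQ : ∀ i, (T i : F.DirectIntegral →L[ℂ] F.DirectIntegral) ∈ Q := fun i =>
    hRQ _ (hT ▸ Set.mem_range_self i : T i ∈ (R : Set (F.integralAlgebra M)))
  have hRT : ∀ S : R, ∃ i, T i = S := fun S => by
    have : (S : F.integralAlgebra M) ∈ Set.range T := hT ▸ S.2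
    exact this
  filter_upwards [ae_exists_ringHom hRc,
    ae_all_iff.2 fun n : ℕ => hθ.ae_traceSq_fiber_lt hτ hτf hw hPM hQM hTQ
      (N := (n : ℝ) + 1) (by positivity),
    ae_all_iff.2 fun n : ℕ => hθ.ae_traceSq_lt hτ hτf hw hPM hQM hTQ
      (N := (n : ℝ) + 1) (by positivity)] with x h1 h2 h3
  obtain ⟨π, hπ, hstar, hscal, hnorm⟩ := h1
  refine ⟨π, hπ, hRs, hRn, hstar, hscal, hnorm, fun N ε hε => ?_, fun N ε hε => ?_⟩
  · obtain ⟨n, hn⟩ := exists_nat_ge N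
    obtain ⟨δ, hδ, h⟩ := h2 n ε hε
    refine ⟨δ, hδ, fun S hS hSδ => ?_⟩
    obtain ⟨i, hi⟩ := hRT S
    rw [hπ, ← hi]
    exact h i (by rw [hi]; linarith) (by rwa [hi])
  · obtain ⟨n, hn⟩ := exists_nat_ge N
    obtain ⟨δ, hδ, h⟩ := h3 n ε hε
    refine ⟨δ, hδ, fun S hS hSδ => ?_⟩
    obtain ⟨i, hi⟩ := hRT S
    rw [hπ] at hSδ
    rw [← hi]
    exact h i (by rw [hi]; linarith) (by rwa [hi])

/-- If the fibers of a countable `*`-subring of `Q` generate almost every `P x`, the von Neumann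
algebra that it generates is isomorphic to almost every `P x`. -/
theorem IsTensorIso.ae_exists_embedding (hθ : IsTensorIso θ)
    (hτ : F.IsIntegralTrace w τ τf)
    (hτf : ∀ᵐ x ∂μ, IsFaithfulNormalTrace (τf x)) (hw : ∀ᵐ x ∂μ, 0 < w x)
    (hPM : F.integralAlgebra P ≤ F.integralAlgebra M)
    (hQM : Q.toStarSubalgebra ≤ F.integralAlgebra M) {R : Subring (F.integralAlgebra M)}
    (hRc : (R : Set (F.integralAlgebra M)).Countable) (hRs : ∀ a ∈ R, star a ∈ R)
    (hRn : ∀ n, algebraMap ℂ (F.integralAlgebra M) (TopologicalSpace.denseSeq ℂ n) ∈ R)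
    (hRQ : ∀ T ∈ R, (T : F.DirectIntegral →L[ℂ] F.DirectIntegral) ∈ Q)
    (hRP : ∀ᵐ x ∂μ, ∀ D : StarSubalgebra ℂ (H x →L[ℂ] H x),
      IsBoundedlyClosed (τf x) D → (∀ y ∈ R, (fiber y x : H x →L[ℂ] H x) ∈ D) →
        (P x).toStarSubalgebra ≤ D)
    {G : VonNeumannAlgebra F.DirectIntegral} (hGM : G.toStarSubalgebra ≤ F.integralAlgebra M)
    (hRG : ∀ T ∈ R, (T : F.DirectIntegral →L[ℂ] F.DirectIntegral) ∈ G)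
    (hG : ∀ t ∈ G, t ∈ generatedVonNeumannAlgebra
      ((fun a : F.integralAlgebra M => (a : F.DirectIntegral →L[ℂ] F.DirectIntegral)) '' R)) :
    ∀ᵐ x ∂μ, ∃ π : R →+* (M x).toStarSubalgebra,
      (∀ T : R, π T = fiber (T : F.integralAlgebra M) x) ∧ IsBicontinuousHom τ (τf x) π ∧
      ∃ Φ : G.toStarSubalgebra →⋆ₐ[ℂ] (M x).toStarSubalgebra, Function.Injective Φ ∧
        (∀ t, IsLimitPair τ (τf x) π (StarSubalgebra.inclusion hGM t) (Φ t)) ∧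
        (∀ t, (Φ t : H x →L[ℂ] H x) ∈ P x) ∧ ∀ S ∈ P x, ∃ t, (Φ t : H x →L[ℂ] H x) = S := by
  have hN := hτ.isNormalTracial hτf hw
  have : Countable R := hRc.to_subtype
  filter_upwards [hτf, hθ.ae_exists_isBicontinuousHom hτ hτf hw hPM hQM hRc hRs hRn hRQ, hRP,
    ae_all_iff.2 fun T : R => ae_mem_of_mem_integralAlgebra (hθ.mem (hRQ T T.2))
      (isIntegralOf_fiber (T : F.integralAlgebra M))] with x h1 h2 h3 h4
  have hNx := h1.isNormalTracial
  obtain ⟨π, hπ, hbi⟩ := h2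
  obtain ⟨Φ, hinj, hpair, hclosed⟩ := hbi.exists_extension hN hNx hG hGM
  refine ⟨π, hπ, hbi, Φ, hinj, hpair, fun t => ?_, fun S hS => ?_⟩
  · obtain ⟨a, ⟨C, hC⟩, -, ha⟩ := hpair t
    refine hNx.isBoundedlyClosed (P x) (fun k => π (a k)) (Φ t)
      ⟨C, fun k => (hbi.norm_le _).trans (hC k)⟩ (fun k => ?_) ha
    rw [hπ]
    exact h4 (a k)
  -- The range of Φ contains the fibers of R and is closed under bounded 2-norm limits, so by the
  -- choice of R it contains P x.
  · let D : StarSubalgebra ℂ (H x →L[ℂ] H x) :=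
      ((M x).toStarSubalgebra.subtype.comp Φ).range
    have hD : IsBoundedlyClosed (τf x) D := by
      intro b c hC hb hbc
      choose t ht using hb
      have ht' : ∀ k, Φ (t k) = b k := fun k => Subtype.ext (ht k)
      obtain ⟨s, hs⟩ := hclosed t c (by simpa only [ht'] using hC) (by simpa only [ht'] using hbc)
      exact ⟨s, congrArg Subtype.val hs⟩
    obtain ⟨t, ht⟩ := h3 D hD (fun y hy => by
      refine ⟨⟨y, hRG y hy⟩, congrArg Subtype.val ?_⟩
      have h5 := (hpair ⟨y, hRG y hy⟩).unique hN hNx hbi (IsLimitPair.of_mem ⟨y, hy⟩)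
      exact h5.trans (hπ ⟨y, hy⟩)) hS
    exact ⟨t, ht⟩

/-- If the fibers of a countable `*`-subring of `Q` generate almost every `P x`, the subring
generates `Q`. -/
theorem IsTensorIso.mem_generatedVonNeumannAlgebra [NeZero μ] (hθ : IsTensorIso θ)
    (hτ : F.IsIntegralTrace w τ τf)
    (hτf : ∀ᵐ x ∂μ, IsFaithfulNormalTrace (τf x)) (hw : ∀ᵐ x ∂μ, 0 < w x)
    (hPM : F.integralAlgebra P ≤ F.integralAlgebra M)
    (hQM : Q.toStarSubalgebra ≤ F.integralAlgebra M) {R : Subring (F.integralAlgebra M)}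
    (hRc : (R : Set (F.integralAlgebra M)).Countable) (hRs : ∀ a ∈ R, star a ∈ R)
    (hRn : ∀ n, algebraMap ℂ (F.integralAlgebra M) (TopologicalSpace.denseSeq ℂ n) ∈ R)
    (hRQ : ∀ T ∈ R, (T : F.DirectIntegral →L[ℂ] F.DirectIntegral) ∈ Q)
    (hRP : ∀ᵐ x ∂μ, ∀ D : StarSubalgebra ℂ (H x →L[ℂ] H x),
      IsBoundedlyClosed (τf x) D → (∀ y ∈ R, (fiber y x : H x →L[ℂ] H x) ∈ D) →
        (P x).toStarSubalgebra ≤ D)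
    {q : F.DirectIntegral →L[ℂ] F.DirectIntegral} (hq : q ∈ Q) :
    q ∈ generatedVonNeumannAlgebra
      ((fun a : F.integralAlgebra M => (a : F.DirectIntegral →L[ℂ] F.DirectIntegral)) '' R) := by
  have hN := hτ.isNormalTracial hτf hw
  -- The subring enlarged by q also has fibers generating P x, so both W*(R) and W*(R') map
  -- isomorphically onto P x at almost every x.
  obtain ⟨R', hRc', hRs', hRn', hRQ', hRR'⟩ := exists_countable_star_subring_of_subset hQM
    (hRc.insert ⟨q, hQM hq⟩) (by
      rintro T (rfl | hT)
      · exact hq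
      · exact hRQ T hT)
  have hsub : R ≤ R' := fun T hT => hRR' (Set.mem_insert_of_mem _ hT)
  have hgen : ∀ R₀ : Subring (F.integralAlgebra M),
      (∀ T ∈ R₀, (T : F.DirectIntegral →L[ℂ] F.DirectIntegral) ∈ Q) →
      (generatedVonNeumannAlgebra ((fun a : F.integralAlgebra M =>
        (a : F.DirectIntegral →L[ℂ] F.DirectIntegral)) '' R₀)).toStarSubalgebra ≤
          F.integralAlgebra M := fun R₀ h t ht => by
    refine hQM (generatedVonNeumannAlgebra_le ?_ ht)
    rintro _ ⟨T, hT, rfl⟩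
    exact h T hT
  have hx := (hθ.ae_exists_embedding hτ hτf hw hPM hQM hRc hRs hRn hRQ hRP (hgen R hRQ)
    (fun T hT => subset_generatedVonNeumannAlgebra ⟨T, hT, rfl⟩) fun _ ht => ht).and
    ((hθ.ae_exists_embedding hτ hτf hw hPM hQM hRc' hRs' hRn' hRQ'
      (by filter_upwards [hRP] with x hx D hD hy using hx D hD fun y h => hy y (hsub h))
      (hgen R' hRQ') (fun T hT => subset_generatedVonNeumannAlgebra ⟨T, hT, rfl⟩)
      fun _ ht => ht).and hτf)
  obtain ⟨x, ⟨π, hπ, -, Φ, -, hpair, -, hsurj⟩,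
    ⟨π', hπ', hbi', Φ', hinj', hpair', hmem', -⟩, h1⟩ := hx.exists
  have hqR' : (⟨q, hQM hq⟩ : F.integralAlgebra M) ∈ R' := hRR' (Set.mem_insert _ _)
  obtain ⟨s, hs⟩ := hsurj _ (hmem' ⟨q, subset_generatedVonNeumannAlgebra ⟨_, hqR', rfl⟩⟩)
  have hs' : (s : F.DirectIntegral →L[ℂ] F.DirectIntegral) ∈ generatedVonNeumannAlgebra
      ((fun a : F.integralAlgebra M =>
        (a : F.DirectIntegral →L[ℂ] F.DirectIntegral)) '' R') := by
    refine generatedVonNeumannAlgebra_le ?_ s.2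
    rintro _ ⟨T, hT, rfl⟩
    exact subset_generatedVonNeumannAlgebra ⟨T, hsub hT, rfl⟩
  -- Choose s in W*(R) with the same image in P x as q. A sequence of R approximating s also lies in
  -- R', so Φ' maps s to Φ s = Φ' q, and injectivity of Φ' gives s = q. One point x is enough, which
  -- is why μ ≠ 0.
  obtain ⟨a, haC, ha1, ha2⟩ := hpair s
  have h2 : IsLimitPair τ (τf x) π' (StarSubalgebra.inclusion (hgen R' hRQ') ⟨s, hs'⟩) (Φ s) := by
    refine ⟨fun k => ⟨a k, hsub (a k).2⟩, haC, ha1, ha2.congr fun k => ?_⟩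
    rw [hπ, hπ']
  have h3 := (hpair' ⟨s, hs'⟩).unique hN h1.isNormalTracial hbi' h2
  have h4 := congrArg Subtype.val (hinj' (h3.trans (Subtype.ext hs)))
  change (s : F.DirectIntegral →L[ℂ] F.DirectIntegral) = q at h4
  rw [← h4]
  exact s.2

/-- If `∫^⊕ P x dμ(x) = L^∞(X, μ) ⊗̄ Q`, almost every `P x` is isomorphic to `Q`. -/
theorem IsLinftyTensor.ae_nonempty_starAlgEquiv
    (hQ : F.IsLinftyTensor (F.integralAlgebra P) Q) (hτ : F.IsIntegralTrace w τ τf)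
    (hτf : ∀ᵐ x ∂μ, IsFaithfulNormalTrace (τf x)) (hw : ∀ᵐ x ∂μ, 0 < w x)
    (hP : F.IsMeasurableAlgebraField P) (hPM : F.integralAlgebra P ≤ F.integralAlgebra M) :
    ∀ᵐ x ∂μ, Nonempty (Q.toStarSubalgebra ≃⋆ₐ[ℂ] (P x).toStarSubalgebra) := by
  -- For μ = 0 the claim is vacuous; otherwise almost every point can be replaced by an actual
  -- point, as the generation lemma requires.
  rcases eq_or_ne μ 0 with rfl | hμ
  · rw [ae_zero]
    exact eventually_bot
  have : NeZero μ := ⟨hμ⟩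
  obtain ⟨θ, hθ⟩ := hQ
  replace hθ : IsTensorIso θ := hθ
  have hQM : Q.toStarSubalgebra ≤ F.integralAlgebra M := fun q hq => hPM (hθ.mem hq)
  obtain ⟨Y, hYQ, hYc, hY⟩ := hθ.exists_countable_forall_le hτ hτf hw hP hPM hQM
  obtain ⟨R, hRc, hRs, hRn, hRQ, hYR⟩ :=
    exists_countable_star_subring_of_subset hQM hYc fun T hT => hYQ hT
  have hRP : ∀ᵐ x ∂μ, ∀ D : StarSubalgebra ℂ (H x →L[ℂ] H x),
      IsBoundedlyClosed (τf x) D → (∀ y ∈ R, (fiber y x : H x →L[ℂ] H x) ∈ D) →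
        (P x).toStarSubalgebra ≤ D := by
    filter_upwards [hY] with x hx D hD hy using hx D hD fun y h => hy y (hYR h)
  filter_upwards [hθ.ae_exists_embedding hτ hτf hw hPM hQM hRc hRs hRn hRQ hRP hQM hRQ
    fun q hq => hθ.mem_generatedVonNeumannAlgebra hτ hτf hw hPM hQM hRc hRs hRn hRQ hRP hq]
    with x hx
  obtain ⟨-, -, -, Φ, hinj, -, hmem, hsurj⟩ := hx
  let f : Q.toStarSubalgebra →⋆ₐ[ℂ] (P x).toStarSubalgebra :=
    StarAlgHom.codRestrict ((M x).toStarSubalgebra.subtype.comp Φ) (P x).toStarSubalgebra hmem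
  refine ⟨StarAlgEquiv.ofBijective f ⟨fun s t hst => ?_, fun S => ?_⟩⟩
  · have h : (f s : H x →L[ℂ] H x) = f t := by rw [hst]
    exact hinj (Subtype.ext h)
  · obtain ⟨t, ht⟩ := hsurj S S.2
    exact ⟨t, Subtype.ext ht⟩

end MeasurableHilbertField

end OperatorAlgebras

theorem mainTheorem11 {X : Type u} [TopologicalSpace X] [T2Space X] [LocallyCompactSpace X]
    [SigmaCompactSpace X] [MeasurableSpace X] [BorelSpace X]
    (μ : Measure X) [μ.Regular]
    {H : X → Type v} [∀ x, NormedAddCommGroup (H x)] [∀ x, InnerProductSpace ℂ (H x)]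
    [∀ x, CompleteSpace (H x)] (F : MeasurableHilbertField μ H)
    -- the measurable field of tracial von Neumann algebras `(M x, τf x)` on `H x`
    (M : ∀ x, VonNeumannAlgebra (H x)) (hM : F.IsMeasurableAlgebraField M)
    (τf : ∀ x, (M x).toStarSubalgebra →ₗ[ℂ] ℂ) (hτf : ∀ᵐ x ∂μ, IsFaithfulNormalTrace (τf x))
    -- the trace of the direct integral
    (τ : F.integralAlgebra M →ₗ[ℂ] ℂ) (w : X → ℝ) (hw : ∀ᵐ x ∂μ, 0 < w x)
    (hτ : F.IsIntegralTrace w τ τf)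
    -- the intermediate algebra, given by its direct integral decomposition
    (P : ∀ x, VonNeumannAlgebra (H x)) (hP : F.IsMeasurableAlgebraField P)
    (hindex : IsFiniteIndex τ (F.integralAlgebra P)) :
    (∀ᵐ x ∂μ, IsFiniteIndex (τf x) (P x).toStarSubalgebra) ∧
    ∀ Q : VonNeumannAlgebra F.DirectIntegral, F.IsLinftyTensor (F.integralAlgebra P) Q →
      ∀ᵐ x ∂μ, ∃ N : VonNeumannAlgebra (H x),
        Nonempty (Q.toStarSubalgebra ≃⋆ₐ[ℂ] N.toStarSubalgebra) ∧
        IsFiniteIndex (τf x) N.toStarSubalgebra := by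
  -- A Radon measure is finite on compact sets, so σ-compactness supplies the σ-finiteness of μ used
  -- throughout.
  have hN := hτ.ae_isFiniteIndex hM hτf hw hP hindex
  refine ⟨hN, fun Q hQ => ?_⟩
  filter_upwards [hN, hQ.ae_nonempty_starAlgEquiv hτ hτf hw hP hindex.1] with x h1 h2
  exact ⟨P x, h2, h1⟩
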